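/- **Knowledge bases.** Let $N_C,N_R,N_I$ be pairwise disjoint sets of concept names, role names and individual names, with $N_I\neq\emptyset$. Atomic roles are $r$ and $r^-$ for $r\in N_R$, with $\mathrm{Inv}(r)=r^-$ and $\mathrm{Inv}(r^-)=r$. Role expressions are built from atomic roles with $\neg,\sqcap,\sqcup$; such an expression is *restricted* if it evaluates to false when all atomic roles are false. Concepts are given by $$C::= A\mid\top\mid\bot\mid\neg C\mid C\sqcap C\mid C\sqcup C\mid\forall U.C\mid\exists U.C\mid{\leqslant}n\,R.C\mid{\geqslant}(n{+}1)\,R.C$$ with $A\in N_C$, $U$ a restricted role expression, $R$ an atomic role, $n\ge 0$. An extended $\mathcal{SHIQ}b_s$ knowledge base $K=(\mathcal T,\mathcal R,\mathcal P)$ consists of three finite sets: a TBox of axioms $C\sqsubseteq D$; an RBox of axioms $U\sqsubseteq V$ ($U,V$ restricted) and $\mathrm{Trans}(R)$ ($R$ atomic); and a set of DL-safe rules $B\to H$, where $B,H$ are finite conjunctions of atoms $A(t),r(t,s),t\approx s$ with $A\in N_C$, $r\in N_R$ and $t,s$ variables or individual names (for an inverse role, $r^-(t,s)$ denotes $r(s,t)$).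 The *non-simple* atomic roles form the least set that contains $R$ if $\mathrm{Trans}(R)\in\mathcal R$, contains $S$ if it contains $R$ and $R\sqsubseteq S\in\mathcal R$ with $R,S$ atomic, and is closed under $\mathrm{Inv}$. Non-atomic role expressions contain only simple roles, number restrictions use only simple roles, and in an axiom $U\sqsubseteq V$ whose right-hand side is not atomic, $U$ contains only simple roles. An interpretation $I$ has a domain, an element $a^I$ for each $a\in N_I$, a subset for each concept name and a binary relation for each role name. It is extended to role and concept expressions, and satisfies TBox and RBox axioms, as usual in description logics. It satisfies $B\to H$ if, for every assignment of the variables to elements of $\{a^I\mid a\in N_I\}$ that makes all atoms of $B$ true, $H$ is non-empty and all its atoms are true (the empty head is false). Satisfiability and entailment ($\models$) refer to all interpretations satisfying all of $\mathcal T,\mathcal R,\mathcal P$. **Auxiliary notions.** *Fresh* names lie outside $N_C\cup N_R\cup N_I$ and do not occur in the knowledge base at hand. Below, $C\sqsubseteq D$ is also written as the universally valid concept $\neg C\sqcup D$, and a concept $C$ listed as an axiom means $\top\sqsubseteq C$. $\mathrm{NNF}$ denotes negation normal form. $\mathrm{parts}(C)$ is the set of concept names, $\top$, $\bot$ and quantified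 subconcepts (those starting with $\forall,\exists,\leqslant,\geqslant$) of $C$, at any depth; $\mathrm{parts}$ of a set of axioms is the union. A *flattening* $\mathrm{FLAT}(K)$ is obtained from $K$ by putting the TBox into NNF and exhaustively replacing outermost occurrences of $\mathsf QU.D$ with $\mathsf Q\in\{\exists,\forall,{\leqslant}n,{\geqslant}n\}$ and $D$ not a concept name by $\mathsf QU.F$ with $F$ a fresh concept name, adding the axiom $\neg F\sqcup D$ if $\mathsf Q\in\{\exists,\forall,{\geqslant}n\}$ and $\mathrm{NNF}(\neg D)\sqcup F$ if $\mathsf Q={\leqslant}n$. **The transformation** $\Theta_{\mathcal{SHIQ}}(K)=\Theta_F\Theta_\leqslant\Theta_H\Theta_\geqslant\Theta_S(K)$. * $\Theta_S$. Call $R$ *transitive* if $\mathrm{Trans}(R)$ or $\mathrm{Trans}(\mathrm{Inv}(R))$ is in $K$. Let $\sqsubseteq^*$ be the least reflexive transitive relation on non-simple atomic roles with $R\sqsubseteq^*S$ and $\mathrm{Inv}(R)\sqsubseteq^*\mathrm{Inv}(S)$ for each axiom $R\sqsubseteq S$ ($R$ non-simple, $R,S$ atomic). Let $cl(K)$ be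 the least set of concepts that contains $\mathrm{NNF}(\neg C\sqcup D)$ for all TBox axioms $C\sqsubseteq D$, is closed under subconcepts, contains $\mathrm{NNF}(\neg C)$ whenever it contains ${\leqslant}n\,R.C$, and contains $\forall S.C$ whenever it contains $\forall R.C$ with $S\sqsubseteq^*R$ and $S$ transitive. $\Theta_S(K)$ arises by deleting all transitivity axioms and adding, for each transitive $R$: the axioms $\forall R.C\sqsubseteq\forall R.\forall R.C$ for all $\forall R.C\in cl(K)$; the axiom $\exists(R\sqcap\mathrm{Inv}(R)).\top\sqsubseteq\mathit{Self}_R$ with $\mathit{Self}_R$ a fresh concept name (distinct for distinct $R$); and the rules $\mathit{Self}_R(x)\to R(x,x)$ and $R(x,y),R(y,z)\to R(x,z)$. * $\Theta_\geqslant$. Flatten, then exhaustively replace occurrences of ${\geqslant}n\,R.A$ by $\exists R_1.A\sqcap\dots\sqcap\exists R_n.A$ with distinct fresh role names $R_i$, adding $R_i\sqsubseteq R$ for all $i$ and $\forall(R_i\sqcap R_k).\bot$ for $i<k$. * $\Theta_H$. Replace every $U\sqsubseteq V$ in the RBox by the TBox axiom $\forall(U\sqcap\neg V).\bot$. * $\Theta_\leqslant$.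 Flatten, then exhaustively replace occurrences of ${\leqslant}n\,R.A$ other than axioms of the form ${\leqslant}1\,S.\top$ by $\forall(R\sqcap\neg R_1\sqcap\dots\sqcap\neg R_n).\neg A$ with distinct fresh role names $R_i$, adding the axioms $\forall R_i.A$ and ${\leqslant}1\,R_i.\top$. * $\Theta_F$. Remove all axioms ${\leqslant}1\,R.\top$ and add for each of them: $\forall R.\neg D\sqcup\forall R.D$ for all parts $D$ of the other TBox axioms; $\forall(R\sqcap S).\bot\sqcup\forall(R\sqcap\neg S).\bot$ for all atomic roles $S$ over role names occurring in the knowledge base; and the rule $R(x,y),R(x,z)\to y\approx z$. **The program** $\mathrm{DD}(K')$, for $K'$ with TBox $\mathcal T'$, rules $\mathcal P'$, no RBox and no number restrictions. Let $\mathcal F$ be the TBox of a flattening of $K'$, $\mathbf R$ the set of atomic roles over role names of $\mathcal F$, $\mathcal C=\mathrm{parts}(\mathcal F)$, and $\mathrm{Var}=\mathbf R\cup\mathcal C\times\{1,2\}$. For a concept $C$, let $[\![C]\!]$ be the Boolean function on subsets $V$ of $\mathrm{Var}$ that evaluates $\neg,\sqcap,\sqcup,\top,\bot$ as Boolean connectives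 and constants and concept names and quantified concepts $D$ as "$(D,1)\in V$"; for a role expression, $[\![U]\!]$ evaluates atomic roles $R$ as "$R\in V$". Let $\varphi_0(V)$ say: $[\![C]\!](V)$ for all $C\in\mathcal F$; if $\forall U.C\in\mathcal C$, $(\forall U.C,1)\in V$ and $[\![U]\!](V)$, then $(C,2)\in V$; if $\exists U.C\in\mathcal C$, $(C,2)\in V$ and $[\![U]\!](V)$, then $(\exists U.C,1)\in V$. Let $\varphi_{i+1}(V)$ say: $\varphi_i(V)$; for all $\exists U.C\in\mathcal C$ with $(\exists U.C,1)\in V$ there is $W$ agreeing with $V$ on $\mathcal C\times\{1\}$ with $\varphi_i(W)$, $[\![U]\!](W)$ and $(C,2)\in W$; for all $\forall U.C\in\mathcal C$ with $(\forall U.C,1)\notin V$ there is such a $W$ with $\varphi_i(W)$, $[\![U]\!](W)$ and $(C,2)\notin W$; and $\varphi_i(V')$ holds for the $V'$ obtained from $V$ by exchanging the indices $1,2$ and replacing each atomic role by its inverse. Let $\varphi$ be the limit of this stationary sequence, and $\mathbb O$ any binary decision diagram over $\mathrm{Var}$ that represents $\varphi$. $\mathrm{DD}(K')$ is the disjunctive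 Datalog program with equality, with the elements of $N_I$ as constants and predicates $S_C$ (unary, $C$ a concept), $S_r$ (binary, $r$ a role name), $A_n$ (binary, $n$ a node of $\mathbb O$) and $\approx$, whose rules are: * the rules of $\mathcal P'$ with each concept name $C$ replaced by $S_C$ and each role name $r$ by $S_r$ (a rule with several head atoms stands for one rule per head atom); * $\to A_{\mathrm{root}}(x,y)$ and $A_{\mathrm{false}}(x,y)\to$; * for each non-terminal node $n$ with label $v$: $\tau_v\wedge A_n(x,y)\to A_{\mathrm{high}(n)}(x,y)$ and $A_n(x,y)\to A_{\mathrm{low}(n)}(x,y)\vee\tau_v$, where $\tau_{(C,1)}=S_C(x)$, $\tau_{(C,2)}=S_C(y)$, $\tau_r=S_r(x,y)$ and $\tau_{r^-}=S_r(y,x)$. **Theorem.** Let $K$ be an extended $\mathcal{SHIQ}b_s$ knowledge base. The constructions of $\Theta_{\mathcal{SHIQ}}(K)$ and of $\mathrm{DD}$ of the result can be carried out, and for every program $\mathbb P=\mathrm{DD}(\Theta_{\mathcal{SHIQ}}(K))$ so obtained (whatever choices of occurrences, fresh names and decision diagrams are made): * $K$ is satisfiable iff $\mathbb P$ is satisfiable;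 * $K\models C(a)$ iff $\mathbb P\models S_C(a)$; * $K\models R(a,b)$ iff $\mathbb P\models S_R(a,b)$; * $K\models a\approx b$ iff $\mathbb P\models a\approx b$; for all $a,b\in N_I$, $C\in N_C$ and $R\in N_R$. -/

import Mathlib

universe u

namespace DL

/-! ### Roles and concepts -/

/-- Atomic roles: role names and their inverses. -/
inductive Role (NR : Type u) : Type u
  | name (r : NR)
  | inv (r : NR)

/-- The operation `Inv` on atomic roles. -/
def Role.Inv {NR : Type u} : Role NR → Role NR
  | .name r => .inv r
  | .inv r => .name r

/-- The role name underlying an atomic role. -/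
def Role.base {NR : Type u} : Role NR → NR
  | .name r => r
  | .inv r => r

/-- Boolean role expressions. -/
inductive RoleExpr (NR : Type u) : Type u
  | atom (R : Role NR)
  | neg (U : RoleExpr NR)
  | inter (U V : RoleExpr NR)
  | union (U V : RoleExpr NR)

/-- `U.Derivable S` is the entailment `S ⊢ U` between a set of atomic roles and a role
expression. -/
def RoleExpr.Derivable {NR : Type u} (S : Set (Role NR)) : RoleExpr NR → Prop
  | .atom R => R ∈ S
  | .neg U => ¬ U.Derivable S
  | .inter U V => U.Derivable S ∧ V.Derivable S
  | .union U V => U.Derivable S ∨ V.Derivable S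

/-- A role expression is restricted if it is not entailed by the empty set. -/
def RoleExpr.Restricted {NR : Type u} (U : RoleExpr NR) : Prop :=
  ¬ U.Derivable ∅

/-- The atomic roles contained in a role expression. -/
def RoleExpr.roles {NR : Type u} : RoleExpr NR → Set (Role NR)
  | .atom R => {R}
  | .neg U => U.roles
  | .inter U V => U.roles ∪ V.roles
  | .union U V => U.roles ∪ V.roles

/-- Concept expressions. `atMost n R C` is `≤ n R.C` and, as the grammar only has positive
numbers there, `atLeast n R C` is `≥ (n+1) R.C`. -/
inductive Concept (NC NR : Type u) : Type u
  | name (A : NC)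
  | top
  | bot
  | neg (C : Concept NC NR)
  | inter (C D : Concept NC NR)
  | union (C D : Concept NC NR)
  | all (U : RoleExpr NR) (C : Concept NC NR)
  | ex (U : RoleExpr NR) (C : Concept NC NR)
  | atMost (n : ℕ) (R : Role NR) (C : Concept NC NR)
  | atLeast (n : ℕ) (R : Role NR) (C : Concept NC NR)

/-- A general concept inclusion `lhs ⊑ rhs`. -/
structure GCI (NC NR : Type u) : Type u where
  lhs : Concept NC NR
  rhs : Concept NC NR

/-- The GCI `C ⊑ D` written as the universally valid concept `¬C ⊔ D`. -/
def GCI.toConcept {NC NR : Type u} (g : GCI NC NR) : Concept NC NR :=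
  .union (.neg g.lhs) g.rhs

/-- RBox axioms. -/
inductive RoleAxiom (NR : Type u) : Type u
  | incl (U V : RoleExpr NR)
  | trans (R : Role NR)

/-! ### DL-safe rules and knowledge bases -/

/-- Terms over the variables `ℕ` and the individual names. -/
inductive Term (NI : Type u) : Type u
  | var (v : ℕ)
  | ind (a : NI)

/-- Concept, role and equality atoms. -/
inductive Atom (NC NR NI : Type u) : Type u
  | con (A : NC) (t : Term NI)
  | rol (r : NR) (t s : Term NI)
  | eq (t s : Term NI)

/-- `R(t,s)` for an atomic role `R`; `r⁻(t,s)` is the atom `r(s,t)`. -/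
def roleAtom {NC NR NI : Type u} : Role NR → Term NI → Term NI → Atom NC NR NI
  | .name r, t, s => .rol r t s
  | .inv r, t, s => .rol r s t

/-- A DL-safe rule `body → head`, both sides being conjunctions of atoms. -/
structure Rule (NC NR NI : Type u) : Type u where
  body : List (Atom NC NR NI)
  head : List (Atom NC NR NI)

/-- Extended knowledge bases, consisting of TBox, RBox and rule base. -/
structure KnowledgeBase (NC NR NI : Type u) : Type u where
  tbox : Set (GCI NC NR)
  rbox : Set (RoleAxiom NR)
  rules : Set (Rule NC NR NI)

/-- The non-simple atomic roles of an RBox. -/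
inductive NonSimple {NR : Type u} (rbox : Set (RoleAxiom NR)) : Role NR → Prop
  | trans {R : Role NR} : RoleAxiom.trans R ∈ rbox → NonSimple rbox R
  | incl {R S : Role NR} :
      RoleAxiom.incl (.atom R) (.atom S) ∈ rbox → NonSimple rbox R → NonSimple rbox S
  | inv {R : Role NR} : NonSimple rbox R → NonSimple rbox R.Inv

/-- All atomic roles contained in the expression are simple. -/
def RoleExpr.Simple {NR : Type u} (rbox : Set (RoleAxiom NR)) (U : RoleExpr NR) : Prop :=
  ∀ R ∈ U.roles, ¬ NonSimple rbox R

/-- The role expression is restricted and, unless it is atomic, contains only simple roles. -/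
def RoleExpr.Admissible {NR : Type u} (rbox : Set (RoleAxiom NR)) (U : RoleExpr NR) : Prop :=
  U.Restricted ∧ ((∃ R, U = .atom R) ∨ U.Simple rbox)

/-- The concept expression is a `SHIQb_s` concept for the given RBox. -/
def Concept.Admissible {NC NR : Type u} (rbox : Set (RoleAxiom NR)) : Concept NC NR → Prop
  | .name _ => True
  | .top => True
  | .bot => True
  | .neg C => C.Admissible rbox
  | .inter C D => C.Admissible rbox ∧ D.Admissible rbox
  | .union C D => C.Admissible rbox ∧ D.Admissible rbox
  | .all U C => U.Admissible rbox ∧ C.Admissible rbox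
  | .ex U C => U.Admissible rbox ∧ C.Admissible rbox
  | .atMost _ R C => ¬ NonSimple rbox R ∧ C.Admissible rbox
  | .atLeast _ R C => ¬ NonSimple rbox R ∧ C.Admissible rbox

/-- `K` is a (finite) extended `SHIQb_s` knowledge base. In a role inclusion, a non-simple role
may only be included in an atomic role (which is then non-simple as well). -/
structure KnowledgeBase.IsSHIQbs {NC NR NI : Type u} (K : KnowledgeBase NC NR NI) : Prop where
  tbox_finite : K.tbox.Finite
  rbox_finite : K.rbox.Finite
  rules_finite : K.rules.Finite
  concepts : ∀ g ∈ K.tbox, g.lhs.Admissible K.rbox ∧ g.rhs.Admissible K.rbox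
  inclusions : ∀ U V, RoleAxiom.incl U V ∈ K.rbox → U.Admissible K.rbox ∧ V.Admissible K.rbox
  inclusions_simple : ∀ U V, RoleAxiom.incl U V ∈ K.rbox →
    (∃ S, V = .atom S) ∨ U.Simple K.rbox

/-! ### Semantics -/

/-- Interpretations. -/
structure Interp (NC NR NI : Type u) : Type (u + 1) where
  Domain : Type u
  ind : NI → Domain
  con : NC → Set Domain
  rol : NR → Domain → Domain → Prop

/-- Extension of atomic roles. -/
def Interp.role {NC NR NI : Type u} (I : Interp NC NR NI) :
    Role NR → I.Domain → I.Domain → Prop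
  | .name r, x, y => I.rol r x y
  | .inv r, x, y => I.rol r y x

/-- Extension of role expressions. -/
def Interp.roleExpr {NC NR NI : Type u} (I : Interp NC NR NI) :
    RoleExpr NR → I.Domain → I.Domain → Prop
  | .atom R, x, y => I.role R x y
  | .neg U, x, y => ¬ I.roleExpr U x y
  | .inter U V, x, y => I.roleExpr U x y ∧ I.roleExpr V x y
  | .union U V, x, y => I.roleExpr U x y ∨ I.roleExpr V x y

/-- Extension of concept expressions. -/
def Interp.concept {NC NR NI : Type u} (I : Interp NC NR NI) : Concept NC NR → Set I.Domain
  | .name A => I.con A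
  | .top => Set.univ
  | .bot => ∅
  | .neg C => (I.concept C)ᶜ
  | .inter C D => I.concept C ∩ I.concept D
  | .union C D => I.concept C ∪ I.concept D
  | .all U C => {x | ∀ y, I.roleExpr U x y → y ∈ I.concept C}
  | .ex U C => {x | ∃ y, I.roleExpr U x y ∧ y ∈ I.concept C}
  | .atMost n R C => {x | {y | I.role R x y ∧ y ∈ I.concept C}.encard ≤ (n : ℕ∞)}
  | .atLeast n R C => {x | ((n + 1 : ℕ) : ℕ∞) ≤ {y | I.role R x y ∧ y ∈ I.concept C}.encard}

/-- Satisfaction of RBox axioms. -/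
def Interp.SatRoleAxiom {NC NR NI : Type u} (I : Interp NC NR NI) : RoleAxiom NR → Prop
  | .incl U V => ∀ x y, I.roleExpr U x y → I.roleExpr V x y
  | .trans R => ∀ x y z, I.role R x y → I.role R y z → I.role R x z

/-- Value of a term under a variable assignment. -/
def Interp.term {NC NR NI : Type u} (I : Interp NC NR NI) (Z : ℕ → I.Domain) :
    Term NI → I.Domain
  | .var v => Z v
  | .ind a => I.ind a

/-- Satisfaction of atoms. -/
def Interp.SatAtom {NC NR NI : Type u} (I : Interp NC NR NI) (Z : ℕ → I.Domain) :
    Atom NC NR NI → Prop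
  | .con A t => I.term Z t ∈ I.con A
  | .rol r t s => I.rol r (I.term Z t) (I.term Z s)
  | .eq t s => I.term Z t = I.term Z s

/-- Satisfaction of a DL-safe rule: variables range over named individuals, the head is a
conjunction, and the empty head is false. -/
def Interp.SatRule {NC NR NI : Type u} (I : Interp NC NR NI) (ρ : Rule NC NR NI) : Prop :=
  ∀ Z : ℕ → I.Domain, (∀ v, Z v ∈ Set.range I.ind) →
    (∀ α ∈ ρ.body, I.SatAtom Z α) → ρ.head ≠ [] ∧ ∀ α ∈ ρ.head, I.SatAtom Z α

/-- `I` is a model of `K`. -/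
def Interp.Models {NC NR NI : Type u} (I : Interp NC NR NI) (K : KnowledgeBase NC NR NI) :
    Prop :=
  (∀ g ∈ K.tbox, I.concept g.lhs ⊆ I.concept g.rhs) ∧
  (∀ α ∈ K.rbox, I.SatRoleAxiom α) ∧
  (∀ ρ ∈ K.rules, I.SatRule ρ)

/-- Satisfiability of extended knowledge bases. -/
def KnowledgeBase.Satisfiable {NC NR NI : Type u} (K : KnowledgeBase NC NR NI) : Prop :=
  ∃ I : Interp NC NR NI, I.Models K

/-- `K ⊨ A(a)`. -/
def KnowledgeBase.EntailsConcept {NC NR NI : Type u} (K : KnowledgeBase NC NR NI)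
    (A : NC) (a : NI) : Prop :=
  ∀ I : Interp NC NR NI, I.Models K → I.ind a ∈ I.con A

/-- `K ⊨ r(a,b)`. -/
def KnowledgeBase.EntailsRole {NC NR NI : Type u} (K : KnowledgeBase NC NR NI)
    (r : NR) (a b : NI) : Prop :=
  ∀ I : Interp NC NR NI, I.Models K → I.rol r (I.ind a) (I.ind b)

/-- `K ⊨ a ≈ b`. -/
def KnowledgeBase.EntailsEq {NC NR NI : Type u} (K : KnowledgeBase NC NR NI)
    (a b : NI) : Prop :=
  ∀ I : Interp NC NR NI, I.Models K → I.ind a = I.ind b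

/-! ### Fresh names

The given vocabulary is enlarged by a countable reservoir of names to be used as fresh ones. -/

/-- The names of the vocabulary `N` together with the reservoir of fresh names. -/
inductive Name (N : Type u) : Type u
  | orig (a : N)
  | fresh (k : ℕ)

/-- Renaming the role name of an atomic role. -/
def Role.map {NR NR' : Type u} (g : NR → NR') : Role NR → Role NR'
  | .name r => .name (g r)
  | .inv r => .inv (g r)

/-- Renaming in role expressions. -/
def RoleExpr.map {NR NR' : Type u} (g : NR → NR') : RoleExpr NR → RoleExpr NR'
  | .atom R => .atom (R.map g)
  | .neg U => .neg (U.map g)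
  | .inter U V => .inter (U.map g) (V.map g)
  | .union U V => .union (U.map g) (V.map g)

/-- Renaming in concept expressions. -/
def Concept.map {NC NC' NR NR' : Type u} (f : NC → NC') (g : NR → NR') :
    Concept NC NR → Concept NC' NR'
  | .name A => .name (f A)
  | .top => .top
  | .bot => .bot
  | .neg C => .neg (C.map f g)
  | .inter C D => .inter (C.map f g) (D.map f g)
  | .union C D => .union (C.map f g) (D.map f g)
  | .all U C => .all (U.map g) (C.map f g)
  | .ex U C => .ex (U.map g) (C.map f g)
  | .atMost n R C => .atMost n (R.map g) (C.map f g)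
  | .atLeast n R C => .atLeast n (R.map g) (C.map f g)

/-- Renaming in GCIs. -/
def GCI.map {NC NC' NR NR' : Type u} (f : NC → NC') (g : NR → NR') (γ : GCI NC NR) :
    GCI NC' NR' :=
  ⟨γ.lhs.map f g, γ.rhs.map f g⟩

/-- Renaming in RBox axioms. -/
def RoleAxiom.map {NR NR' : Type u} (g : NR → NR') : RoleAxiom NR → RoleAxiom NR'
  | .incl U V => .incl (U.map g) (V.map g)
  | .trans R => .trans (R.map g)

/-- Renaming in atoms. -/
def Atom.map {NC NC' NR NR' NI : Type u} (f : NC → NC') (g : NR → NR') :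
    Atom NC NR NI → Atom NC' NR' NI
  | .con A t => .con (f A) t
  | .rol r t s => .rol (g r) t s
  | .eq t s => .eq t s

/-- Renaming in rules. -/
def Rule.map {NC NC' NR NR' NI : Type u} (f : NC → NC') (g : NR → NR') (ρ : Rule NC NR NI) :
    Rule NC' NR' NI :=
  ⟨ρ.body.map (Atom.map f g), ρ.head.map (Atom.map f g)⟩

/-- The knowledge base `K`, seen over the enlarged vocabulary. -/
def KnowledgeBase.lift {NC NR NI : Type u} (K : KnowledgeBase NC NR NI) :
    KnowledgeBase (Name NC) (Name NR) NI where
  tbox := GCI.map Name.orig Name.orig '' K.tbox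
  rbox := RoleAxiom.map Name.orig '' K.rbox
  rules := Rule.map Name.orig Name.orig '' K.rules

/-! ### Negation normal form, parts, occurring names -/

mutual
/-- Negation normal form of `C`. -/
def Concept.nnf {NC NR : Type u} : Concept NC NR → Concept NC NR
  | .name A => .name A
  | .top => .top
  | .bot => .bot
  | .neg C => C.nnfNeg
  | .inter C D => .inter C.nnf D.nnf
  | .union C D => .union C.nnf D.nnf
  | .all U C => .all U C.nnf
  | .ex U C => .ex U C.nnf
  | .atMost n R C => .atMost n R C.nnf
  | .atLeast n R C => .atLeast n R C.nnf
/-- Negation normal form of `¬C`. -/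
def Concept.nnfNeg {NC NR : Type u} : Concept NC NR → Concept NC NR
  | .name A => .neg (.name A)
  | .top => .bot
  | .bot => .top
  | .neg C => C.nnf
  | .inter C D => .union C.nnfNeg D.nnfNeg
  | .union C D => .inter C.nnfNeg D.nnfNeg
  | .all U C => .ex U C.nnfNeg
  | .ex U C => .all U C.nnfNeg
  | .atMost n R C => .atLeast n R C.nnf
  | .atLeast n R C => .atMost n R C.nnf
end

/-- The set of parts of a concept expression. -/
def Concept.parts {NC NR : Type u} : Concept NC NR → Set (Concept NC NR)
  | .name A => {.name A}
  | .top => {.top}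
  | .bot => {.bot}
  | .neg C => C.parts
  | .inter C D => C.parts ∪ D.parts
  | .union C D => C.parts ∪ D.parts
  | .all U C => {.all U C} ∪ C.parts
  | .ex U C => {.ex U C} ∪ C.parts
  | .atMost n R C => {.atMost n R C} ∪ C.parts
  | .atLeast n R C => {.atLeast n R C} ∪ C.parts

/-- The parts of a set of concept expressions. -/
def parts {NC NR : Type u} (T : Set (Concept NC NR)) : Set (Concept NC NR) :=
  {D | ∃ C ∈ T, D ∈ C.parts}

/-- Concept names occurring in a concept expression. -/
def Concept.conNames {NC NR : Type u} : Concept NC NR → Set NC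
  | .name A => {A}
  | .top => ∅
  | .bot => ∅
  | .neg C => C.conNames
  | .inter C D => C.conNames ∪ D.conNames
  | .union C D => C.conNames ∪ D.conNames
  | .all _ C => C.conNames
  | .ex _ C => C.conNames
  | .atMost _ _ C => C.conNames
  | .atLeast _ _ C => C.conNames

/-- Role names occurring in a role expression. -/
def RoleExpr.roleNames {NR : Type u} (U : RoleExpr NR) : Set NR :=
  Role.base '' U.roles

/-- Role names occurring in a concept expression. -/
def Concept.roleNames {NC NR : Type u} : Concept NC NR → Set NR
  | .name _ => ∅
  | .top => ∅
  | .bot => ∅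
  | .neg C => C.roleNames
  | .inter C D => C.roleNames ∪ D.roleNames
  | .union C D => C.roleNames ∪ D.roleNames
  | .all U C => U.roleNames ∪ C.roleNames
  | .ex U C => U.roleNames ∪ C.roleNames
  | .atMost _ R C => {R.base} ∪ C.roleNames
  | .atLeast _ R C => {R.base} ∪ C.roleNames

/-- Role names occurring in an RBox axiom. -/
def RoleAxiom.roleNames {NR : Type u} : RoleAxiom NR → Set NR
  | .incl U V => U.roleNames ∪ V.roleNames
  | .trans R => {R.base}

/-- Concept names occurring in an atom. -/
def Atom.conNames {NC NR NI : Type u} : Atom NC NR NI → Set NC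
  | .con A _ => {A}
  | .rol _ _ _ => ∅
  | .eq _ _ => ∅

/-- Role names occurring in an atom. -/
def Atom.roleNames {NC NR NI : Type u} : Atom NC NR NI → Set NR
  | .con _ _ => ∅
  | .rol r _ _ => {r}
  | .eq _ _ => ∅

/-- Knowledge bases all of whose TBox axioms are written as universally valid concepts: an element
`C` of the TBox stands for the axiom `⊤ ⊑ C`. -/
structure UKB (NC NR NI : Type u) : Type u where
  tbox : Set (Concept NC NR)
  rbox : Set (RoleAxiom NR)
  rules : Set (Rule NC NR NI)

/-- Concept names occurring in a knowledge base. -/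
def UKB.conNames {NC NR NI : Type u} (K : UKB NC NR NI) : Set NC :=
  {A | (∃ C ∈ K.tbox, A ∈ C.conNames) ∨
    ∃ ρ ∈ K.rules, ∃ α, (α ∈ ρ.body ∨ α ∈ ρ.head) ∧ A ∈ α.conNames}

/-- Role names occurring in a knowledge base. -/
def UKB.roleNames {NC NR NI : Type u} (K : UKB NC NR NI) : Set NR :=
  {r | (∃ C ∈ K.tbox, r ∈ C.roleNames) ∨ (∃ α ∈ K.rbox, r ∈ α.roleNames) ∨
    ∃ ρ ∈ K.rules, ∃ α, (α ∈ ρ.body ∨ α ∈ ρ.head) ∧ r ∈ α.roleNames}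

/-- Negation normal form of a knowledge base. -/
def UKB.nnf {NC NR NI : Type u} (K : UKB NC NR NI) : UKB NC NR NI where
  tbox := Concept.nnf '' K.tbox
  rbox := K.rbox
  rules := K.rules

/-! ### Exhaustive rewriting and flattening -/

/-- `b` is the result of exhaustively applying `step`, starting from `a`. -/
def Exhausts {α : Type u} (step : α → α → Prop) (a b : α) : Prop :=
  Relation.ReflTransGen step a b ∧ ∀ c, ¬ step b c

/-- `ReplaceOuter X Y C C'`: the concept `C'` results from `C` by replacing one occurrence of `X`
that is only in the scope of `⊓` and `⊔` by `Y`. In a concept in negation normal form, these are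
the outermost occurrences when `X` is a quantifier or number restriction. -/
inductive ReplaceOuter {NC NR : Type u} (X Y : Concept NC NR) :
    Concept NC NR → Concept NC NR → Prop
  | here : ReplaceOuter X Y X Y
  | interL {C C' : Concept NC NR} (D : Concept NC NR) :
      ReplaceOuter X Y C C' → ReplaceOuter X Y (.inter C D) (.inter C' D)
  | interR {D D' : Concept NC NR} (C : Concept NC NR) :
      ReplaceOuter X Y D D' → ReplaceOuter X Y (.inter C D) (.inter C D')
  | unionL {C C' : Concept NC NR} (D : Concept NC NR) :
      ReplaceOuter X Y C C' → ReplaceOuter X Y (.union C D) (.union C' D)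
  | unionR {D D' : Concept NC NR} (C : Concept NC NR) :
      ReplaceOuter X Y D D' → ReplaceOuter X Y (.union C D) (.union C D')

/-- `Abbreviate F D X X' G`: `X` is of the form `Q U.D`, `X'` is `Q U.F`, and `G` is the axiom
that connects the concept name `F` with `D`. -/
inductive Abbreviate {NC NR : Type u} (F : NC) (D : Concept NC NR) :
    Concept NC NR → Concept NC NR → Concept NC NR → Prop
  | all (U : RoleExpr NR) :
      Abbreviate F D (.all U D) (.all U (.name F)) (.union (.neg (.name F)) D)
  | ex (U : RoleExpr NR) :
      Abbreviate F D (.ex U D) (.ex U (.name F)) (.union (.neg (.name F)) D)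
  | atLeast (n : ℕ) (R : Role NR) :
      Abbreviate F D (.atLeast n R D) (.atLeast n R (.name F)) (.union (.neg (.name F)) D)
  | atMost (n : ℕ) (R : Role NR) :
      Abbreviate F D (.atMost n R D) (.atMost n R (.name F)) (.union D.nnfNeg (.name F))

/-- One flattening step: an outermost `Q U.D` in an axiom `E`, where `D` is not a concept name, is
replaced by `Q U.F` for a fresh concept name `F`. -/
def FlatStep {NC NR NI : Type u} (K K' : UKB (Name NC) (Name NR) NI) : Prop :=
  ∃ (E E' X X' G D : Concept (Name NC) (Name NR)) (k : ℕ),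
    E ∈ K.tbox ∧ (∀ A, D ≠ .name A) ∧ Name.fresh k ∉ K.conNames ∧
    Abbreviate (Name.fresh k) D X X' G ∧ ReplaceOuter X X' E E' ∧
    K' = { K with tbox := (K.tbox \ {E}) ∪ {E', G} }

/-- `K'` is a flattening of `K`. -/
def Flat {NC NR NI : Type u} (K K' : UKB (Name NC) (Name NR) NI) : Prop :=
  Exhausts FlatStep K.nnf K'

/-! ### Elimination of transitivity -/

/-- `R` is declared transitive, where declaring `R` or `Inv R` transitive amounts to the same. -/
def KnowledgeBase.Transitive {NC NR NI : Type u} (K : KnowledgeBase NC NR NI) (R : Role NR) :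
    Prop :=
  RoleAxiom.trans R ∈ K.rbox ∨ RoleAxiom.trans R.Inv ∈ K.rbox

/-- The relation `⊑*` on the non-simple roles. -/
inductive SubRole {NR : Type u} (rbox : Set (RoleAxiom NR)) : Role NR → Role NR → Prop
  | refl {R : Role NR} : NonSimple rbox R → SubRole rbox R R
  | incl {R S : Role NR} : NonSimple rbox R → RoleAxiom.incl (.atom R) (.atom S) ∈ rbox →
      SubRole rbox R S
  | inclInv {R S : Role NR} : NonSimple rbox R → RoleAxiom.incl (.atom R) (.atom S) ∈ rbox →
      SubRole rbox R.Inv S.Inv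
  | trans {R S T : Role NR} : SubRole rbox R S → SubRole rbox S T → SubRole rbox R T

/-- `D` is an immediate subexpression of `C`. -/
def Concept.ImmediateSub {NC NR : Type u} (D : Concept NC NR) : Concept NC NR → Prop
  | .name _ => False
  | .top => False
  | .bot => False
  | .neg C => D = C
  | .inter C C' => D = C ∨ D = C'
  | .union C C' => D = C ∨ D = C'
  | .all _ C => D = C
  | .ex _ C => D = C
  | .atMost _ _ C => D = C
  | .atLeast _ _ C => D = C

/-- The closure `cl(K)`. -/
inductive KnowledgeBase.Cl {NC NR NI : Type u} (K : KnowledgeBase NC NR NI) :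
    Concept NC NR → Prop
  | gci {g : GCI NC NR} : g ∈ K.tbox → K.Cl g.toConcept.nnf
  | sub {C D : Concept NC NR} : K.Cl C → D.ImmediateSub C → K.Cl D
  | atMost {n : ℕ} {R : Role NR} {C : Concept NC NR} : K.Cl (.atMost n R C) → K.Cl C.nnfNeg
  | trans {R S : Role NR} {C : Concept NC NR} : K.Transitive S → SubRole K.rbox S R →
      K.Cl (.all (.atom R) C) → K.Cl (.all (.atom S) C)

/-- The knowledge base `Θ_S(K)`; `self R` is the concept name `Self_R`. -/
def KnowledgeBase.thetaS {NC NR NI : Type u} (K : KnowledgeBase NC NR NI)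
    (self : Role NR → NC) : UKB NC NR NI where
  tbox := GCI.toConcept ''
    (K.tbox ∪
      {g | ∃ R C, K.Transitive R ∧ K.Cl (.all (.atom R) C) ∧
        g = ⟨.all (.atom R) C, .all (.atom R) (.all (.atom R) C)⟩} ∪
      {g | ∃ R, K.Transitive R ∧
        g = ⟨.ex (.inter (.atom R) (.atom R.Inv)) .top, .name (self R)⟩})
  rbox := {α ∈ K.rbox | ∃ U V, α = .incl U V}
  rules := K.rules ∪
    {ρ | ∃ R, K.Transitive R ∧
      ρ = ⟨[.con (self R) (.var 0)], [roleAtom R (.var 0) (.var 0)]⟩} ∪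
    {ρ | ∃ R, K.Transitive R ∧
      ρ = ⟨[roleAtom R (.var 0) (.var 1), roleAtom R (.var 1) (.var 2)],
        [roleAtom R (.var 0) (.var 2)]⟩}

/-! ### Elimination of number restrictions and role inclusions -/

/-- `∃R_0.C ⊓ … ⊓ ∃R_n.C` for the role names `R_i = rs i`. -/
def exInter {NC NR : Type u} (rs : ℕ → NR) (C : Concept NC NR) : ℕ → Concept NC NR
  | 0 => .ex (.atom (.name (rs 0))) C
  | n + 1 => .inter (exInter rs C n) (.ex (.atom (.name (rs (n + 1)))) C)

/-- One elimination step for `≥ (n+1) R.C`, with fresh role names `R_0, …, R_n`. -/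
def GeStep {NC NR NI : Type u} (K K' : UKB (Name NC) (Name NR) NI) : Prop :=
  ∃ (E E' C : Concept (Name NC) (Name NR)) (n : ℕ) (R : Role (Name NR)) (f : ℕ → ℕ),
    E ∈ K.tbox ∧ (∀ i ≤ n, Name.fresh (f i) ∉ K.roleNames) ∧
    (∀ i ≤ n, ∀ k ≤ n, f i = f k → i = k) ∧
    ReplaceOuter (.atLeast n R C) (exInter (fun i => .fresh (f i)) C n) E E' ∧
    K' =
      { tbox := (K.tbox \ {E}) ∪ {E'} ∪
          {G | ∃ i k, i < k ∧ k ≤ n ∧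
            G = .all (.inter (.atom (.name (.fresh (f i)))) (.atom (.name (.fresh (f k))))) .bot}
        rbox := K.rbox ∪ {α | ∃ i ≤ n, α = .incl (.atom (.name (.fresh (f i)))) (.atom R)}
        rules := K.rules }

/-- `K'` is a result `Θ_≥(K)`. -/
def ThetaGe {NC NR NI : Type u} (K K' : UKB (Name NC) (Name NR) NI) : Prop :=
  ∃ K₀, Flat K K₀ ∧ Exhausts GeStep K₀ K'

/-- `Θ_H(K)`: role inclusions `U ⊑ V` become TBox axioms `∀(U ⊓ ¬V).⊥`. -/
def UKB.thetaH {NC NR NI : Type u} (K : UKB NC NR NI) : UKB NC NR NI where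
  tbox := K.tbox ∪ {C | ∃ U V, RoleAxiom.incl U V ∈ K.rbox ∧ C = .all (.inter U (.neg V)) .bot}
  rbox := {α ∈ K.rbox | ∀ U V, α ≠ .incl U V}
  rules := K.rules

/-- `R ⊓ ¬R_0 ⊓ … ⊓ ¬R_{n-1}` for the role names `R_i = rs i`. -/
def roleMinus {NR : Type u} (R : Role NR) (rs : ℕ → NR) : ℕ → RoleExpr NR
  | 0 => .atom R
  | n + 1 => .inter (roleMinus R rs n) (.neg (.atom (.name (rs n))))

/-- One elimination step for an occurrence of `≤ n R.C` that is not a functionality axiom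
`≤ 1 S.⊤`, with fresh role names `R_0, …, R_{n-1}`. -/
def LeStep {NC NR NI : Type u} (K K' : UKB (Name NC) (Name NR) NI) : Prop :=
  ∃ (E E' C : Concept (Name NC) (Name NR)) (n : ℕ) (R : Role (Name NR)) (f : ℕ → ℕ),
    E ∈ K.tbox ∧ (∀ S, E ≠ .atMost 1 S .top) ∧
    (∀ i < n, Name.fresh (f i) ∉ K.roleNames) ∧
    (∀ i < n, ∀ k < n, f i = f k → i = k) ∧
    ReplaceOuter (.atMost n R C) (.all (roleMinus R (fun i => .fresh (f i)) n) (.neg C)) E E' ∧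
    K' =
      { K with
        tbox := (K.tbox \ {E}) ∪ {E'} ∪
          {G | ∃ i < n, G = .all (.atom (.name (.fresh (f i)))) C ∨
            G = .atMost 1 (.name (.fresh (f i))) .top} }

/-- `K'` is a result `Θ_≤(K)`. -/
def ThetaLe {NC NR NI : Type u} (K K' : UKB (Name NC) (Name NR) NI) : Prop :=
  ∃ K₀, Flat K K₀ ∧ Exhausts LeStep K₀ K'

/-! ### Elimination of functionality -/

/-- The TBox axioms that are not functionality axioms. -/
def UKB.nonFunctional {NC NR NI : Type u} (K : UKB NC NR NI) : Set (Concept NC NR) :=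
  {C ∈ K.tbox | ∀ R, C ≠ .atMost 1 R .top}

/-- `Θ_F(K)`. -/
def UKB.thetaF {NC NR NI : Type u} (K : UKB NC NR NI) : UKB NC NR NI where
  tbox := K.nonFunctional ∪
    {C | ∃ R D, .atMost 1 R .top ∈ K.tbox ∧ D ∈ parts K.nonFunctional ∧
      C = .union (.all (.atom R) (.neg D)) (.all (.atom R) D)} ∪
    {C | ∃ R S, .atMost 1 R .top ∈ K.tbox ∧ S.base ∈ K.roleNames ∧
      C = .union (.all (.inter (.atom R) (.atom S)) .bot)
        (.all (.inter (.atom R) (.neg (.atom S))) .bot)}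
  rbox := K.rbox
  rules := K.rules ∪
    {ρ | ∃ R, .atMost 1 R .top ∈ K.tbox ∧
      ρ = ⟨[roleAtom R (.var 0) (.var 1), roleAtom R (.var 0) (.var 2)],
        [.eq (.var 1) (.var 2)]⟩}

/-- `K'` is a result `Θ_SHIQ(K) = Θ_F Θ_≤ Θ_H Θ_≥ Θ_S(K)`. -/
def KnowledgeBase.ThetaSHIQ {NC NR NI : Type u} (K : KnowledgeBase NC NR NI)
    (K' : UKB (Name NC) (Name NR) NI) : Prop :=
  ∃ (self : Role (Name NR) → ℕ) (K₁ K₂ : UKB (Name NC) (Name NR) NI),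
    Set.InjOn self {R | K.lift.Transitive R} ∧
    ThetaGe (K.lift.thetaS fun R => Name.fresh (self R)) K₁ ∧
    ThetaLe K₁.thetaH K₂ ∧
    K' = K₂.thetaF

/-! ### The Boolean function of a flat TBox -/

/-- Boolean variables: atomic roles and pairs `⟨C,1⟩`, `⟨C,2⟩`. -/
inductive BVar (NC NR : Type u) : Type u
  | role (R : Role NR)
  | fst (C : Concept NC NR)
  | snd (C : Concept NC NR)

/-- Boolean functions on sets of variables. -/
abbrev BFun (NC NR : Type u) : Type u := Set (BVar NC NR) → Prop

/-- The role variables of a TBox: the atomic roles over the role names occurring in it. -/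
def roleVars {NC NR : Type u} (T : Set (Concept NC NR)) : Set (BVar NC NR) :=
  {v | ∃ R, (∃ C ∈ T, R.base ∈ C.roleNames) ∧ v = .role R}

/-- The variables of a TBox. -/
def vars {NC NR : Type u} (T : Set (Concept NC NR)) : Set (BVar NC NR) :=
  roleVars T ∪ BVar.fst '' parts T ∪ BVar.snd '' parts T

/-- Boolean function of a concept. -/
def Concept.bfun {NC NR : Type u} : Concept NC NR → BFun NC NR
  | .name A, V => .fst (.name A) ∈ V
  | .top, _ => True
  | .bot, _ => False
  | .neg C, V => ¬ C.bfun V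
  | .inter C D, V => C.bfun V ∧ D.bfun V
  | .union C D, V => C.bfun V ∨ D.bfun V
  | .all U C, V => .fst (.all U C) ∈ V
  | .ex U C, V => .fst (.ex U C) ∈ V
  | .atMost n R C, V => .fst (.atMost n R C) ∈ V
  | .atLeast n R C, V => .fst (.atLeast n R C) ∈ V

/-- Boolean function of a role expression. -/
def RoleExpr.bfun {NC NR : Type u} : RoleExpr NR → BFun NC NR
  | .atom R, V => .role R ∈ V
  | .neg U, V => ¬ U.bfun V
  | .inter U U', V => U.bfun V ∧ U'.bfun V
  | .union U U', V => U.bfun V ∨ U'.bfun V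

/-- Existential quantification of a Boolean function over the set `S` of variables. -/
def existsVars {NC NR : Type u} (S : Set (BVar NC NR)) (φ : BFun NC NR) : BFun NC NR :=
  fun W => ∃ V ⊆ S, φ (V ∪ (W \ S))

/-- The function `φ^kb ∧ φ^uni ∧ φ^ex`. -/
def stageZero {NC NR : Type u} (T : Set (Concept NC NR)) : BFun NC NR := fun V =>
  (∀ C ∈ T, C.bfun V) ∧
  (∀ U C, .all U C ∈ parts T → .fst (.all U C) ∈ V ∧ U.bfun V → .snd C ∈ V) ∧
  (∀ U C, .ex U C ∈ parts T → .snd C ∈ V ∧ U.bfun V → .fst (.ex U C) ∈ V)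

/-- The variables `𝐑 ∪ (parts(T) × {2})` over which the iteration quantifies. -/
def successorVars {NC NR : Type u} (T : Set (Concept NC NR)) : Set (BVar NC NR) :=
  roleVars T ∪ BVar.snd '' parts T

/-- The function `φ^delex` for the previous approximation `φ`. -/
def delex {NC NR : Type u} (T : Set (Concept NC NR)) (φ : BFun NC NR) : BFun NC NR := fun V =>
  ∀ U C, .ex U C ∈ parts T → .fst (.ex U C) ∈ V →
    existsVars (successorVars T) (fun W => φ W ∧ U.bfun W ∧ .snd C ∈ W) V

/-- The function `φ^deluni` for the previous approximation `φ`. -/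
def deluni {NC NR : Type u} (T : Set (Concept NC NR)) (φ : BFun NC NR) : BFun NC NR := fun V =>
  ∀ U C, .all U C ∈ parts T → .fst (.all U C) ∉ V →
    existsVars (successorVars T) (fun W => φ W ∧ U.bfun W ∧ .snd C ∉ W) V

/-- Exchanging the two sides of a domino. -/
def swapVars {NC NR : Type u} (V : Set (BVar NC NR)) : Set (BVar NC NR) :=
  {v | ∃ D, .snd D ∈ V ∧ v = .fst D} ∪ {v | ∃ R : Role NR, .role R ∈ V ∧ v = .role R.Inv} ∪
    {v | ∃ D, .fst D ∈ V ∧ v = .snd D}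

/-- The successive approximations of the Boolean function of the TBox. -/
def stage {NC NR : Type u} (T : Set (Concept NC NR)) : ℕ → BFun NC NR
  | 0 => stageZero T
  | i + 1 => fun V =>
      stage T i V ∧ delex T (stage T i) V ∧ deluni T (stage T i) V ∧ stage T i (swapVars V)

/-- The Boolean function of a flat TBox. The approximations decrease, so for a finite TBox this
is the stage at which the iteration becomes stationary. -/
def tboxFun {NC NR : Type u} (T : Set (Concept NC NR)) : BFun NC NR :=
  fun V => ∀ i, stage T i V

/-! ### Binary decision diagrams -/

/-- Binary decision diagrams; `low`, `high` and `label` only matter at non-terminal nodes. -/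
structure BDD (Node : Type) (Var : Type u) : Type u where
  root : Node
  true_ : Node
  false_ : Node
  low : Node → Node
  high : Node → Node
  label : Node → Var
  node_finite : Finite Node
  true_ne_false : true_ ≠ false_
  acyclic : ∀ n, ¬ Relation.TransGen
    (fun m m' => (m ≠ true_ ∧ m ≠ false_) ∧ (m' = low m ∨ m' = high m)) n n

/-- Nodes other than the two terminal ones. -/
def BDD.Inner {Node : Type} {Var : Type u} (O : BDD Node Var) (n : Node) : Prop :=
  n ≠ O.true_ ∧ n ≠ O.false_

/-- `O.Accepts V n`: the Boolean function of the node `n` is true at `V`. -/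
inductive BDD.Accepts {Node : Type} {Var : Type u} (O : BDD Node Var) (V : Set Var) :
    Node → Prop
  | terminal : O.Accepts V O.true_
  | high {n : Node} : O.Inner n → O.label n ∈ V → O.Accepts V (O.high n) → O.Accepts V n
  | low {n : Node} : O.Inner n → O.label n ∉ V → O.Accepts V (O.low n) → O.Accepts V n

/-- The diagram is over the variables of `T` and represents the Boolean function of `T`. -/
def BDD.Represents {Node : Type} {NC NR : Type u} (O : BDD Node (BVar NC NR))
    (T : Set (Concept NC NR)) : Prop :=
  (∀ n, O.Inner n → O.label n ∈ vars T) ∧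
  ∀ V ⊆ vars T, O.Accepts V O.root ↔ tboxFun T V

/-! ### Disjunctive Datalog -/

/-- Atoms of the Datalog programs: `S_C(t)`, `S_r(t,s)`, `A_n(t,s)` and `t ≈ s`. -/
inductive DAtom (NC NR NI : Type u) (Node : Type) : Type u
  | con (C : Concept NC NR) (t : Term NI)
  | rol (r : NR) (t s : Term NI)
  | node (n : Node) (t s : Term NI)
  | eq (t s : Term NI)

/-- Disjunctive Datalog rules: the body is a conjunction and the head a disjunction. -/
structure DRule (NC NR NI : Type u) (Node : Type) : Type u where
  body : List (DAtom NC NR NI Node)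
  head : List (DAtom NC NR NI Node)

/-- Disjunctive Datalog programs. -/
abbrev Program (NC NR NI : Type u) (Node : Type) : Type u := Set (DRule NC NR NI Node)

/-- Interpretations of Datalog programs; all individual names are constants. -/
structure DInterp (NC NR NI : Type u) (Node : Type) : Type (u + 1) where
  Domain : Type u
  ind : NI → Domain
  con : Concept NC NR → Set Domain
  rol : NR → Domain → Domain → Prop
  node : Node → Domain → Domain → Prop

/-- Value of a term. -/
def DInterp.term {NC NR NI : Type u} {Node : Type} (J : DInterp NC NR NI Node)
    (Z : ℕ → J.Domain) : Term NI → J.Domain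
  | .var v => Z v
  | .ind a => J.ind a

/-- Satisfaction of atoms. -/
def DInterp.SatAtom {NC NR NI : Type u} {Node : Type} (J : DInterp NC NR NI Node)
    (Z : ℕ → J.Domain) : DAtom NC NR NI Node → Prop
  | .con C t => J.term Z t ∈ J.con C
  | .rol r t s => J.rol r (J.term Z t) (J.term Z s)
  | .node n t s => J.node n (J.term Z t) (J.term Z s)
  | .eq t s => J.term Z t = J.term Z s

/-- Models of a program. -/
def DInterp.Models {NC NR NI : Type u} {Node : Type} (J : DInterp NC NR NI Node)
    (P : Program NC NR NI Node) : Prop :=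
  ∀ ρ ∈ P, ∀ Z : ℕ → J.Domain, (∀ α ∈ ρ.body, J.SatAtom Z α) → ∃ α ∈ ρ.head, J.SatAtom Z α

/-- Satisfiability of a program. -/
def Program.Satisfiable {NC NR NI : Type u} {Node : Type} (P : Program NC NR NI Node) : Prop :=
  ∃ J : DInterp NC NR NI Node, J.Models P

/-- `P ⊨ S_C(a)`. -/
def Program.EntailsConcept {NC NR NI : Type u} {Node : Type} (P : Program NC NR NI Node)
    (C : Concept NC NR) (a : NI) : Prop :=
  ∀ J : DInterp NC NR NI Node, J.Models P → J.ind a ∈ J.con C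

/-- `P ⊨ S_r(a,b)`. -/
def Program.EntailsRole {NC NR NI : Type u} {Node : Type} (P : Program NC NR NI Node)
    (r : NR) (a b : NI) : Prop :=
  ∀ J : DInterp NC NR NI Node, J.Models P → J.rol r (J.ind a) (J.ind b)

/-- `P ⊨ a ≈ b`. -/
def Program.EntailsEq {NC NR NI : Type u} {Node : Type} (P : Program NC NR NI Node)
    (a b : NI) : Prop :=
  ∀ J : DInterp NC NR NI Node, J.Models P → J.ind a = J.ind b

/-- Translation of atoms of DL-safe rules: `C` becomes `S_C` and `r` becomes `S_r`. -/
def Atom.toDatalog {NC NR NI : Type u} (Node : Type) : Atom NC NR NI → DAtom NC NR NI Node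
  | .con A t => .con (.name A) t
  | .rol r t s => .rol r t s
  | .eq t s => .eq t s

/-- The Datalog atom that tests the Boolean variable `v` at the pair `(x,y)` of variables, where
`x` is variable `0` and `y` is variable `1`. -/
def BVar.test {NC NR NI : Type u} (Node : Type) : BVar NC NR → DAtom NC NR NI Node
  | .fst C => .con C (.var 0)
  | .snd C => .con C (.var 1)
  | .role (.name r) => .rol r (.var 0) (.var 1)
  | .role (.inv r) => .rol r (.var 1) (.var 0)

/-- The rules of the program built from a decision diagram and a rule base. A DL-safe rule whose
head is a conjunction of several atoms is written as one rule for each of them. -/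
inductive DDRule {NC NR NI : Type u} {Node : Type} (O : BDD Node (BVar NC NR))
    (rules : Set (Rule NC NR NI)) : DRule NC NR NI Node → Prop
  | safe {ρ : Rule NC NR NI} {α : Atom NC NR NI} : ρ ∈ rules → α ∈ ρ.head →
      DDRule O rules ⟨ρ.body.map (Atom.toDatalog Node), [α.toDatalog Node]⟩
  | constraint {ρ : Rule NC NR NI} : ρ ∈ rules → ρ.head = [] →
      DDRule O rules ⟨ρ.body.map (Atom.toDatalog Node), []⟩
  | root : DDRule O rules ⟨[], [.node O.root (.var 0) (.var 1)]⟩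
  | false_ : DDRule O rules ⟨[.node O.false_ (.var 0) (.var 1)], []⟩
  | high {n : Node} : O.Inner n →
      DDRule O rules ⟨[(O.label n).test Node, .node n (.var 0) (.var 1)],
        [.node (O.high n) (.var 0) (.var 1)]⟩
  | low {n : Node} : O.Inner n →
      DDRule O rules ⟨[.node n (.var 0) (.var 1)],
        [.node (O.low n) (.var 0) (.var 1), (O.label n).test Node]⟩

/-- `P` is a program `DD(K)`, built from a decision diagram for the flattened TBox of `K`. -/
def UKB.IsDD {NC NR NI : Type u} {Node : Type} (K : UKB (Name NC) (Name NR) NI)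
    (P : Program (Name NC) (Name NR) NI Node) : Prop :=
  ∃ (K' : UKB (Name NC) (Name NR) NI) (O : BDD Node (BVar (Name NC) (Name NR))),
    Flat K K' ∧ O.Represents K'.tbox ∧ P = {ρ | DDRule O K.rules ρ}

end DL

namespace DL
variable {NC NR NI : Type u}

/-! ### Semantic preliminaries -/

-- Satisfiability and the three kinds of entailment depend only on which ground atoms over the
-- original vocabulary a model satisfies. It therefore suffices that every model of the knowledge
-- base has a model of the program with the same ground atoms, and conversely; this is
-- `ThetaSpec.program`. Agreement on ground atoms is `Interp.NamedEq`. Since the variables of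
-- DL-safe rules range over named individuals, it preserves satisfaction of rules, so the unnamed
-- part of a domain may be rebuilt at will.
--
-- From the knowledge base to the program, each transformation keeps the domain and interprets its
-- fresh names suitably: an abbreviation as its filler, `Self_R` as the set of reflexive points of
-- `R`, and the roles replacing a number restriction as graphs of functions that enumerate
-- successors. In the resulting model every pair of elements determines a domino, that is, the types
-- of both elements and the roles between them. By induction on the stages it satisfies the Boolean
-- function (`Interp.tboxFun_domino`). The named elements, with a node predicate holding where the
-- node accepts the domino, form a model of the program.
--
-- Conversely, in a model of the program the rules for diagram nodes force the domino of every pair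
-- of constants to be accepted (`DInterp.accepts_of_node`). Accepted dominoes are the transitions of
-- a labelled graph on types. The fixpoint conditions say that transitions can be inverted and that
-- every `∃` and every failing `∀` has a witness. Unravelling this graph from the constants gives a
-- model of the flat TBox (`exists_model_of_dominoes`), by the truth lemma
-- `Frame.Coherent.mem_concept_iff`. Restrictedness matters here: elements not joined by an edge of
-- the forest satisfy no restricted role expression.
--
-- This model satisfies only the approximation of functionality by `Θ_F`, which makes all
-- `R`-successors of an element agree in type and in connecting roles. A second unravelling
-- (`UKB.exists_forest_model`) creates at most one child per label, and none whose label is already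
-- realized by a named neighbour of a root or by the predecessor. Indistinguishable successors are
-- thereby merged, and the rule `R(x,y),R(x,z)→y≈z` handles roots.
--
-- All models of the output of flattening, `Θ_≤`, `Θ_H` and `Θ_≥` are models of the input. For `Θ_S`
-- the transitive roles are closed transitively. `closure_concept` shows that concepts in `cl(K)`
-- stay true, because `∀S.C ⊑ ∀S.∀S.C` carries universal constraints along paths. `named_transGen`
-- shows that no new role atom between named elements arises: a path that enters an anonymous tree
-- returns to its root through the same child, where `Self_R` supplies the loop, and the rest is the
-- transitivity rule.
--
-- Existence of the constructions rests on weights decreasing with every rewriting step, on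
-- finiteness of `cl(K)`, and on the complete decision diagram of a Boolean function.

@[simp] theorem Role.Inv_Inv (R : Role NR) : R.Inv.Inv = R := by cases R <;> rfl

@[simp] theorem Role.base_Inv (R : Role NR) : R.Inv.base = R.base := by cases R <;> rfl

@[simp] theorem Interp.role_Inv (I : Interp NC NR NI) (R : Role NR) (x y : I.Domain) :
    I.role R.Inv x y ↔ I.role R y x := by cases R <;> rfl

theorem Interp.mem_bot (I : Interp NC NR NI) (x : I.Domain) :
    x ∈ I.concept .bot ↔ False := Iff.rfl

theorem Interp.mem_neg (I : Interp NC NR NI) (C : Concept NC NR) (x : I.Domain) :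
    x ∈ I.concept (.neg C) ↔ x ∉ I.concept C := Iff.rfl

theorem Interp.mem_inter (I : Interp NC NR NI) (C D : Concept NC NR) (x : I.Domain) :
    x ∈ I.concept (.inter C D) ↔ x ∈ I.concept C ∧ x ∈ I.concept D := Iff.rfl

theorem Interp.mem_union (I : Interp NC NR NI) (C D : Concept NC NR) (x : I.Domain) :
    x ∈ I.concept (.union C D) ↔ x ∈ I.concept C ∨ x ∈ I.concept D := Iff.rfl

theorem Interp.mem_all (I : Interp NC NR NI) (U : RoleExpr NR) (C : Concept NC NR)
    (x : I.Domain) :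
    x ∈ I.concept (.all U C) ↔ ∀ y, I.roleExpr U x y → y ∈ I.concept C := Iff.rfl

theorem Interp.mem_ex (I : Interp NC NR NI) (U : RoleExpr NR) (C : Concept NC NR)
    (x : I.Domain) :
    x ∈ I.concept (.ex U C) ↔ ∃ y, I.roleExpr U x y ∧ y ∈ I.concept C := Iff.rfl

theorem Interp.mem_atMost (I : Interp NC NR NI) (n : ℕ) (R : Role NR) (C : Concept NC NR)
    (x : I.Domain) :
    x ∈ I.concept (.atMost n R C) ↔
      {y | I.role R x y ∧ y ∈ I.concept C}.encard ≤ (n : ℕ∞) := Iff.rfl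

theorem Interp.mem_atLeast (I : Interp NC NR NI) (n : ℕ) (R : Role NR) (C : Concept NC NR)
    (x : I.Domain) :
    x ∈ I.concept (.atLeast n R C) ↔
      ((n + 1 : ℕ) : ℕ∞) ≤ {y | I.role R x y ∧ y ∈ I.concept C}.encard := Iff.rfl

theorem Interp.roleExpr_inter (I : Interp NC NR NI) (U V : RoleExpr NR) (x y : I.Domain) :
    I.roleExpr (.inter U V) x y ↔ I.roleExpr U x y ∧ I.roleExpr V x y := Iff.rfl

theorem Interp.roleExpr_neg (I : Interp NC NR NI) (U : RoleExpr NR) (x y : I.Domain) :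
    I.roleExpr (.neg U) x y ↔ ¬ I.roleExpr U x y := Iff.rfl

/-- With `atLeast n` standing for `≥ (n+1)`, this makes `atMost n` and `atLeast n` exact duals,
without an index shift in the normal form. -/
theorem not_le_natCast_iff (e : ℕ∞) (n : ℕ) : ¬ e ≤ (n : ℕ∞) ↔ ((n + 1 : ℕ) : ℕ∞) ≤ e := by
  rw [not_le, Nat.cast_add, Nat.cast_one, ENat.add_one_le_iff (ENat.natCast_ne_top n)]

/-- Both halves go through one induction because `nnf` and `nnfNeg` call each other at negations. -/
theorem Interp.concept_nnf_and (I : Interp NC NR NI) (C : Concept NC NR) :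
    I.concept C.nnf = I.concept C ∧ I.concept C.nnfNeg = (I.concept C)ᶜ := by
  induction C with
  | name A => exact ⟨rfl, rfl⟩
  | top => exact ⟨rfl, by simp [Concept.nnfNeg, Interp.concept]⟩
  | bot => exact ⟨rfl, by simp [Concept.nnfNeg, Interp.concept]⟩
  | neg C ih => exact ⟨ih.2, by simp [Concept.nnfNeg, Interp.concept, ih.1]⟩
  | inter C D ihC ihD =>
    simp only [Concept.nnf, Concept.nnfNeg, Interp.concept, ihC, ihD, Set.compl_inter, and_self]
  | union C D ihC ihD =>
    simp only [Concept.nnf, Concept.nnfNeg, Interp.concept, ihC, ihD, Set.compl_union, and_self]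
  | all U C ih =>
    constructor
    · simp only [Concept.nnf, Interp.concept, ih]
    · ext x; simp [Concept.nnfNeg, Interp.concept, ih]
  | ex U C ih =>
    constructor
    · simp only [Concept.nnf, Interp.concept, ih]
    · ext x; simp [Concept.nnfNeg, Interp.concept, ih]
  | atMost n R C ih =>
    constructor
    · simp only [Concept.nnf, Interp.concept, ih]
    · ext x
      simp only [Concept.nnfNeg, Interp.concept, ih, Set.mem_ofPred_eq, Set.mem_compl_iff,
        not_le_natCast_iff]
  | atLeast n R C ih =>
    constructor
    · simp only [Concept.nnf, Interp.concept, ih]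
    · ext x
      simp only [Concept.nnfNeg, Interp.concept, ih, Set.mem_ofPred_eq, Set.mem_compl_iff,
        ← not_le_natCast_iff, not_not]

theorem Interp.concept_nnf (I : Interp NC NR NI) (C : Concept NC NR) :
    I.concept C.nnf = I.concept C := (I.concept_nnf_and C).1

theorem Interp.mem_nnfNeg (I : Interp NC NR NI) (C : Concept NC NR) (x : I.Domain) :
    x ∈ I.concept C.nnfNeg ↔ x ∉ I.concept C := by rw [(I.concept_nnf_and C).2]; rfl

/-- Used for fillers `C.nnf` of number restrictions: their negation normal form is again `C.nnfNeg`,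
so closing `cl(K)` under negated fillers creates nothing new. -/
theorem nnf_nnf_and (C : Concept NC NR) :
    (C.nnf.nnf = C.nnf ∧ C.nnfNeg.nnf = C.nnfNeg) ∧
      C.nnf.nnfNeg = C.nnfNeg ∧ C.nnfNeg.nnfNeg = C.nnf := by
  induction C <;> simp_all [Concept.nnf, Concept.nnfNeg]

/-- `I` is a model of the knowledge base `K`. -/
def UKB.IsModel (K : UKB NC NR NI) (I : Interp NC NR NI) : Prop :=
  (∀ C ∈ K.tbox, ∀ x, x ∈ I.concept C) ∧ (∀ α ∈ K.rbox, I.SatRoleAxiom α) ∧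
    ∀ ρ ∈ K.rules, I.SatRule ρ

/-- The two interpretations satisfy the same ground atoms. -/
structure Interp.NamedEq (I I' : Interp NC NR NI) : Prop where
  con : ∀ A a, I.ind a ∈ I.con A ↔ I'.ind a ∈ I'.con A
  rol : ∀ r a b, I.rol r (I.ind a) (I.ind b) ↔ I'.rol r (I'.ind a) (I'.ind b)
  eq : ∀ a b, I.ind a = I.ind b ↔ I'.ind a = I'.ind b

theorem Interp.NamedEq.refl (I : Interp NC NR NI) : I.NamedEq I :=
  ⟨fun _ _ => Iff.rfl, fun _ _ _ => Iff.rfl, fun _ _ => Iff.rfl⟩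

theorem Interp.NamedEq.symm {I I' : Interp NC NR NI} (h : I.NamedEq I') : I'.NamedEq I :=
  ⟨fun A a => (h.con A a).symm, fun r a b => (h.rol r a b).symm, fun a b => (h.eq a b).symm⟩

theorem Interp.NamedEq.trans {I I' I'' : Interp NC NR NI} (h : I.NamedEq I')
    (h' : I'.NamedEq I'') : I.NamedEq I'' :=
  ⟨fun A a => (h.con A a).trans (h'.con A a), fun r a b => (h.rol r a b).trans (h'.rol r a b),
    fun a b => (h.eq a b).trans (h'.eq a b)⟩

/-- Term evaluation with variables ranging over individual names. -/
def Term.inst (z : ℕ → NI) : Term NI → NI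
  | .var v => z v
  | .ind a => a

theorem Interp.term_inst (I : Interp NC NR NI) (z : ℕ → NI) (t : Term NI) :
    I.term (fun v => I.ind (z v)) t = I.ind (t.inst z) := by cases t <;> rfl

/-- The ground instance of `α` under `z` holds in `I`. -/
def Interp.Ground (I : Interp NC NR NI) (z : ℕ → NI) (α : Atom NC NR NI) : Prop :=
  I.SatAtom (fun v => I.ind (z v)) α

/-- DL-safety in usable form: an assignment into the named elements comes from an assignment of
names, so only ground atoms matter. -/
theorem Interp.satRule_iff (I : Interp NC NR NI) (ρ : Rule NC NR NI) :
    I.SatRule ρ ↔ ∀ z : ℕ → NI, (∀ α ∈ ρ.body, I.Ground z α) →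
      ρ.head ≠ [] ∧ ∀ α ∈ ρ.head, I.Ground z α := by
  constructor
  · intro h z hz
    exact h _ (fun v => ⟨_, rfl⟩) hz
  · intro h Z hZ
    choose z hz using hZ
    obtain rfl : Z = fun v => I.ind (z v) := funext fun v => (hz v).symm
    exact h z

theorem Interp.NamedEq.ground_iff {I I' : Interp NC NR NI} (h : I.NamedEq I') (z : ℕ → NI)
    (α : Atom NC NR NI) : I.Ground z α ↔ I'.Ground z α := by
  cases α <;> simp only [Interp.Ground, Interp.SatAtom, Interp.term_inst, h.con, h.rol, h.eq]

theorem Interp.NamedEq.satRule {I I' : Interp NC NR NI} (h : I.NamedEq I')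
    {ρ : Rule NC NR NI} (hI : I.SatRule ρ) : I'.SatRule ρ := by
  rw [Interp.satRule_iff] at hI ⊢
  simpa only [h.ground_iff] using hI

theorem Interp.ground_roleAtom (I : Interp NC NR NI) (z : ℕ → NI) (R : Role NR) (t s : Term NI) :
    I.Ground z (roleAtom R t s) ↔ I.role R (I.ind (t.inst z)) (I.ind (s.inst z)) := by
  cases R <;> simp only [roleAtom, Interp.Ground, Interp.SatAtom, Interp.term_inst, Interp.role]

/-! ### Changing the interpretation of names -/

/-- Replacing the interpretation of concept and role names. -/
def Interp.withNames (I : Interp NC NR NI) (con : NC → Set I.Domain)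
    (rol : NR → I.Domain → I.Domain → Prop) : Interp NC NR NI :=
  ⟨I.Domain, I.ind, con, rol⟩

section Congr

variable {I : Interp NC NR NI} {con : NC → Set I.Domain}
  {rol : NR → I.Domain → I.Domain → Prop}

theorem Interp.withNames_role {R : Role NR} (h : rol R.base = I.rol R.base) :
    (I.withNames con rol).role R = I.role R := by
  cases R <;> (funext x y; exact congrFun (congrFun h _) _)

theorem Interp.withNames_roleExpr {U : RoleExpr NR} (h : ∀ r ∈ U.roleNames, rol r = I.rol r) :
    (I.withNames con rol).roleExpr U = I.roleExpr U := by
  have h' : ∀ R ∈ U.roles, rol R.base = I.rol R.base := fun R hR => h _ ⟨R, hR, rfl⟩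
  clear h
  induction U with
  | atom R => exact Interp.withNames_role (h' R rfl)
  | neg U ih => funext x y; exact congrArg Not (congrFun (congrFun (ih h') x) y)
  | inter U V ihU ihV =>
    funext x y
    exact congrArg₂ And (congrFun (congrFun (ihU fun R hR => h' R (.inl hR)) x) y)
      (congrFun (congrFun (ihV fun R hR => h' R (.inr hR)) x) y)
  | union U V ihU ihV =>
    funext x y
    exact congrArg₂ Or (congrFun (congrFun (ihU fun R hR => h' R (.inl hR)) x) y)
      (congrFun (congrFun (ihV fun R hR => h' R (.inr hR)) x) y)

theorem Interp.withNames_concept {C : Concept NC NR} (hc : ∀ A ∈ C.conNames, con A = I.con A)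
    (hr : ∀ r ∈ C.roleNames, rol r = I.rol r) :
    (I.withNames con rol).concept C = I.concept C := by
  induction C with
  | name A => exact hc A rfl
  | top => rfl
  | bot => rfl
  | neg C ih => exact congrArg compl (ih hc hr)
  | inter C D ihC ihD =>
    exact congrArg₂ (· ∩ ·) (ihC (fun A h => hc A (.inl h)) fun r h => hr r (.inl h))
      (ihD (fun A h => hc A (.inr h)) fun r h => hr r (.inr h))
  | union C D ihC ihD =>
    exact congrArg₂ (· ∪ ·) (ihC (fun A h => hc A (.inl h)) fun r h => hr r (.inl h))
      (ihD (fun A h => hc A (.inr h)) fun r h => hr r (.inr h))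
  | all U C ih =>
    simp only [Interp.concept, ih hc fun r h => hr r (.inr h),
      Interp.withNames_roleExpr (con := con) fun r h => hr r (.inl h)]
    rfl
  | ex U C ih =>
    simp only [Interp.concept, ih hc fun r h => hr r (.inr h),
      Interp.withNames_roleExpr (con := con) fun r h => hr r (.inl h)]
    rfl
  | atMost n R C ih =>
    simp only [Interp.concept, ih hc fun r h => hr r (.inr h),
      Interp.withNames_role (con := con) (hr _ (.inl rfl))]
    rfl
  | atLeast n R C ih =>
    simp only [Interp.concept, ih hc fun r h => hr r (.inr h),
      Interp.withNames_role (con := con) (hr _ (.inl rfl))]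
    rfl

theorem Interp.withNames_satRoleAxiom {α : RoleAxiom NR} (hr : ∀ r ∈ α.roleNames, rol r = I.rol r)
    (h : I.SatRoleAxiom α) : (I.withNames con rol).SatRoleAxiom α := by
  cases α with
  | incl U V =>
    intro x y
    rw [Interp.withNames_roleExpr fun r h => hr r (.inl h),
      Interp.withNames_roleExpr fun r h => hr r (.inr h)]
    exact h x y
  | trans R =>
    intro x y z
    rw [Interp.withNames_role (hr _ rfl)]
    exact h x y z

theorem Interp.withNames_satAtom {α : Atom NC NR NI} (hc : ∀ A ∈ α.conNames, con A = I.con A)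
    (hr : ∀ r ∈ α.roleNames, rol r = I.rol r) (Z : ℕ → I.Domain) :
    (I.withNames con rol).SatAtom Z α ↔ I.SatAtom Z α := by
  have ht : ∀ t, (I.withNames con rol).term Z t = I.term Z t := fun t => by cases t <;> rfl
  cases α with
  | con A t => simp only [Interp.SatAtom, ht]; exact iff_of_eq (congrArg (_ ∈ ·) (hc A rfl))
  | rol r t s =>
    simp only [Interp.SatAtom, ht]
    exact iff_of_eq (congrFun (congrFun (hr r rfl) _) _)
  | eq t s => simp only [Interp.SatAtom, ht]; rfl

/-- Licenses every reinterpretation of fresh names below: a model stays a model if no occurring name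
is touched. -/
theorem UKB.IsModel.withNames {K : UKB NC NR NI} (h : K.IsModel I)
    (hc : ∀ A ∈ K.conNames, con A = I.con A) (hr : ∀ r ∈ K.roleNames, rol r = I.rol r) :
    K.IsModel (I.withNames con rol) := by
  refine ⟨fun C hC x => ?_, fun α hα => ?_, fun ρ hρ Z hZ hb => ?_⟩
  · rw [Interp.withNames_concept (fun A hA => hc A (.inl ⟨C, hC, hA⟩))
      fun r h => hr r (.inl ⟨C, hC, h⟩)]
    exact h.1 C hC x
  · exact Interp.withNames_satRoleAxiom (fun r h => hr r (.inr (.inl ⟨α, hα, h⟩))) (h.2.1 α hα)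
  · have key : ∀ α, (α ∈ ρ.body ∨ α ∈ ρ.head) →
        ((I.withNames con rol).SatAtom Z α ↔ I.SatAtom Z α) := fun α hα =>
      Interp.withNames_satAtom (fun A hA => hc A (.inr ⟨ρ, hρ, α, hα, hA⟩))
        (fun r h => hr r (.inr (.inr ⟨ρ, hρ, α, hα, h⟩))) Z
    obtain ⟨h1, h2⟩ := h.2.2 ρ hρ Z hZ fun α hα => (key α (.inl hα)).1 (hb α hα)
    exact ⟨h1, fun α hα => (key α (.inr hα)).2 (h2 α hα)⟩

end Congr

/-! ### Replacing outermost occurrences -/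

/-- The replaced position is under `⊓` and `⊔` only, hence positive and evaluated at the same
element; a one-directional implication at `x` is enough. -/
theorem ReplaceOuter.mono {I : Interp NC NR NI} {X Y E E' : Concept NC NR} {x : I.Domain}
    (h : ReplaceOuter X Y E E') (hXY : x ∈ I.concept X → x ∈ I.concept Y) :
    x ∈ I.concept E → x ∈ I.concept E' := by
  induction h with
  | here => exact hXY
  | interL D _ ih => exact fun h => ⟨ih h.1, h.2⟩
  | interR D _ ih => exact fun h => ⟨h.1, ih h.2⟩
  | unionL D _ ih => exact fun h => h.imp ih id
  | unionR D _ ih => exact fun h => h.imp id ih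

theorem ReplaceOuter.symm {X Y E E' : Concept NC NR} (h : ReplaceOuter X Y E E') :
    ReplaceOuter Y X E' E := by
  induction h with
  | here => exact .here
  | interL D _ ih => exact .interL D ih
  | interR D _ ih => exact .interR D ih
  | unionL D _ ih => exact .unionL D ih
  | unionR D _ ih => exact .unionR D ih

theorem ReplaceOuter.conNames {X Y E E' : Concept NC NR} (h : ReplaceOuter X Y E E') :
    X.conNames ⊆ E.conNames := by
  induction h with
  | here => exact subset_rfl
  | interL D _ ih => exact ih.trans Set.subset_union_left
  | interR D _ ih => exact ih.trans Set.subset_union_right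
  | unionL D _ ih => exact ih.trans Set.subset_union_left
  | unionR D _ ih => exact ih.trans Set.subset_union_right

theorem ReplaceOuter.roleNames {X Y E E' : Concept NC NR} (h : ReplaceOuter X Y E E') :
    X.roleNames ⊆ E.roleNames := by
  induction h with
  | here => exact subset_rfl
  | interL D _ ih => exact ih.trans Set.subset_union_left
  | interR D _ ih => exact ih.trans Set.subset_union_right
  | unionL D _ ih => exact ih.trans Set.subset_union_left
  | unionR D _ ih => exact ih.trans Set.subset_union_right

theorem ReplaceOuter.parts_left {X Y E E' : Concept NC NR} (h : ReplaceOuter X Y E E') :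
    X.parts ⊆ E.parts := by
  induction h with
  | here => exact subset_rfl
  | interL D _ ih => exact ih.trans Set.subset_union_left
  | interR D _ ih => exact ih.trans Set.subset_union_right
  | unionL D _ ih => exact ih.trans Set.subset_union_left
  | unionR D _ ih => exact ih.trans Set.subset_union_right

theorem ReplaceOuter.parts_right {X Y E E' : Concept NC NR} (h : ReplaceOuter X Y E E') :
    E'.parts ⊆ E.parts ∪ Y.parts := by
  induction h with
  | here => exact Set.subset_union_right
  | interL D _ ih | interR D _ ih | unionL D _ ih | unionR D _ ih =>
    simp only [Concept.parts]
    intro Z hZ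
    rcases hZ with hZ | hZ <;> first
      | exact .inl (.inl hZ)
      | exact .inl (.inr hZ)
      | (rcases ih hZ with h | h
         · first | exact .inl (.inl h) | exact .inl (.inr h)
         · exact .inr h)

/-! ### Soundness and conservativity of the rewriting steps -/

section Steps

/-- The interpretation of the original vocabulary. -/
def Interp.reduct (I : Interp (Name NC) (Name NR) NI) : Interp NC NR NI :=
  ⟨I.Domain, I.ind, fun A => I.con (.orig A), fun r => I.rol (.orig r)⟩

theorem Interp.NamedEq.reduct {I I' : Interp (Name NC) (Name NR) NI} (h : I.NamedEq I') :
    I.reduct.NamedEq I'.reduct :=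
  ⟨fun _ a => h.con _ a, fun _ a b => h.rol _ a b, h.eq⟩

/-- Every model of `K` yields a model of `K'` with the same original named part. -/
def UKB.Extends (K K' : UKB (Name NC) (Name NR) NI) : Prop :=
  ∀ I, K.IsModel I → ∃ I', K'.IsModel I' ∧ I.reduct.NamedEq I'.reduct

/-- Every model of `K'` is a model of `K`. -/
def UKB.Reflects (K K' : UKB (Name NC) (Name NR) NI) : Prop :=
  ∀ I, K'.IsModel I → K.IsModel I

theorem UKB.Extends.refl (K : UKB (Name NC) (Name NR) NI) : K.Extends K :=
  fun I h => ⟨I, h, .refl _⟩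

theorem UKB.Extends.trans {K K' K'' : UKB (Name NC) (Name NR) NI} (h : K.Extends K')
    (h' : K'.Extends K'') : K.Extends K'' := fun I hI => by
  obtain ⟨I', hI', e⟩ := h I hI
  obtain ⟨I'', hI'', e'⟩ := h' I' hI'
  exact ⟨I'', hI'', e.trans e'⟩

theorem UKB.Reflects.trans {K K' K'' : UKB (Name NC) (Name NR) NI} (h : K.Reflects K')
    (h' : K'.Reflects K'') : K.Reflects K'' := fun I hI => h I (h' I hI)

theorem Exhausts.extends {step : UKB (Name NC) (Name NR) NI → UKB (Name NC) (Name NR) NI → Prop}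
    (hs : ∀ K K', step K K' → K.Extends K') {K K' : UKB (Name NC) (Name NR) NI}
    (h : Exhausts step K K') : K.Extends K' := by
  obtain ⟨h, -⟩ := h
  induction h with
  | refl => exact .refl _
  | tail _ h ih => exact ih.trans (hs _ _ h)

theorem Exhausts.reflects {step : UKB (Name NC) (Name NR) NI → UKB (Name NC) (Name NR) NI → Prop}
    (hs : ∀ K K', step K K' → K.Reflects K') {K K' : UKB (Name NC) (Name NR) NI}
    (h : Exhausts step K K') : K.Reflects K' := by
  obtain ⟨h, -⟩ := h
  induction h with
  | refl => exact fun I h => h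
  | tail _ h ih => exact ih.trans (hs _ _ h)

theorem UKB.isModel_nnf {K : UKB NC NR NI} {I : Interp NC NR NI} :
    K.nnf.IsModel I ↔ K.IsModel I := by
  refine and_congr_left fun _ => ?_
  simp only [UKB.nnf, Set.forall_mem_image, Interp.concept_nnf]

/-! #### Flattening -/

/-- The connecting axiom gives `F ⊆ D` for the monotone constructors and `D ⊆ F` for the antitone
`≤`, in each case the direction that makes the abbreviated concept stronger. -/
theorem Abbreviate.reflects {I : Interp NC NR NI} {F : NC} {D X X' G : Concept NC NR}
    (h : Abbreviate F D X X' G) (hG : ∀ x, x ∈ I.concept G) (x : I.Domain) :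
    x ∈ I.concept X' → x ∈ I.concept X := by
  cases h with
  | all U => exact fun h y hy => (hG y).resolve_left (not_not.2 (h y hy))
  | ex U => exact fun ⟨y, hy, hF⟩ => ⟨y, hy, (hG y).resolve_left (not_not.2 hF)⟩
  | atLeast n R =>
    exact fun h => le_trans h (Set.encard_le_encard fun y (hy : _ ∧ _) =>
      And.intro hy.1 ((hG y).resolve_left (not_not.2 hy.2)))
  | atMost n R =>
    exact fun h => le_trans (Set.encard_le_encard fun y (hy : _ ∧ _) =>
      And.intro hy.1 ((hG y).resolve_left fun h' => (I.mem_nnfNeg D y).1 h' hy.2)) h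

/-- If `F` has the very extension of `D`, the abbreviation changes nothing and the connecting axiom
is a tautology. -/
theorem Abbreviate.extends {I : Interp NC NR NI} {F : NC} {D X X' G : Concept NC NR}
    (h : Abbreviate F D X X' G) (hF : I.con F = I.concept D) :
    (∀ x, x ∈ I.concept G) ∧ ∀ x, x ∈ I.concept X → x ∈ I.concept X' := by
  have hF' : I.concept (.name F) = I.concept D := hF
  cases h with
  | all U =>
    refine ⟨fun x => ?_, fun x => ?_⟩
    · rw [Interp.mem_union, Interp.mem_neg, hF']; exact (em _).symm
    · simp only [Interp.mem_all, hF', imp_self]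
  | ex U =>
    refine ⟨fun x => ?_, fun x => ?_⟩
    · rw [Interp.mem_union, Interp.mem_neg, hF']; exact (em _).symm
    · simp only [Interp.mem_ex, hF', imp_self]
  | atLeast n R =>
    refine ⟨fun x => ?_, fun x => ?_⟩
    · rw [Interp.mem_union, Interp.mem_neg, hF']; exact (em _).symm
    · simp only [Interp.mem_atLeast, hF', imp_self]
  | atMost n R =>
    refine ⟨fun x => ?_, fun x => ?_⟩
    · rw [Interp.mem_union, Interp.mem_nnfNeg, hF']; exact (em _).symm
    · simp only [Interp.mem_atMost, hF', imp_self]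

theorem Abbreviate.conNames_subset {F : NC} {D X X' G : Concept NC NR}
    (h : Abbreviate F D X X' G) : D.conNames = X.conNames := by
  cases h <;> rfl

theorem FlatStep.reflects {K K' : UKB (Name NC) (Name NR) NI} (h : FlatStep K K') :
    K.Reflects K' := by
  obtain ⟨E, E', X, X', G, D, k, hE, -, -, hA, hR, rfl⟩ := h
  intro I hI
  refine ⟨fun C hC x => ?_, hI.2⟩
  by_cases hCE : C = E
  · subst hCE
    exact hR.symm.mono (hA.reflects (hI.1 G (.inr (.inr rfl))) x) (hI.1 E' (.inr (.inl rfl)) x)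
  · exact hI.1 C (.inl ⟨hC, hCE⟩) x

theorem FlatStep.extends {K K' : UKB (Name NC) (Name NR) NI} (h : FlatStep K K') :
    K.Extends K' := by
  classical
  obtain ⟨E, E', X, X', G, D, k, hE, -, hk, hA, hR, rfl⟩ := h
  intro I hI
  -- The abbreviating name is interpreted by its filler; freshness keeps all old axioms and rules
  -- true and leaves the extension of `D` unaffected.
  let con := Function.update I.con (.fresh k) (I.concept D)
  have hcon : ∀ A ∈ K.conNames, con A = I.con A := fun A hA =>
    Function.update_of_ne (by rintro rfl; exact hk hA) _ _
  have hI' : K.IsModel (I.withNames con I.rol) := hI.withNames hcon fun _ _ => rfl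
  have hD : (I.withNames con I.rol).con (.fresh k) = (I.withNames con I.rol).concept D := by
    rw [Interp.withNames_concept _ fun _ _ => rfl]
    · exact Function.update_self (Name.fresh k) (I.concept D) I.con
    · intro A hA'
      rw [hA.conNames_subset] at hA'
      exact hcon A (.inl ⟨E, hE, hR.conNames hA'⟩)
  obtain ⟨hG, hX⟩ := hA.extends hD
  refine ⟨_, ⟨fun C hC x => ?_, hI'.2⟩, fun A a => ?_, fun _ _ _ => Iff.rfl, fun _ _ => Iff.rfl⟩
  · rcases hC with hC | rfl | rfl
    · exact hI'.1 C hC.1 x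
    · exact hR.mono (hX x) (hI'.1 E hE x)
    · exact hG x
  · change _ ↔ _ ∈ con (.orig A)
    simp only [con, Function.update_of_ne (show Name.orig A ≠ .fresh k by simp)]
    rfl

theorem Flat.reflects {K K' : UKB (Name NC) (Name NR) NI} (h : Flat K K') : K.Reflects K' :=
  fun I hI => UKB.isModel_nnf.1 (Exhausts.reflects (fun _ _ => FlatStep.reflects) h I hI)

theorem Flat.extends {K K' : UKB (Name NC) (Name NR) NI} (h : Flat K K') : K.Extends K' :=
  fun I hI => Exhausts.extends (fun _ _ => FlatStep.extends) h I (UKB.isModel_nnf.2 hI)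

/-! #### At-least restrictions -/

theorem Interp.mem_exInter (I : Interp NC NR NI) (rs : ℕ → NR) (C : Concept NC NR) (n : ℕ)
    (x : I.Domain) :
    x ∈ I.concept (exInter rs C n) ↔ ∀ i ≤ n, ∃ y, I.rol (rs i) x y ∧ y ∈ I.concept C := by
  induction n with
  | zero =>
    simp only [exInter, nonpos_iff_eq_zero, forall_eq]
    rfl
  | succ n ih =>
    simp only [exInter, Interp.mem_inter, ih, Nat.le_succ_iff, or_imp, forall_and, forall_eq]
    rfl

/-- The witnesses for different fresh roles are different by the disjointness axioms, and all are
`R`-successors by the new inclusions. This yields `n+1` fillers, indexed by `Set.Iic n`. -/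
theorem GeStep.reflects {K K' : UKB (Name NC) (Name NR) NI} (h : GeStep K K') :
    K.Reflects K' := by
  obtain ⟨E, E', C, n, R, f, hE, hf, hinj, hR, rfl⟩ := h
  intro I hI
  refine ⟨fun C' hC x => ?_, fun α hα => hI.2.1 α (.inl hα), hI.2.2⟩
  by_cases hCE : C' = E
  · subst hCE
    refine hR.symm.mono (fun hx => ?_) (hI.1 E' (.inl (.inr rfl)) x)
    rw [Interp.mem_exInter] at hx
    rw [Interp.mem_atLeast]
    have : Nonempty I.Domain := ⟨x⟩
    choose! y hy hyC using hx
    have hinjy : Set.InjOn y (Set.Iic n) := by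
      have key : ∀ i ≤ n, ∀ k ≤ n, i < k → y i ≠ y k := fun i hi k hk hik he =>
        hI.1 _ (.inr ⟨i, k, hik, hk, rfl⟩) x (y i) ⟨hy i hi, by rw [he]; exact hy k hk⟩
      intro i hi k hk he
      rcases lt_trichotomy i k with h | h | h
      · exact (key i hi k hk h he).elim
      · exact h
      · exact (key k hk i hi h he.symm).elim
    have hcard : ((n + 1 : ℕ) : ℕ∞) = (y '' Set.Iic n).encard := by
      rw [hinjy.encard_image, ← Finset.coe_Iic, Set.encard_coe_eq_coe_finsetCard, Nat.card_Iic]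
    rw [hcard]
    refine Set.encard_le_encard ?_
    rintro _ ⟨i, hi, rfl⟩
    exact ⟨hI.2.1 _ (.inr ⟨i, hi, rfl⟩) x _ (hy i hi), hyC i hi⟩
  · exact hI.1 C' (.inl (.inl ⟨hC, hCE⟩)) x

theorem exists_injOn_of_le_encard {α : Type*} [Nonempty α] {s : Set α} {n : ℕ}
    (h : ((n + 1 : ℕ) : ℕ∞) ≤ s.encard) :
    ∃ g : ℕ → α, (∀ i ≤ n, g i ∈ s) ∧ ∀ i ≤ n, ∀ k ≤ n, g i = g k → i = k := by
  obtain ⟨t, hts, ht⟩ := Set.exists_subset_encard_eq h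
  have hfin : t.Finite := Set.finite_of_encard_eq_coe ht
  have hle : ((Set.Iic n).encard : ℕ∞) ≤ t.encard := by
    rw [ht, ← Finset.coe_Iic, Set.encard_coe_eq_coe_finsetCard, Nat.card_Iic]
  obtain ⟨g, hg, hinj⟩ := (Set.finite_Iic n).exists_injOn_of_encard_le hle
  exact ⟨g, fun i hi => hts (hg hi), fun i hi k hk h => hinj hi hk h⟩

theorem exists_cover_of_encard_le {α : Type*} [Nonempty α] {s : Set α} {n : ℕ}
    (h : s.encard ≤ (n : ℕ∞)) : ∃ g : ℕ → α, ∀ y ∈ s, ∃ i < n, g i = y := by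
  have hfin : s.Finite := Set.finite_of_encard_le_coe h
  have hle : s.encard ≤ (Set.Iio n).encard := by
    rwa [← Finset.coe_Iio, Set.encard_coe_eq_coe_finsetCard, Nat.card_Iio]
  obtain ⟨g, hg, hinj⟩ := hfin.exists_injOn_of_encard_le hle
  refine ⟨Function.invFunOn g s, fun y hy => ⟨g y, hg hy, hinj.leftInvOn_invFunOn hy⟩⟩

/-- Interpreting the fresh names `f i` for `i ∈ s` by `rel i`, the others as before. -/
def freshRoles {D : Type*} (s : Set ℕ) (f : ℕ → ℕ) (rel : ℕ → D → D → Prop)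
    (rol : Name NR → D → D → Prop) : Name NR → D → D → Prop
  | .orig r => rol (.orig r)
  | .fresh k => fun x y => (∃ i ∈ s, f i = k ∧ rel i x y) ∨ ((∀ i ∈ s, f i ≠ k) ∧ rol (.fresh k) x y)

theorem freshRoles_fresh {D : Type*} {s : Set ℕ} {f : ℕ → ℕ} (rel : ℕ → D → D → Prop)
    (rol : Name NR → D → D → Prop) (hf : Set.InjOn f s) {i : ℕ} (hi : i ∈ s) :
    freshRoles s f rel rol (.fresh (f i)) = rel i := by
  funext x y
  refine propext ⟨?_, fun h => .inl ⟨i, hi, rfl, h⟩⟩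
  rintro (⟨j, hj, he, h⟩ | ⟨h, -⟩)
  · rwa [← hf hj hi he]
  · exact (h i hi rfl).elim

theorem freshRoles_of_forall_ne {D : Type*} {s : Set ℕ} {f : ℕ → ℕ} (rel : ℕ → D → D → Prop)
    (rol : Name NR → D → D → Prop) {r : Name NR} (hr : ∀ i ∈ s, Name.fresh (f i) ≠ r) :
    freshRoles s f rel rol r = rol r := by
  cases r with
  | orig r => rfl
  | fresh k =>
    funext x y
    refine propext ⟨?_, fun h => .inr ⟨fun i hi he => hr i hi (he ▸ rfl), h⟩⟩
    rintro (⟨j, hj, he, -⟩ | ⟨-, h⟩)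
    · exact (hr j hj (he ▸ rfl)).elim
    · exact h

/-- Wherever the restriction holds, `n+1` distinct fillers are chosen, and the `i`-th fresh role
points to the `i`-th of them. -/
theorem GeStep.extends {K K' : UKB (Name NC) (Name NR) NI} (h : GeStep K K') :
    K.Extends K' := by
  obtain ⟨E, E', C, n, R, f, hE, hf, hinj, hR, rfl⟩ := h
  intro I hI
  have hg : ∀ x : I.Domain, ∃ g : ℕ → I.Domain, x ∈ I.concept (.atLeast n R C) →
      (∀ i ≤ n, I.role R x (g i) ∧ g i ∈ I.concept C) ∧
        ∀ i ≤ n, ∀ k ≤ n, g i = g k → i = k := by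
    intro x
    by_cases hx : x ∈ I.concept (.atLeast n R C)
    · have : Nonempty I.Domain := ⟨x⟩
      obtain ⟨g, hg⟩ := exists_injOn_of_le_encard hx
      exact ⟨g, fun _ => hg⟩
    -- An arbitrary choice: the value of `g` is never used where the restriction fails.
    · exact ⟨fun _ => x, fun h => (hx h).elim⟩
  choose g hg using hg
  -- The relation is empty outside the restriction; there the chosen values need be neither
  -- `R`-successors nor distinct, which could violate the inclusion and disjointness axioms.
  let rel : ℕ → I.Domain → I.Domain → Prop := fun i x y =>
    x ∈ I.concept (.atLeast n R C) ∧ y = g x i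
  let rol := freshRoles (Set.Iic n) f rel I.rol
  have hrol : ∀ i ≤ n, ∀ x y : I.Domain, (I.withNames I.con rol).rol (.fresh (f i)) x y ↔
      x ∈ I.concept (.atLeast n R C) ∧ y = g x i := fun i hi x y =>
    iff_of_eq (congrFun (congrFun
      (freshRoles_fresh rel I.rol (fun i hi k hk => hinj i hi k hk) (Set.mem_Iic.2 hi)) x) y)
  have hsame : ∀ r ∈ K.roleNames, rol r = I.rol r := fun r hr =>
    freshRoles_of_forall_ne _ _ fun i hi h => hf i hi (h ▸ hr)
  have hI' : K.IsModel (I.withNames I.con rol) := hI.withNames (fun _ _ => rfl) hsame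
  have hX : ∀ r ∈ (Concept.atLeast n R C).roleNames, rol r = I.rol r := fun r hr =>
    hsame r (.inl ⟨E, hE, hR.roleNames hr⟩)
  have hC : (I.withNames I.con rol).concept C = I.concept C :=
    Interp.withNames_concept (fun _ _ => rfl) fun r hr => hX r (.inr hr)
  have hXc : (I.withNames I.con rol).concept (.atLeast n R C) = I.concept (.atLeast n R C) :=
    Interp.withNames_concept (fun _ _ => rfl) hX
  have hRr : (I.withNames I.con rol).role R = I.role R :=
    Interp.withNames_role (hX _ (.inl rfl))
  refine ⟨_, ⟨fun C' hC' x => ?_, fun α hα => ?_, hI'.2.2⟩, fun _ _ => Iff.rfl,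
    fun _ _ _ => Iff.rfl, fun _ _ => Iff.rfl⟩
  · rcases hC' with (hC' | rfl) | ⟨i, k, hik, hk, rfl⟩
    · exact hI'.1 C' hC'.1 x
    · refine hR.mono (fun hx => ?_) (hI'.1 E hE x)
      rw [hXc] at hx
      rw [Interp.mem_exInter]
      intro i hi
      refine ⟨g x i, (hrol i hi _ _).2 ⟨hx, rfl⟩, ?_⟩
      rw [hC]
      exact ((hg x hx).1 i hi).2
    · rintro y ⟨h1, h2⟩
      replace h1 := (hrol i (hik.le.trans hk) _ _).1 h1
      replace h2 := (hrol k hk _ _).1 h2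
      exact hik.ne ((hg x h1.1).2 i (hik.le.trans hk) k hk (h1.2.symm.trans h2.2))
  · rcases hα with hα | ⟨i, hi, rfl⟩
    · exact hI'.2.1 α hα
    · intro x y h1
      obtain ⟨hx, rfl⟩ := (hrol i hi _ _).1 h1
      exact (iff_of_eq (congrFun (congrFun hRr x) _)).2 ((hg x hx).1 i hi).1

/-! #### Role inclusions -/

theorem UKB.isModel_thetaH {K : UKB NC NR NI} {I : Interp NC NR NI} :
    K.thetaH.IsModel I ↔ K.IsModel I := by
  have key : ∀ U V, (∀ x, x ∈ I.concept (.all (.inter U (.neg V)) .bot)) ↔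
      I.SatRoleAxiom (.incl U V) := fun U V =>
    forall_congr' fun x => forall_congr' fun y => by
      simp only [Interp.mem_bot, Interp.roleExpr_inter, Interp.roleExpr_neg]
      tauto
  constructor
  · rintro ⟨h1, h2, h3⟩
    refine ⟨fun C hC => h1 C (.inl hC), fun α hα => ?_, h3⟩
    by_cases h : ∃ U V, α = .incl U V
    · obtain ⟨U, V, rfl⟩ := h
      exact (key U V).1 (h1 _ (.inr ⟨U, V, hα, rfl⟩))
    · push Not at h
      exact h2 α ⟨hα, h⟩
  · rintro ⟨h1, h2, h3⟩
    refine ⟨?_, fun α hα => h2 α hα.1, h3⟩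
    rintro C (hC | ⟨U, V, hα, rfl⟩)
    · exact h1 C hC
    · exact (key U V).2 (h2 _ hα)

/-! #### At-most restrictions -/

theorem Interp.roleExpr_roleMinus (I : Interp NC NR NI) (R : Role NR) (rs : ℕ → NR) (n : ℕ)
    (x y : I.Domain) :
    I.roleExpr (roleMinus R rs n) x y ↔ I.role R x y ∧ ∀ i < n, ¬ I.rol (rs i) x y := by
  induction n with
  | zero => simp [roleMinus, Interp.roleExpr]
  | succ n ih =>
    simp only [roleMinus, Interp.roleExpr_inter, Interp.roleExpr_neg, ih, Nat.lt_succ_iff_lt_or_eq,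
      or_imp, forall_and, forall_eq, and_assoc]
    rfl

/-- Every `R`-successor in `C` is reached by one of the `n` fresh roles, and each of these reaches
at most one element, so the fillers inject into the `n` indices. -/
theorem LeStep.reflects {K K' : UKB (Name NC) (Name NR) NI} (h : LeStep K K') :
    K.Reflects K' := by
  obtain ⟨E, E', C, n, R, f, hE, -, hf, hinj, hR, rfl⟩ := h
  intro I hI
  refine ⟨fun C' hC x => ?_, hI.2⟩
  by_cases hCE : C' = E
  · subst hCE
    refine hR.symm.mono (fun hx => ?_) (hI.1 E' (.inl (.inr rfl)) x)
    rw [Interp.mem_atMost]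
    have hcov : ∀ y, I.role R x y → y ∈ I.concept C → ∃ i < n, I.rol (.fresh (f i)) x y := by
      intro y hy hyC
      by_contra! hno
      exact hx y ((I.roleExpr_roleMinus ..).2 ⟨hy, hno⟩) hyC
    have huniq : ∀ i < n, ∀ y z, I.rol (.fresh (f i)) x y → I.rol (.fresh (f i)) x z → y = z := by
      intro i hi y z hy hz
      have := hI.1 _ (.inr ⟨i, hi, .inr rfl⟩) x
      rw [Interp.mem_atMost, Nat.cast_one, Set.encard_le_one_iff] at this
      exact this y z ⟨hy, trivial⟩ ⟨hz, trivial⟩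
    choose! idx hidx hidx' using hcov
    have hinjI : Set.InjOn idx {y | I.role R x y ∧ y ∈ I.concept C} := fun y hy z hz he =>
      huniq _ (hidx y hy.1 hy.2) y z (hidx' y hy.1 hy.2) (by rw [he]; exact hidx' z hz.1 hz.2)
    rw [← hinjI.encard_image]
    refine le_trans (Set.encard_le_encard (t := Set.Iio n) ?_) ?_
    · rintro _ ⟨y, hy, rfl⟩
      exact hidx y hy.1 hy.2
    · rw [← Finset.coe_Iio, Set.encard_coe_eq_coe_finsetCard, Nat.card_Iio]
  · exact hI.1 C' (.inl (.inl ⟨hC, hCE⟩)) x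

/-- At most `n` fillers can be listed, possibly with repetition, by a function on `n` indices; the
`i`-th fresh role points to the `i`-th entry if it lies in `C`. -/
theorem LeStep.extends {K K' : UKB (Name NC) (Name NR) NI} (h : LeStep K K') :
    K.Extends K' := by
  obtain ⟨E, E', C, n, R, f, hE, -, hf, hinj, hR, rfl⟩ := h
  intro I hI
  have hg : ∀ x : I.Domain, ∃ g : ℕ → I.Domain, x ∈ I.concept (.atMost n R C) →
      ∀ y, I.role R x y → y ∈ I.concept C → ∃ i < n, g i = y := by
    intro x
    by_cases hx : x ∈ I.concept (.atMost n R C)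
    · have : Nonempty I.Domain := ⟨x⟩
      obtain ⟨g, hg⟩ := exists_cover_of_encard_le hx
      exact ⟨g, fun _ y hy hC => hg y ⟨hy, hC⟩⟩
    · exact ⟨fun _ => x, fun h => (hx h).elim⟩
  choose g hg using hg
  -- No condition on `x` is needed here: functionality and range `C` hold by construction, and the
  -- fresh roles are not required to be subroles of `R`.
  let rel : ℕ → I.Domain → I.Domain → Prop := fun i x y => y ∈ I.concept C ∧ y = g x i
  let rol := freshRoles (Set.Iio n) f rel I.rol
  have hrol : ∀ i < n, ∀ x y : I.Domain, (I.withNames I.con rol).rol (.fresh (f i)) x y ↔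
      y ∈ I.concept C ∧ y = g x i := fun i hi x y =>
    iff_of_eq (congrFun (congrFun
      (freshRoles_fresh rel I.rol (fun i hi k hk => hinj i hi k hk) (Set.mem_Iio.2 hi)) x) y)
  have hsame : ∀ r ∈ K.roleNames, rol r = I.rol r := fun r hr =>
    freshRoles_of_forall_ne _ _ fun i hi h => hf i hi (h ▸ hr)
  have hI' : K.IsModel (I.withNames I.con rol) := hI.withNames (fun _ _ => rfl) hsame
  have hX : ∀ r ∈ (Concept.atMost n R C).roleNames, rol r = I.rol r := fun r hr =>
    hsame r (.inl ⟨E, hE, hR.roleNames hr⟩)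
  have hC : (I.withNames I.con rol).concept C = I.concept C :=
    Interp.withNames_concept (fun _ _ => rfl) fun r hr => hX r (.inr hr)
  have hXc : (I.withNames I.con rol).concept (.atMost n R C) = I.concept (.atMost n R C) :=
    Interp.withNames_concept (fun _ _ => rfl) hX
  have hRr : (I.withNames I.con rol).role R = I.role R :=
    Interp.withNames_role (hX _ (.inl rfl))
  refine ⟨_, ⟨fun C' hC' x => ?_, hI'.2⟩, fun _ _ => Iff.rfl,
    fun _ _ _ => Iff.rfl, fun _ _ => Iff.rfl⟩
  rcases hC' with (hC' | rfl) | ⟨i, hi, rfl | rfl⟩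
  · exact hI'.1 C' hC'.1 x
  · refine hR.mono (fun hx => ?_) (hI'.1 E hE x)
    rw [hXc] at hx
    intro y hy
    rw [Interp.mem_neg, hC]
    intro hyC
    rw [Interp.roleExpr_roleMinus, hRr] at hy
    obtain ⟨i, hi, he⟩ := hg x hx y hy.1 hyC
    exact hy.2 i hi ((hrol i hi _ _).2 ⟨hyC, he.symm⟩)
  · intro y hy
    rw [hC]
    exact ((hrol i hi _ _).1 hy).1
  · rw [Interp.mem_atMost, Nat.cast_one, Set.encard_le_one_iff]
    rintro y z ⟨hy, -⟩ ⟨hz, -⟩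
    exact ((hrol i hi _ _).1 hy).2.trans ((hrol i hi _ _).1 hz).2.symm

/-! #### Functionality -/

theorem UKB.IsModel.functional {K : UKB NC NR NI} {I : Interp NC NR NI} (h : K.IsModel I)
    {R : Role NR} (hR : .atMost 1 R .top ∈ K.tbox) {x y z : I.Domain} (hy : I.role R x y)
    (hz : I.role R x z) : y = z := by
  have := h.1 _ hR x
  rw [Interp.mem_atMost, Nat.cast_one, Set.encard_le_one_iff] at this
  exact this y z ⟨hy, trivial⟩ ⟨hz, trivial⟩

/-- With at most one `R`-successor, any property of successors holds for all of them or for none;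
this gives both kinds of disjunctive axioms at once. -/
theorem UKB.IsModel.thetaF {K : UKB NC NR NI} {I : Interp NC NR NI} (h : K.IsModel I) :
    K.thetaF.IsModel I := by
  refine ⟨?_, h.2.1, ?_⟩
  · rintro C ((hC | ⟨R, D, hR, -, rfl⟩) | ⟨R, S, hR, -, rfl⟩) x
    · exact h.1 C hC.1 x
    · by_contra hno
      simp only [Interp.mem_union, Interp.mem_all, Interp.mem_neg, not_or, not_forall,
        not_not] at hno
      obtain ⟨⟨y, hy, hyD⟩, z, hz, hzD⟩ := hno
      exact hzD (h.functional hR hy hz ▸ hyD)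
    · by_contra hno
      simp only [Interp.mem_union, Interp.mem_all, Interp.mem_bot, not_or, not_forall,
        Interp.roleExpr_inter, Interp.roleExpr_neg] at hno
      obtain ⟨⟨y, hy, -⟩, z, hz, -⟩ := hno
      exact hz.2 (h.functional hR hy.1 hz.1 ▸ hy.2)
  · rintro ρ (hρ | ⟨R, hR, rfl⟩)
    · exact h.2.2 ρ hρ
    · rw [Interp.satRule_iff]
      intro z hz
      refine ⟨by simp, ?_⟩
      simp only [List.mem_cons, List.not_mem_nil, or_false, forall_eq_or_imp, forall_eq,
        Interp.ground_roleAtom] at hz ⊢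
      exact h.functional hR hz.1 hz.2

end Steps

/-! ### Syntactic shape of the rewritten knowledge bases -/

section Shape

/-- The concept is in negation normal form. -/
def Concept.NNF : Concept NC NR → Prop
  | .name _ => True
  | .top => True
  | .bot => True
  | .neg C => ∃ A, C = .name A
  | .inter C D => C.NNF ∧ D.NNF
  | .union C D => C.NNF ∧ D.NNF
  | .all _ C => C.NNF
  | .ex _ C => C.NNF
  | .atMost _ _ C => C.NNF
  | .atLeast _ _ C => C.NNF

/-- The concept does not start with `∀U` or `∃U` for an unrestricted `U`. -/
def Concept.RestrQ : Concept NC NR → Prop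
  | .all U _ => U.Restricted
  | .ex U _ => U.Restricted
  | _ => True

/-- The concept is not an at-least restriction. -/
def Concept.NoGe : Concept NC NR → Prop
  | .atLeast _ _ _ => False
  | _ => True

/-- The concept is not a number restriction. -/
def Concept.NumFree : Concept NC NR → Prop
  | .atMost _ _ _ => False
  | .atLeast _ _ _ => False
  | _ => True

/-- If the concept starts with a quantifier or number restriction, its filler has property `q`. -/
def Concept.BodyIn (q : Concept NC NR → Prop) : Concept NC NR → Prop
  | .all _ C => q C
  | .ex _ C => q C
  | .atMost _ _ C => q C
  | .atLeast _ _ C => q C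
  | _ => True

/-- The concept is a concept name. -/
def Concept.IsName (C : Concept NC NR) : Prop := ∃ A, C = .name A

/-- The concept is a literal. -/
def Concept.Lit (C : Concept NC NR) : Prop :=
  C.IsName ∨ C = .top ∨ C = .bot ∨ ∃ A, C = .neg (.name A)

/-- If the concept is an at-most restriction, its filler is a concept name. -/
def Concept.AtMostName : Concept NC NR → Prop
  | .atMost _ _ C => C.IsName
  | _ => True

theorem Concept.NNF_nnf_and (C : Concept NC NR) : C.nnf.NNF ∧ C.nnfNeg.NNF := by
  induction C <;> simp_all [Concept.nnf, Concept.nnfNeg, Concept.NNF]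

theorem Concept.NNF.nnf_eq {C : Concept NC NR} (h : C.NNF) : C.nnf = C := by
  induction C with
  | neg C => obtain ⟨A, rfl⟩ := h; rfl
  | inter C D ihC ihD | union C D ihC ihD => simp only [Concept.nnf, ihC h.1, ihD h.2]
  | all U C ih | ex U C ih | atMost n R C ih | atLeast n R C ih => simp only [Concept.nnf, ih h]
  | _ => rfl

/-- The property of quantified concepts does not depend on the filler and is closed under
dualization. -/
structure DualStable (p : Concept NC NR → Prop) : Prop where
  name : ∀ A, p (.name A)
  top : p .top
  bot : p .bot
  all : ∀ U C C', p (.all U C) → p (.all U C') ∧ p (.ex U C')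
  ex : ∀ U C C', p (.ex U C) → p (.all U C') ∧ p (.ex U C')
  atMost : ∀ n R C C', p (.atMost n R C) → p (.atMost n R C') ∧ p (.atLeast n R C')
  atLeast : ∀ n R C C', p (.atLeast n R C) → p (.atMost n R C') ∧ p (.atLeast n R C')

/-- All parts of the concept have the property. -/
def Concept.AllParts (p : Concept NC NR → Prop) (C : Concept NC NR) : Prop :=
  ∀ X ∈ C.parts, p X

section AllParts

variable {p : Concept NC NR → Prop}

theorem Concept.allParts_name {A : NC} : (Concept.name A : Concept NC NR).AllParts p ↔
    p (.name A) := by simp [Concept.AllParts, Concept.parts]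

theorem Concept.allParts_top : (Concept.top : Concept NC NR).AllParts p ↔ p .top := by
  simp [Concept.AllParts, Concept.parts]

theorem Concept.allParts_bot : (Concept.bot : Concept NC NR).AllParts p ↔ p .bot := by
  simp [Concept.AllParts, Concept.parts]

theorem Concept.allParts_neg {C : Concept NC NR} : (Concept.neg C).AllParts p ↔ C.AllParts p :=
  Iff.rfl

theorem Concept.allParts_inter {C D : Concept NC NR} : (Concept.inter C D).AllParts p ↔
    C.AllParts p ∧ D.AllParts p := by
  simp only [Concept.AllParts, Concept.parts, Set.mem_union, or_imp, forall_and]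

theorem Concept.allParts_union {C D : Concept NC NR} : (Concept.union C D).AllParts p ↔
    C.AllParts p ∧ D.AllParts p := by
  simp only [Concept.AllParts, Concept.parts, Set.mem_union, or_imp, forall_and]

theorem Concept.allParts_all {U : RoleExpr NR} {C : Concept NC NR} :
    (Concept.all U C).AllParts p ↔ p (.all U C) ∧ C.AllParts p := by
  simp [Concept.AllParts, Concept.parts]

theorem Concept.allParts_ex {U : RoleExpr NR} {C : Concept NC NR} :
    (Concept.ex U C).AllParts p ↔ p (.ex U C) ∧ C.AllParts p := by
  simp [Concept.AllParts, Concept.parts]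

theorem Concept.allParts_atMost {n : ℕ} {R : Role NR} {C : Concept NC NR} :
    (Concept.atMost n R C).AllParts p ↔ p (.atMost n R C) ∧ C.AllParts p := by
  simp [Concept.AllParts, Concept.parts]

theorem Concept.allParts_atLeast {n : ℕ} {R : Role NR} {C : Concept NC NR} :
    (Concept.atLeast n R C).AllParts p ↔ p (.atLeast n R C) ∧ C.AllParts p := by
  simp [Concept.AllParts, Concept.parts]

theorem DualStable.nnf_and (hp : DualStable p) {C : Concept NC NR} (h : C.AllParts p) :
    C.nnf.AllParts p ∧ C.nnfNeg.AllParts p := by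
  induction C with
  | name A => exact ⟨h, h⟩
  | top => exact ⟨h, Concept.allParts_bot.2 hp.bot⟩
  | bot => exact ⟨h, Concept.allParts_top.2 hp.top⟩
  | neg C ih => exact (ih h).symm
  | inter C D ihC ihD =>
    rw [Concept.allParts_inter] at h
    exact ⟨Concept.allParts_inter.2 ⟨(ihC h.1).1, (ihD h.2).1⟩,
      Concept.allParts_union.2 ⟨(ihC h.1).2, (ihD h.2).2⟩⟩
  | union C D ihC ihD =>
    rw [Concept.allParts_union] at h
    exact ⟨Concept.allParts_union.2 ⟨(ihC h.1).1, (ihD h.2).1⟩,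
      Concept.allParts_inter.2 ⟨(ihC h.1).2, (ihD h.2).2⟩⟩
  | all U C ih =>
    rw [Concept.allParts_all] at h
    exact ⟨Concept.allParts_all.2 ⟨(hp.all _ _ _ h.1).1, (ih h.2).1⟩,
      Concept.allParts_ex.2 ⟨(hp.all _ _ _ h.1).2, (ih h.2).2⟩⟩
  | ex U C ih =>
    rw [Concept.allParts_ex] at h
    exact ⟨Concept.allParts_ex.2 ⟨(hp.ex _ _ _ h.1).2, (ih h.2).1⟩,
      Concept.allParts_all.2 ⟨(hp.ex _ _ _ h.1).1, (ih h.2).2⟩⟩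
  | atMost n R C ih =>
    rw [Concept.allParts_atMost] at h
    exact ⟨Concept.allParts_atMost.2 ⟨(hp.atMost _ _ _ _ h.1).1, (ih h.2).1⟩,
      Concept.allParts_atLeast.2 ⟨(hp.atMost _ _ _ _ h.1).2, (ih h.2).1⟩⟩
  | atLeast n R C ih =>
    rw [Concept.allParts_atLeast] at h
    exact ⟨Concept.allParts_atLeast.2 ⟨(hp.atLeast _ _ _ _ h.1).2, (ih h.2).1⟩,
      Concept.allParts_atMost.2 ⟨(hp.atLeast _ _ _ _ h.1).1, (ih h.2).1⟩⟩

theorem ReplaceOuter.allParts {X Y E E' : Concept NC NR} (h : ReplaceOuter X Y E E')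
    (hE : E.AllParts p) (hY : Y.AllParts p) : E'.AllParts p := fun Z hZ =>
  (h.parts_right hZ).elim (hE Z) (hY Z)

theorem ReplaceOuter.allParts_left {X Y E E' : Concept NC NR} (h : ReplaceOuter X Y E E')
    (hE : E.AllParts p) : X.AllParts p := fun Z hZ => hE Z (h.parts_left hZ)

end AllParts

theorem ReplaceOuter.NNF_left {X Y E E' : Concept NC NR} (h : ReplaceOuter X Y E E')
    (hE : E.NNF) : X.NNF := by
  induction h with
  | here => exact hE
  | interL D _ ih | unionL D _ ih => exact ih hE.1
  | interR D _ ih | unionR D _ ih => exact ih hE.2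

theorem ReplaceOuter.NNF_right {X Y E E' : Concept NC NR} (h : ReplaceOuter X Y E E')
    (hE : E.NNF) (hY : Y.NNF) : E'.NNF := by
  induction h with
  | here => exact hY
  | interL D _ ih | unionL D _ ih => exact ⟨ih hE.1, hE.2⟩
  | interR D _ ih | unionR D _ ih => exact ⟨hE.1, ih hE.2⟩

theorem dualStable_restrQ : DualStable (Concept.RestrQ : Concept NC NR → Prop) :=
  ⟨fun _ => trivial, trivial, trivial, fun _ _ _ h => ⟨h, h⟩, fun _ _ _ h => ⟨h, h⟩,
    fun _ _ _ _ h => ⟨h, h⟩, fun _ _ _ _ h => ⟨h, h⟩⟩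

theorem dualStable_restrQ_numFree :
    DualStable (fun X : Concept NC NR => X.RestrQ ∧ X.NumFree) :=
  ⟨fun _ => ⟨trivial, trivial⟩, ⟨trivial, trivial⟩, ⟨trivial, trivial⟩, fun _ _ _ h => ⟨h, h⟩,
    fun _ _ _ h => ⟨h, h⟩, fun _ _ _ _ h => h.2.elim, fun _ _ _ _ h => h.2.elim⟩

/-- The property of parts is preserved by flattening. -/
def FlatStable (p : Concept NC NR → Prop) : Prop :=
  ∀ ⦃F : NC⦄ ⦃D X X' G : Concept NC NR⦄, Abbreviate F D X X' G → (∀ A, D ≠ .name A) →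
    X.AllParts p → X'.AllParts p ∧ G.AllParts p

theorem DualStable.flatStable {p : Concept NC NR → Prop} (hp : DualStable p) : FlatStable p := by
  intro F D X X' G h _ hX
  have hF := hp.name F
  cases h with
  | all U =>
    rw [Concept.allParts_all] at hX
    simp only [Concept.allParts_all, Concept.allParts_union, Concept.allParts_neg,
      Concept.allParts_name]
    exact ⟨⟨(hp.all _ _ _ hX.1).1, hF⟩, hF, hX.2⟩
  | ex U =>
    rw [Concept.allParts_ex] at hX
    simp only [Concept.allParts_ex, Concept.allParts_union, Concept.allParts_neg,
      Concept.allParts_name]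
    exact ⟨⟨(hp.ex _ _ _ hX.1).2, hF⟩, hF, hX.2⟩
  | atLeast n R =>
    rw [Concept.allParts_atLeast] at hX
    simp only [Concept.allParts_atLeast, Concept.allParts_union, Concept.allParts_neg,
      Concept.allParts_name]
    exact ⟨⟨(hp.atLeast _ _ _ _ hX.1).2, hF⟩, hF, hX.2⟩
  | atMost n R =>
    rw [Concept.allParts_atMost] at hX
    simp only [Concept.allParts_atMost, Concept.allParts_union, Concept.allParts_name]
    exact ⟨⟨(hp.atMost _ _ _ _ hX.1).1, hF⟩, (hp.nnf_and hX.2).2, hF⟩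

/-- Restricted roles, no at-least restrictions, only concept names as fillers of at-most
restrictions. -/
def Concept.LeShape (X : Concept NC NR) : Prop := X.RestrQ ∧ X.NoGe ∧ X.AtMostName

/-- `LeShape` is not stable under dualization, since `¬ ≤n` becomes `≥(n+1)`. It survives flattening
because the only step that negates a filler abbreviates under `≤`, and there the fillers already are
concept names, which are never abbreviated. -/
theorem flatStable_leShape : FlatStable (Concept.LeShape : Concept NC NR → Prop) := by
  intro F D X X' G h hD hX
  have hF : (Concept.name F : Concept NC NR).LeShape := ⟨trivial, trivial, trivial⟩
  cases h with
  | all U =>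
    rw [Concept.allParts_all] at hX
    simp only [Concept.allParts_all, Concept.allParts_union, Concept.allParts_neg,
      Concept.allParts_name]
    exact ⟨⟨hX.1, hF⟩, hF, hX.2⟩
  | ex U =>
    rw [Concept.allParts_ex] at hX
    simp only [Concept.allParts_ex, Concept.allParts_union, Concept.allParts_neg,
      Concept.allParts_name]
    exact ⟨⟨hX.1, hF⟩, hF, hX.2⟩
  | atLeast n R => exact (hX _ (.inl rfl)).2.1.elim
  | atMost n R =>
    obtain ⟨A, hA⟩ := (hX _ (.inl rfl)).2.2
    exact (hD A hA).elim

/-! #### Outermost occurrences -/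

/-- `X` has an outermost occurrence in `E`. -/
def Concept.Outer (X E : Concept NC NR) : Prop := ∀ Y, ∃ E', ReplaceOuter X Y E E'

theorem Concept.Outer.refl (X : Concept NC NR) : X.Outer X := fun Y => ⟨Y, .here⟩

theorem Concept.Outer.interL {X C : Concept NC NR} (h : X.Outer C) (D : Concept NC NR) :
    X.Outer (.inter C D) := fun Y => (h Y).elim fun _ h => ⟨_, .interL D h⟩

theorem Concept.Outer.interR {X D : Concept NC NR} (h : X.Outer D) (C : Concept NC NR) :
    X.Outer (.inter C D) := fun Y => (h Y).elim fun _ h => ⟨_, .interR C h⟩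

theorem Concept.Outer.unionL {X C : Concept NC NR} (h : X.Outer C) (D : Concept NC NR) :
    X.Outer (.union C D) := fun Y => (h Y).elim fun _ h => ⟨_, .unionL D h⟩

theorem Concept.Outer.unionR {X D : Concept NC NR} (h : X.Outer D) (C : Concept NC NR) :
    X.Outer (.union C D) := fun Y => (h Y).elim fun _ h => ⟨_, .unionR C h⟩

/-- In negation normal form no quantifier is hidden under a negation. Descending through `⊓` and `⊔`
to a quantified concept, either its own filler is not a name or the filler has no quantified parts
at all. -/
theorem Concept.NNF.exists_outer {E : Concept NC NR} (hE : E.NNF)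
    (h : ¬ E.AllParts (Concept.BodyIn Concept.IsName)) :
    ∃ X : Concept NC NR, X.Outer E ∧ ¬ X.BodyIn Concept.IsName := by
  have body : ∀ {C : Concept NC NR}, C.IsName → C.AllParts (Concept.BodyIn Concept.IsName) := by
    rintro _ ⟨A, rfl⟩
    exact Concept.allParts_name.2 trivial
  induction E with
  | name A => exact (h (Concept.allParts_name.2 trivial)).elim
  | top => exact (h (Concept.allParts_top.2 trivial)).elim
  | bot => exact (h (Concept.allParts_bot.2 trivial)).elim
  | neg C =>
    obtain ⟨A, rfl⟩ := hE
    exact (h (Concept.allParts_name.2 trivial)).elim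
  | inter C D ihC ihD =>
    rw [Concept.allParts_inter, not_and_or] at h
    rcases h with h | h
    · obtain ⟨X, hX, hb⟩ := ihC hE.1 h
      exact ⟨X, hX.interL D, hb⟩
    · obtain ⟨X, hX, hb⟩ := ihD hE.2 h
      exact ⟨X, hX.interR C, hb⟩
  | union C D ihC ihD =>
    rw [Concept.allParts_union, not_and_or] at h
    rcases h with h | h
    · obtain ⟨X, hX, hb⟩ := ihC hE.1 h
      exact ⟨X, hX.unionL D, hb⟩
    · obtain ⟨X, hX, hb⟩ := ihD hE.2 h
      exact ⟨X, hX.unionR C, hb⟩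
  | all U C => exact ⟨_, .refl _, fun hb => h (Concept.allParts_all.2 ⟨hb, body hb⟩)⟩
  | ex U C => exact ⟨_, .refl _, fun hb => h (Concept.allParts_ex.2 ⟨hb, body hb⟩)⟩
  | atMost n R C => exact ⟨_, .refl _, fun hb => h (Concept.allParts_atMost.2 ⟨hb, body hb⟩)⟩
  | atLeast n R C => exact ⟨_, .refl _, fun hb => h (Concept.allParts_atLeast.2 ⟨hb, body hb⟩)⟩

theorem Concept.Lit.numFree {C X : Concept NC NR} (h : C.Lit) (hX : X ∈ C.parts) :
    X.NumFree := by
  rcases h with ⟨A, rfl⟩ | rfl | rfl | ⟨A, rfl⟩ <;>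
    (simp only [Concept.parts, Set.mem_singleton_iff] at hX; subst hX; trivial)

/-- A literal filler contains no number restriction, so nesting is impossible and every number
restriction is accessible to `ReplaceOuter`. -/
theorem Concept.NNF.outer_of_lit {E X : Concept NC NR} (hE : E.NNF)
    (h : E.AllParts (Concept.BodyIn Concept.Lit)) (hX : X ∈ E.parts) (hq : ¬ X.NumFree) :
    X.Outer E := by
  induction E with
  | name A | top | bot =>
    simp only [Concept.parts, Set.mem_singleton_iff] at hX
    subst hX
    exact (hq trivial).elim
  | neg C =>
    obtain ⟨A, rfl⟩ := hE
    simp only [Concept.parts, Set.mem_singleton_iff] at hX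
    subst hX
    exact (hq trivial).elim
  | inter C D ihC ihD =>
    rw [Concept.allParts_inter] at h
    exact hX.elim (fun hX => (ihC hE.1 h.1 hX).interL D) fun hX => (ihD hE.2 h.2 hX).interR C
  | union C D ihC ihD =>
    rw [Concept.allParts_union] at h
    exact hX.elim (fun hX => (ihC hE.1 h.1 hX).unionL D) fun hX => (ihD hE.2 h.2 hX).unionR C
  | all U C | ex U C | atMost n R C | atLeast n R C =>
    rcases hX with rfl | hX
    · exact .refl _
    · exact (hq (Concept.Lit.numFree (h _ (.inl rfl)) hX)).elim

theorem exists_abbreviate {X : Concept NC NR} (h : ¬ X.BodyIn Concept.IsName) (F : NC) :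
    ∃ D X' G, (∀ A, D ≠ .name A) ∧ Abbreviate F D X X' G := by
  have key : ∀ {D : Concept NC NR}, ¬ D.IsName → ∀ A, D ≠ .name A := fun h A he => h ⟨A, he⟩
  cases X with
  | all U C => exact ⟨_, _, _, key h, .all U⟩
  | ex U C => exact ⟨_, _, _, key h, .ex U⟩
  | atMost n R C => exact ⟨_, _, _, key h, .atMost n R⟩
  | atLeast n R C => exact ⟨_, _, _, key h, .atLeast n R⟩
  | _ => exact (h trivial).elim

/-! #### Finiteness -/

/-- All components of the knowledge base are finite. -/
structure UKB.IsFinite (K : UKB NC NR NI) : Prop where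
  tbox : K.tbox.Finite
  rbox : K.rbox.Finite
  rules : K.rules.Finite

theorem Concept.finite_conNames (C : Concept NC NR) : C.conNames.Finite := by
  induction C <;> simp_all [Concept.conNames]

theorem RoleExpr.finite_roles (U : RoleExpr NR) : U.roles.Finite := by
  induction U <;> simp_all [RoleExpr.roles]

theorem RoleExpr.finite_roleNames (U : RoleExpr NR) : U.roleNames.Finite :=
  U.finite_roles.image _

theorem Concept.finite_roleNames (C : Concept NC NR) : C.roleNames.Finite := by
  induction C <;> simp_all [Concept.roleNames, RoleExpr.finite_roleNames]

theorem RoleAxiom.finite_roleNames (α : RoleAxiom NR) : α.roleNames.Finite := by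
  cases α <;> simp [RoleAxiom.roleNames, RoleExpr.finite_roleNames]

theorem Concept.finite_parts (C : Concept NC NR) : C.parts.Finite := by
  induction C <;> simp_all [Concept.parts]

theorem Rule.finite_atoms (ρ : Rule NC NR NI) : {α | α ∈ ρ.body ∨ α ∈ ρ.head}.Finite :=
  (List.finite_toSet ρ.body).union (List.finite_toSet ρ.head)

theorem UKB.IsFinite.conNames {K : UKB NC NR NI} (h : K.IsFinite) : K.conNames.Finite := by
  have h1 : (⋃ C ∈ K.tbox, C.conNames).Finite :=
    h.tbox.biUnion fun C _ => C.finite_conNames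
  have h2 : (⋃ ρ ∈ K.rules, ⋃ α ∈ {α | α ∈ ρ.body ∨ α ∈ ρ.head}, α.conNames).Finite :=
    h.rules.biUnion fun ρ _ => ρ.finite_atoms.biUnion fun α _ => by
      cases α <;> simp [Atom.conNames]
  refine (h1.union h2).subset ?_
  rintro A (⟨C, hC, hA⟩ | ⟨ρ, hρ, α, hα, hA⟩)
  · exact .inl (Set.mem_biUnion hC hA)
  · exact .inr (Set.mem_biUnion hρ (Set.mem_biUnion hα hA))

theorem UKB.IsFinite.roleNames {K : UKB NC NR NI} (h : K.IsFinite) : K.roleNames.Finite := by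
  have h1 : (⋃ C ∈ K.tbox, C.roleNames).Finite :=
    h.tbox.biUnion fun C _ => C.finite_roleNames
  have h2 : (⋃ α ∈ K.rbox, α.roleNames).Finite :=
    h.rbox.biUnion fun α _ => α.finite_roleNames
  have h3 : (⋃ ρ ∈ K.rules, ⋃ α ∈ {α | α ∈ ρ.body ∨ α ∈ ρ.head}, α.roleNames).Finite :=
    h.rules.biUnion fun ρ _ => ρ.finite_atoms.biUnion fun α _ => by
      cases α <;> simp [Atom.roleNames]
  refine (h1.union (h2.union h3)).subset ?_
  rintro A (⟨C, hC, hA⟩ | ⟨α, hα, hA⟩ | ⟨ρ, hρ, α, hα, hA⟩)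
  · exact .inl (Set.mem_biUnion hC hA)
  · exact .inr (.inl (Set.mem_biUnion hα hA))
  · exact .inr (.inr (Set.mem_biUnion hρ (Set.mem_biUnion hα hA)))

theorem exists_fresh {N : Type u} {S : Set (Name N)} (hS : S.Finite) :
    ∃ f : ℕ → ℕ, Function.Injective f ∧ ∀ i, Name.fresh (f i) ∉ S := by
  have hfin : {k | (Name.fresh k : Name N) ∈ S}.Finite :=
    hS.preimage fun a _ b _ h => by simpa using h
  obtain ⟨m, hm⟩ := hfin.bddAbove
  refine ⟨fun i => m + 1 + i, fun i j h => by simpa using h, fun i hi => ?_⟩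
  have : m + 1 + i ≤ m := hm hi
  omega

theorem UKB.IsFinite.nnf {K : UKB NC NR NI} (h : K.IsFinite) : K.nnf.IsFinite :=
  ⟨h.tbox.image _, h.rbox, h.rules⟩

theorem FlatStep.fin {K K' : UKB (Name NC) (Name NR) NI} (h : FlatStep K K') (hK : K.IsFinite) :
    K'.IsFinite := by
  obtain ⟨E, E', X, X', G, D, k, -, -, -, -, -, rfl⟩ := h
  exact ⟨(hK.tbox.subset Set.sdiff_subset).union (Set.toFinite {E', G}), hK.rbox, hK.rules⟩

theorem finite_bounded_pairs {α : Type*} (n : ℕ) (g : ℕ → ℕ → α) :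
    {G | ∃ i k, i < k ∧ k ≤ n ∧ G = g i k}.Finite := by
  refine ((((Set.finite_Iic n).prod (Set.finite_Iic n)).image fun p => g p.1 p.2)).subset ?_
  rintro _ ⟨i, k, hik, hk, rfl⟩
  exact ⟨(i, k), ⟨hik.le.trans hk, hk⟩, rfl⟩

theorem GeStep.fin {K K' : UKB (Name NC) (Name NR) NI} (h : GeStep K K') (hK : K.IsFinite) :
    K'.IsFinite := by
  obtain ⟨E, E', C, n, R, f, -, -, -, -, rfl⟩ := h
  refine ⟨((hK.tbox.subset Set.sdiff_subset).union (Set.finite_singleton E')).union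
    (finite_bounded_pairs n _), hK.rbox.union ?_, hK.rules⟩
  refine ((Set.finite_Iic n).image fun i =>
    RoleAxiom.incl (.atom (.name (.fresh (f i)))) (.atom R)).subset ?_
  rintro _ ⟨i, hi, rfl⟩
  exact ⟨i, hi, rfl⟩

theorem LeStep.finite_added {C : Concept (Name NC) (Name NR)} (n : ℕ) (f : ℕ → ℕ) :
    {G : Concept (Name NC) (Name NR) | ∃ i < n, G = .all (.atom (.name (.fresh (f i)))) C ∨
      G = .atMost 1 (.name (.fresh (f i))) .top}.Finite := by
  refine (((Set.finite_Iio n).image fun i => Concept.all (.atom (.name (.fresh (f i)))) C).union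
    ((Set.finite_Iio n).image fun i => Concept.atMost 1 (.name (.fresh (f i))) .top)).subset ?_
  rintro _ ⟨i, hi, rfl | rfl⟩
  · exact .inl ⟨i, hi, rfl⟩
  · exact .inr ⟨i, hi, rfl⟩

theorem LeStep.fin {K K' : UKB (Name NC) (Name NR) NI} (h : LeStep K K') (hK : K.IsFinite) :
    K'.IsFinite := by
  obtain ⟨E, E', C, n, R, f, -, -, -, -, -, rfl⟩ := h
  exact ⟨((hK.tbox.subset Set.sdiff_subset).union (Set.finite_singleton E')).union
    (LeStep.finite_added n f), hK.rbox, hK.rules⟩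

theorem UKB.IsFinite.thetaH {K : UKB NC NR NI} (h : K.IsFinite) : K.thetaH.IsFinite := by
  refine ⟨h.tbox.union ?_, h.rbox.subset (Set.sep_subset _ _), h.rules⟩
  refine (h.rbox.image fun α => match α with
    | .incl U V => Concept.all (.inter U (.neg V)) .bot
    | .trans _ => .bot).subset ?_
  rintro _ ⟨U, V, hα, rfl⟩
  exact ⟨_, hα, rfl⟩

theorem finite_parts {T : Set (Concept NC NR)} (h : T.Finite) : (parts T).Finite :=
  (h.biUnion fun C _ => C.finite_parts).subset fun _ ⟨_, hC, hX⟩ => Set.mem_biUnion hC hX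

theorem finite_base_preimage {S : Set NR} (hS : S.Finite) : {R : Role NR | R.base ∈ S}.Finite := by
  refine ((hS.image Role.name).union (hS.image Role.inv)).subset ?_
  rintro (r | r) hr
  · exact .inl ⟨r, hr, rfl⟩
  · exact .inr ⟨r, hr, rfl⟩

theorem UKB.IsFinite.thetaF {K : UKB NC NR NI} (h : K.IsFinite) : K.thetaF.IsFinite := by
  have hR : {R : Role NR | .atMost 1 R .top ∈ K.tbox}.Finite :=
    h.tbox.preimage fun a _ b _ h => by simpa using h
  have hN : K.nonFunctional.Finite := h.tbox.subset (Set.sep_subset _ _)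
  refine ⟨(hN.union ?_).union ?_, h.rbox, h.rules.union ?_⟩
  · refine ((hR.prod (finite_parts hN)).image fun q =>
      Concept.union (.all (.atom q.1) (.neg q.2)) (.all (.atom q.1) q.2)).subset ?_
    rintro _ ⟨R, D, hR, hD, rfl⟩
    exact ⟨(R, D), ⟨hR, hD⟩, rfl⟩
  · refine ((hR.prod (finite_base_preimage h.roleNames)).image fun q =>
      Concept.union (.all (.inter (.atom q.1) (.atom q.2)) .bot)
        (.all (.inter (.atom q.1) (.neg (.atom q.2))) .bot)).subset ?_
    rintro _ ⟨R, S, hR, hS, rfl⟩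
    exact ⟨(R, S), ⟨hR, hS⟩, rfl⟩
  · refine (hR.image fun R => (⟨[roleAtom R (.var 0) (.var 1), roleAtom R (.var 0) (.var 2)],
        [.eq (.var 1) (.var 2)]⟩ : Rule NC NR NI)).subset ?_
    rintro _ ⟨R, hR, rfl⟩
    exact ⟨R, hR, rfl⟩

theorem Exhausts.invariant {α : Type*} {step : α → α → Prop} {P : α → Prop} {a b : α}
    (h : Exhausts step a b) (hs : ∀ x y, step x y → P x → P y) (ha : P a) : P b := by
  obtain ⟨h, -⟩ := h
  induction h with
  | refl => exact ha
  | tail _ h ih => exact hs _ _ h ih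

theorem Flat.fin {K K' : UKB (Name NC) (Name NR) NI} (h : Flat K K') (hK : K.IsFinite) : K'.IsFinite :=
  Exhausts.invariant h (fun _ _ h hK => h.fin hK) hK.nnf

/-! #### Invariants of flattening -/

/-- All axioms are in negation normal form and all parts have the property. -/
def UKB.Shaped (p : Concept NC NR → Prop) (K : UKB NC NR NI) : Prop :=
  ∀ E ∈ K.tbox, E.NNF ∧ E.AllParts p

theorem UKB.Shaped.imp {p q : Concept NC NR → Prop} {K : UKB NC NR NI} (h : K.Shaped p)
    (hpq : ∀ X, p X → q X) : K.Shaped q := fun E hE =>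
  ⟨(h E hE).1, fun X hX => hpq X ((h E hE).2 X hX)⟩

theorem UKB.Shaped.and {p q : Concept NC NR → Prop} {K : UKB NC NR NI} (h : K.Shaped p)
    (h' : K.Shaped q) : K.Shaped fun X => p X ∧ q X := fun E hE =>
  ⟨(h E hE).1, fun X hX => ⟨(h E hE).2 X hX, (h' E hE).2 X hX⟩⟩

theorem UKB.Shaped.nnf_eq {p : Concept NC NR → Prop} {K : UKB NC NR NI} (h : K.Shaped p) :
    K.nnf = K := by
  have : Concept.nnf '' K.tbox = K.tbox := by
    refine (Set.image_congr fun C hC => (h C hC).1.nnf_eq).trans (Set.image_id' _)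
  unfold UKB.nnf
  rw [this]

theorem Abbreviate.NNF {F : NC} {D X X' G : Concept NC NR} (h : Abbreviate F D X X' G)
    (hX : X.NNF) : X'.NNF ∧ G.NNF := by
  cases h with
  | atMost n R => exact ⟨trivial, D.NNF_nnf_and.2, trivial⟩
  | _ => exact ⟨trivial, ⟨F, rfl⟩, hX⟩

theorem FlatStep.shaped {p : Concept (Name NC) (Name NR) → Prop} (hp : FlatStable p)
    {K K' : UKB (Name NC) (Name NR) NI} (h : FlatStep K K') (hK : K.Shaped p) : K'.Shaped p := by
  obtain ⟨E, E', X, X', G, D, k, hE, hD, -, hA, hR, rfl⟩ := h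
  obtain ⟨h1, h2⟩ := hA.NNF (hR.NNF_left (hK E hE).1)
  obtain ⟨h3, h4⟩ := hp hA hD (hR.allParts_left (hK E hE).2)
  rintro C (hC | rfl | rfl)
  · exact hK C hC.1
  · exact ⟨hR.NNF_right (hK E hE).1 h1, hR.allParts (hK E hE).2 h3⟩
  · exact ⟨h2, h4⟩

/-- Exhaustiveness turns into shape: a filler that is not a name would give an outermost offending
part, and a fresh name would permit one more step. -/
theorem Flat.shaped {p : Concept (Name NC) (Name NR) → Prop} (hp : FlatStable p)
    {K K' : UKB (Name NC) (Name NR) NI} (h : Flat K K') (hfin : K.IsFinite) (hK : K.nnf.Shaped p) :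
    K'.Shaped fun X => p X ∧ X.BodyIn Concept.IsName := by
  have h1 : K'.Shaped p := Exhausts.invariant h (fun _ _ h hK => h.shaped hp hK) hK
  refine h1.and fun E hE => ⟨(h1 E hE).1, ?_⟩
  by_contra hno
  obtain ⟨X, hX, hb⟩ := (h1 E hE).1.exists_outer hno
  obtain ⟨f, -, hf⟩ := exists_fresh (h.fin hfin).conNames
  obtain ⟨D, X', G, hD, hA⟩ := exists_abbreviate hb (.fresh (f 0))
  obtain ⟨E', hR⟩ := hX X'
  exact h.2 _ ⟨E, E', X, X', G, D, f 0, hE, hD, hf 0, hA, hR, rfl⟩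

theorem Flat.rbox {K K' : UKB (Name NC) (Name NR) NI} (h : Flat K K') : K'.rbox = K.rbox := by
  refine Exhausts.invariant (P := fun K' => K'.rbox = K.rbox) h ?_ rfl
  rintro _ _ ⟨E, E', X, X', G, D, k, -, -, -, -, -, rfl⟩ h
  exact h

theorem Flat.rules {K K' : UKB (Name NC) (Name NR) NI} (h : Flat K K') : K'.rules = K.rules := by
  refine Exhausts.invariant (P := fun K' => K'.rules = K.rules) h ?_ rfl
  rintro _ _ ⟨E, E', X, X', G, D, k, -, -, -, -, -, rfl⟩ h
  exact h

theorem UKB.shaped_nnf {p : Concept NC NR → Prop} (hp : DualStable p) {K : UKB NC NR NI}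
    (hK : ∀ E ∈ K.tbox, E.AllParts p) : K.nnf.Shaped p := by
  rintro _ ⟨E, hE, rfl⟩
  exact ⟨E.NNF_nnf_and.1, (hp.nnf_and (hK E hE)).1⟩

/-! #### Invariants of the elimination of number restrictions -/

/-- All role axioms are inclusions with restricted left-hand sides. -/
def InclOnly (rbox : Set (RoleAxiom NR)) : Prop :=
  ∀ α ∈ rbox, ∃ U V, α = .incl U V ∧ U.Restricted

/-- Restricted roles, literals as fillers, only concept names as fillers of at-most restrictions. -/
def Concept.GeShape (X : Concept NC NR) : Prop :=
  X.RestrQ ∧ X.BodyIn Concept.Lit ∧ X.AtMostName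

theorem exInter_geShape {C : Concept NC NR} (rs : ℕ → NR) (hC : C.Lit) (hC' : C.NNF)
    (hp : C.AllParts Concept.GeShape) (n : ℕ) :
    (exInter rs C n).NNF ∧ (exInter rs C n).AllParts Concept.GeShape := by
  induction n with
  | zero =>
    exact ⟨hC', Concept.allParts_ex.2 ⟨⟨id, hC, trivial⟩, hp⟩⟩
  | succ n ih =>
    exact ⟨⟨ih.1, hC'⟩, Concept.allParts_inter.2 ⟨ih.2,
      Concept.allParts_ex.2 ⟨⟨id, hC, trivial⟩, hp⟩⟩⟩

theorem GeStep.shaped {K K' : UKB (Name NC) (Name NR) NI} (h : GeStep K K')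
    (hK : K.Shaped Concept.GeShape) : K'.Shaped Concept.GeShape := by
  obtain ⟨E, E', C, n, R, f, hE, -, -, hR, rfl⟩ := h
  rintro D ((hD | rfl) | ⟨i, k, -, -, rfl⟩)
  · exact hK D hD.1
  · have hX := hR.allParts_left (hK E hE).2
    rw [Concept.allParts_atLeast] at hX
    obtain ⟨h1, h2⟩ := exInter_geShape (fun i => Name.fresh (f i)) hX.1.2.1
      (hR.NNF_left (hK E hE).1) hX.2 n
    exact ⟨hR.NNF_right (hK E hE).1 h1, hR.allParts (hK E hE).2 h2⟩
  · refine ⟨trivial, Concept.allParts_all.2 ⟨⟨fun h => h.1, .inr (.inr (.inl rfl)), trivial⟩, ?_⟩⟩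
    exact Concept.allParts_bot.2 ⟨trivial, trivial, trivial⟩

theorem GeStep.inclOnly {K K' : UKB (Name NC) (Name NR) NI} (h : GeStep K K')
    (hK : InclOnly K.rbox) : InclOnly K'.rbox := by
  obtain ⟨E, E', C, n, R, f, hE, -, -, hR, rfl⟩ := h
  rintro α (hα | ⟨i, -, rfl⟩)
  · exact hK α hα
  · exact ⟨_, _, rfl, id⟩

/-- A remaining at-least restriction would be outermost, because all fillers are literals, and could
still be replaced. -/
theorem Exhausts.noGe {K K' : UKB (Name NC) (Name NR) NI} (h : Exhausts GeStep K K')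
    (hfin : K'.IsFinite) (hK : K'.Shaped Concept.GeShape) : K'.Shaped Concept.LeShape := by
  refine fun E hE => ⟨(hK E hE).1, fun X hX => ⟨((hK E hE).2 X hX).1, ?_, ((hK E hE).2 X hX).2.2⟩⟩
  cases X with
  | atLeast n R C =>
    obtain ⟨f, hf, hf'⟩ := exists_fresh hfin.roleNames
    obtain ⟨E', hR⟩ := (hK E hE).1.outer_of_lit (fun X hX => ((hK E hE).2 X hX).2.1) hX id
      (exInter (fun i => .fresh (f i)) C n)
    exact h.2 _ ⟨E, E', C, n, R, f, hE, fun i _ => hf' i, fun i _ k _ h => hf h, hR, rfl⟩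
  | _ => trivial

theorem UKB.Shaped.thetaH {K : UKB NC NR NI} (hK : K.Shaped Concept.LeShape)
    (hr : InclOnly K.rbox) : K.thetaH.Shaped Concept.LeShape := by
  rintro C (hC | ⟨U, V, hα, rfl⟩)
  · exact hK C hC
  · obtain ⟨_, _, he, hU⟩ := hr _ hα
    cases he
    exact ⟨trivial, Concept.allParts_all.2 ⟨⟨fun h => hU h.1, trivial, trivial⟩,
      Concept.allParts_bot.2 ⟨trivial, trivial, trivial⟩⟩⟩

theorem InclOnly.thetaH_rbox {K : UKB NC NR NI} (hr : InclOnly K.rbox) : K.thetaH.rbox = ∅ := by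
  refine Set.eq_empty_of_forall_notMem fun α hα => ?_
  obtain ⟨U, V, rfl, -⟩ := hr α hα.1
  exact hα.2 U V rfl

/-- Functionality axioms, or axioms without at-least restrictions and with literals as fillers. -/
def UKB.LeInvariant (K : UKB NC NR NI) : Prop :=
  ∀ E ∈ K.tbox, (∀ S, E ≠ .atMost 1 S .top) →
    E.NNF ∧ E.AllParts fun X => X.LeShape ∧ X.BodyIn Concept.Lit

theorem restricted_roleMinus (R : Role NR) (rs : ℕ → NR) (n : ℕ) :
    (roleMinus R rs n).Restricted := by
  induction n with
  | zero => exact id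
  | succ n ih => exact fun h => ih h.1

/-- The step turns a filler `A` into `¬A`, which is why the invariant speaks of literals and not of
names. The functionality axioms that it adds are exempt. -/
theorem LeStep.leInvariant {K K' : UKB (Name NC) (Name NR) NI} (h : LeStep K K')
    (hK : K.LeInvariant) : K'.LeInvariant := by
  obtain ⟨E, E', C, n, R, f, hE, hE1, -, -, hR, rfl⟩ := h
  obtain ⟨hN, hP⟩ := hK E hE hE1
  obtain ⟨A, rfl⟩ := (hR.allParts_left hP _ (.inl rfl)).1.2.2
  have hA : (Concept.name A : Concept (Name NC) (Name NR)).AllParts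
      fun X => X.LeShape ∧ X.BodyIn Concept.Lit :=
    Concept.allParts_name.2 ⟨⟨trivial, trivial, trivial⟩, trivial⟩
  rintro D ((hD | rfl) | ⟨i, -, rfl | rfl⟩) hD1
  · exact hK D hD.1 hD1
  · refine ⟨hR.NNF_right hN ⟨A, rfl⟩, hR.allParts hP (Concept.allParts_all.2 ⟨?_, hA⟩)⟩
    exact ⟨⟨restricted_roleMinus _ _ _, trivial, trivial⟩, .inr (.inr (.inr ⟨A, rfl⟩))⟩
  · exact ⟨trivial, Concept.allParts_all.2 ⟨⟨⟨id, trivial, trivial⟩, .inl ⟨A, rfl⟩⟩, hA⟩⟩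
  · exact (hD1 _ rfl).elim

theorem Exhausts.numFree {K K' : UKB (Name NC) (Name NR) NI} (h : Exhausts LeStep K K')
    (hfin : K'.IsFinite) (hK : K'.LeInvariant) :
    ∀ E ∈ K'.nonFunctional, E.AllParts fun X => X.RestrQ ∧ X.NumFree := by
  rintro E ⟨hE, hE1⟩ X hX
  obtain ⟨hN, hP⟩ := hK E hE hE1
  refine ⟨(hP X hX).1.1, ?_⟩
  cases X with
  | atMost n R C =>
    obtain ⟨f, hf, hf'⟩ := exists_fresh hfin.roleNames
    obtain ⟨E', hR⟩ := hN.outer_of_lit (fun X hX => (hP X hX).2) hX id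
      (.all (roleMinus R (fun i => .fresh (f i)) n) (.neg C))
    exact h.2 _ ⟨E, E', C, n, R, f, hE, hE1, fun i _ => hf' i, fun i _ k _ h => hf h, hR, rfl⟩
  | atLeast n R C => exact (hP _ hX).1.2.1
  | _ => trivial

theorem Concept.parts_trans {C D : Concept NC NR} (h : D ∈ C.parts) : D.parts ⊆ C.parts := by
  induction C with
  | name A | top | bot => rw [Set.eq_of_mem_singleton h]
  | neg C ih => exact ih h
  | inter C C' ih ih' | union C C' ih ih' =>
    exact h.elim (fun h => (ih h).trans Set.subset_union_left)
      fun h => (ih' h).trans Set.subset_union_right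
  | all U C ih | ex U C ih | atMost n R C ih | atLeast n R C ih =>
    rcases h with rfl | h
    · exact subset_rfl
    · exact (ih h).trans Set.subset_union_right

theorem UKB.thetaF_allParts {K : UKB NC NR NI}
    (h : ∀ E ∈ K.nonFunctional, E.AllParts fun X => X.RestrQ ∧ X.NumFree) :
    ∀ E ∈ K.thetaF.tbox, E.AllParts fun X => X.RestrQ ∧ X.NumFree := by
  rintro E ((hE | ⟨R, D, -, ⟨C, hC, hD⟩, rfl⟩) | ⟨R, S, -, -, rfl⟩)
  · exact h E hE
  · have : D.AllParts fun X => X.RestrQ ∧ X.NumFree := fun X hX =>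
      h C hC X (Concept.parts_trans hD hX)
    simp only [Concept.allParts_union, Concept.allParts_all, Concept.allParts_neg]
    exact ⟨⟨⟨id, trivial⟩, this⟩, ⟨id, trivial⟩, this⟩
  · simp only [Concept.allParts_union, Concept.allParts_all, Concept.allParts_bot]
    exact ⟨⟨⟨fun h => h.1, trivial⟩, trivial, trivial⟩, ⟨fun h => h.1, trivial⟩, trivial, trivial⟩

end Shape

/-! ### Termination of the rewriting -/

section Termination

theorem exists_exhausts {α : Type*} {step : α → α → Prop} (P : α → Prop) (m : α → ℕ)
    (h : ∀ a b, P a → step a b → P b ∧ m b < m a) (a : α) (ha : P a) :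
    ∃ b, Exhausts step a b := by
  induction hn : m a using Nat.strong_induction_on generalizing a with
  | _ n ih =>
    by_cases hs : ∃ c, step a c
    · obtain ⟨c, hc⟩ := hs
      obtain ⟨hPc, hm⟩ := h a c ha hc
      obtain ⟨b, hb, hb'⟩ := ih (m c) (hn ▸ hm) c hPc rfl
      exact ⟨b, .head hc hb, hb'⟩
    · push Not at hs
      exact ⟨a, .refl, hs⟩

/-- Total weight of a set of axioms. -/
noncomputable def weight {α : Type*} (μ : α → ℕ) (T : Set α) : ℕ := ∑ᶠ C ∈ T, μ C

theorem weight_union_le {α : Type*} (μ : α → ℕ) {S T : Set α} (hS : S.Finite) (hT : T.Finite) :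
    weight μ (S ∪ T) ≤ weight μ S + weight μ T := by
  have := finsum_mem_union_inter (f := μ) hS hT
  simp only [weight]
  omega

theorem weight_singleton {α : Type*} (μ : α → ℕ) (a : α) : weight μ {a} = μ a :=
  finsum_mem_singleton

theorem weight_pair_le {α : Type*} (μ : α → ℕ) (a b : α) : weight μ {a, b} ≤ μ a + μ b := by
  rw [← weight_singleton μ a, ← weight_singleton μ b]
  exact weight_union_le μ (Set.finite_singleton a) (Set.finite_singleton b)

theorem weight_eq_zero {α : Type*} (μ : α → ℕ) {T : Set α} (h : ∀ a ∈ T, μ a = 0) :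
    weight μ T = 0 := finsum_mem_eq_zero_of_forall_eq_zero h

/-- Axioms form a set, so a new axiom may coincide with an old one; this can only lower the total,
whence the subadditive bounds suffice. -/
theorem weight_replace_lt {α : Type*} (μ : α → ℕ) {T N : Set α} {E : α} (hT : T.Finite)
    (hN : N.Finite) (hE : E ∈ T) (h : weight μ N < μ E) : weight μ (T \ {E} ∪ N) < weight μ T := by
  have h1 := weight_union_le μ (hT.subset (Set.sdiff_subset (t := {E}))) hN
  have h2 : weight μ T = μ E + weight μ (T \ {E}) := by
    have : T = insert E (T \ {E}) := by simp [Set.insert_eq_of_mem hE]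
    conv_lhs => rw [this]
    exact finsum_mem_insert μ (fun h => h.2 rfl) (hT.subset Set.sdiff_subset)
  omega

/-- The number of quantifiers and number restrictions. -/
def Concept.quants : Concept NC NR → ℕ
  | .name _ => 0
  | .top => 0
  | .bot => 0
  | .neg C => C.quants
  | .inter C D => C.quants + D.quants
  | .union C D => C.quants + D.quants
  | .all _ C => C.quants + 1
  | .ex _ C => C.quants + 1
  | .atMost _ _ C => C.quants + 1
  | .atLeast _ _ C => C.quants + 1

open Classical in
/-- The weight of a filler that is to be abbreviated. -/
noncomputable def Concept.fillerWeight (C : Concept NC NR) : ℕ :=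
  if C.IsName then 0 else C.quants + 1

/-- The weight that decreases in flattening steps. -/
noncomputable def Concept.flatWeight : Concept NC NR → ℕ
  | .name _ => 0
  | .top => 0
  | .bot => 0
  | .neg C => C.flatWeight
  | .inter C D => C.flatWeight + D.flatWeight
  | .union C D => C.flatWeight + D.flatWeight
  | .all _ C => C.fillerWeight
  | .ex _ C => C.fillerWeight
  | .atMost _ _ C => C.fillerWeight
  | .atLeast _ _ C => C.fillerWeight

theorem Concept.quants_nnf_and (C : Concept NC NR) :
    C.nnf.quants = C.quants ∧ C.nnfNeg.quants = C.quants := by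
  induction C <;> simp_all [Concept.nnf, Concept.nnfNeg, Concept.quants]

theorem Concept.flatWeight_le (C : Concept NC NR) : C.flatWeight ≤ C.quants := by
  have key : ∀ D : Concept NC NR, D.fillerWeight ≤ D.quants + 1 := fun D => by
    unfold Concept.fillerWeight
    split <;> omega
  induction C with
  | all U C | ex U C | atMost n R C | atLeast n R C => exact key C
  | neg C ih => exact ih
  | inter C D ihC ihD | union C D ihC ihD => exact Nat.add_le_add ihC ihD
  | _ => exact le_rfl

theorem ReplaceOuter.flatWeight {X Y E E' : Concept NC NR} (h : ReplaceOuter X Y E E') :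
    E'.flatWeight + X.flatWeight = E.flatWeight + Y.flatWeight := by
  induction h with
  | here => exact Nat.add_comm _ _
  | _ => simp only [Concept.flatWeight]; omega

/-- The abbreviated concept drops from `D.quants + 1` to `0`, while the connecting axiom weighs at
most `D.quants`, since negation normal form preserves the number of quantifiers. -/
theorem Abbreviate.flatWeight {F : NC} {D X X' G : Concept NC NR} (h : Abbreviate F D X X' G)
    (hD : ∀ A, D ≠ .name A) : X'.flatWeight + G.flatWeight < X.flatWeight := by
  have h1 : D.fillerWeight = D.quants + 1 := if_neg fun ⟨A, hA⟩ => hD A hA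
  have h2 : (Concept.name F : Concept NC NR).fillerWeight = 0 := if_pos ⟨F, rfl⟩
  have h3 := D.flatWeight_le
  have h4 := D.nnfNeg.flatWeight_le
  rw [D.quants_nnf_and.2] at h4
  cases h <;> simp only [Concept.flatWeight, h1, h2] <;> omega

theorem FlatStep.weight_lt {K K' : UKB (Name NC) (Name NR) NI} (h : FlatStep K K')
    (hK : K.IsFinite) :
    weight Concept.flatWeight K'.tbox < weight Concept.flatWeight K.tbox := by
  obtain ⟨E, E', X, X', G, D, k, hE, hD, -, hA, hR, rfl⟩ := h
  refine weight_replace_lt _ hK.tbox (Set.toFinite {E', G}) hE ?_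
  have h1 := weight_pair_le Concept.flatWeight E' G
  have h2 := hA.flatWeight hD
  have h3 := hR.flatWeight
  omega

theorem exists_flat {K : UKB (Name NC) (Name NR) NI} (hK : K.IsFinite) : ∃ K', Flat K K' :=
  exists_exhausts UKB.IsFinite (fun K => weight Concept.flatWeight K.tbox)
    (fun _ _ hK h => ⟨h.fin hK, h.weight_lt hK⟩) K.nnf hK.nnf

/-- The number of occurrences of number restrictions in the scope of `⊓` and `⊔` only. -/
def Concept.outerNum : Concept NC NR → ℕ
  | .inter C D => C.outerNum + D.outerNum
  | .union C D => C.outerNum + D.outerNum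
  | .atMost _ _ _ => 1
  | .atLeast _ _ _ => 1
  | _ => 0

theorem ReplaceOuter.outerNum {X Y E E' : Concept NC NR} (h : ReplaceOuter X Y E E') :
    E'.outerNum + X.outerNum = E.outerNum + Y.outerNum := by
  induction h with
  | here => exact Nat.add_comm _ _
  | _ => simp only [Concept.outerNum]; omega

theorem outerNum_exInter (rs : ℕ → NR) (C : Concept NC NR) (n : ℕ) :
    (exInter rs C n).outerNum = 0 := by
  induction n <;> simp_all [exInter, Concept.outerNum]

/-- Each step removes one accessible number restriction, and the disjointness axioms it adds start
with `∀`, so they have weight zero. -/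
theorem exists_geExhausts {K : UKB (Name NC) (Name NR) NI} (hK : K.IsFinite) :
    ∃ K', Exhausts GeStep K K' := by
  refine exists_exhausts UKB.IsFinite (fun K => weight Concept.outerNum K.tbox)
    (fun K K' hK h => ⟨h.fin hK, ?_⟩) K hK
  obtain ⟨E, E', C, n, R, f, hE, -, -, hR, rfl⟩ := h
  simp only [Set.union_assoc]
  have hadd := finite_bounded_pairs n fun i k => (Concept.all
    (.inter (.atom (.name (.fresh (f i)))) (.atom (.name (.fresh (f k))))) .bot :
      Concept (Name NC) (Name NR))
  refine weight_replace_lt _ hK.tbox ((Set.finite_singleton E').union hadd) hE ?_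
  refine (weight_union_le _ (Set.finite_singleton E') hadd).trans_lt ?_
  rw [weight_singleton, weight_eq_zero _ (by rintro _ ⟨i, k, -, -, rfl⟩; rfl)]
  have h1 := hR.outerNum
  rw [outerNum_exInter] at h1
  simp only [Concept.outerNum] at h1
  omega

open Classical in
theorem exists_leExhausts {K : UKB (Name NC) (Name NR) NI} (hK : K.IsFinite) :
    ∃ K', Exhausts LeStep K K' := by
  -- Functionality axioms count zero: each step produces new ones, and they are never rewritten.
  let μ : Concept (Name NC) (Name NR) → ℕ := fun E =>
    if ∃ S, E = .atMost 1 S .top then 0 else E.outerNum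
  refine exists_exhausts UKB.IsFinite (fun K => weight μ K.tbox)
    (fun K K' hK h => ⟨h.fin hK, ?_⟩) K hK
  obtain ⟨E, E', C, n, R, f, hE, hE1, -, -, hR, rfl⟩ := h
  simp only [Set.union_assoc]
  have hadd := LeStep.finite_added (NR := NR) (C := C) n f
  refine weight_replace_lt _ hK.tbox ((Set.finite_singleton E').union hadd) hE ?_
  refine (weight_union_le _ (Set.finite_singleton E') hadd).trans_lt ?_
  rw [weight_singleton, weight_eq_zero]
  · have h1 := hR.outerNum
    simp only [Concept.outerNum] at h1
    have h2 : μ E = E.outerNum := if_neg fun ⟨S, hS⟩ => hE1 S hS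
    have h3 : μ E' ≤ E'.outerNum := by
      simp only [μ]
      split <;> omega
    omega
  · rintro _ ⟨i, -, rfl | rfl⟩
    · simp [μ, Concept.outerNum]
    · exact if_pos ⟨_, rfl⟩

end Termination

/-! ### The knowledge base without transitivity axioms -/

section ThetaS

/-- All subexpressions of a concept expression. -/
def Concept.subs : Concept NC NR → Set (Concept NC NR)
  | .name A => {.name A}
  | .top => {.top}
  | .bot => {.bot}
  | .neg C => {.neg C} ∪ C.subs
  | .inter C D => {.inter C D} ∪ (C.subs ∪ D.subs)
  | .union C D => {.union C D} ∪ (C.subs ∪ D.subs)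
  | .all U C => {.all U C} ∪ C.subs
  | .ex U C => {.ex U C} ∪ C.subs
  | .atMost n R C => {.atMost n R C} ∪ C.subs
  | .atLeast n R C => {.atLeast n R C} ∪ C.subs

theorem Concept.finite_subs (C : Concept NC NR) : C.subs.Finite := by
  induction C <;> simp_all [Concept.subs]

theorem Concept.mem_subs_self (C : Concept NC NR) : C ∈ C.subs := by
  cases C <;> simp [Concept.subs]

theorem Concept.subs_trans {C D : Concept NC NR} (h : D ∈ C.subs) : D.subs ⊆ C.subs := by
  induction C with
  | name A | top | bot => rw [Set.eq_of_mem_singleton h]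
  | inter C C' ih ih' | union C C' ih ih' =>
    rcases h with rfl | h | h
    · exact subset_rfl
    · exact (ih h).trans fun _ h => .inr (.inl h)
    · exact (ih' h).trans fun _ h => .inr (.inr h)
  | neg C ih | all U C ih | ex U C ih | atMost n R C ih | atLeast n R C ih =>
    rcases h with rfl | h
    · exact subset_rfl
    · exact (ih h).trans Set.subset_union_right

/-- The negation normal forms of `C` and `¬C` are among the subexpressions up to normal form. -/
def nnfClosure (S : Set (Concept NC NR)) : Set (Concept NC NR) :=
  Concept.nnf '' S ∪ Concept.nnfNeg '' S

/-- Normal forms push negations inwards, so their immediate parts are normal forms of subexpressions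
or of negated ones; the negation case just swaps the two claims. -/
theorem mem_nnfClosure_of_immediateSub {S : Set (Concept NC NR)}
    (hS : ∀ C ∈ S, C.subs ⊆ S) {C : Concept NC NR} (hC : C ∈ S) :
    (∀ D, D.ImmediateSub C.nnf → D ∈ nnfClosure S) ∧
      ∀ D, D.ImmediateSub C.nnfNeg → D ∈ nnfClosure S := by
  have pos : ∀ {C}, C ∈ S → C.nnf ∈ nnfClosure S := fun h => .inl ⟨_, h, rfl⟩
  have neg : ∀ {C}, C ∈ S → C.nnfNeg ∈ nnfClosure S := fun h => .inr ⟨_, h, rfl⟩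
  induction C with
  | name A => exact ⟨fun D h => h.elim, fun D h => h ▸ pos hC⟩
  | top => exact ⟨fun D h => h.elim, fun D h => h.elim⟩
  | bot => exact ⟨fun D h => h.elim, fun D h => h.elim⟩
  | neg C ih => exact (ih (hS _ hC (.inr C.mem_subs_self))).symm
  | inter C C' | union C C' =>
    have h1 := hS _ hC (.inr (.inl C.mem_subs_self))
    have h2 := hS _ hC (.inr (.inr C'.mem_subs_self))
    constructor
    · rintro D (rfl | rfl)
      exacts [pos h1, pos h2]
    · rintro D (rfl | rfl)
      exacts [neg h1, neg h2]
  | all U C | ex U C =>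
    have h1 := hS _ hC (.inr C.mem_subs_self)
    exact ⟨fun D h => h ▸ pos h1, fun D h => h ▸ neg h1⟩
  | atMost n R C | atLeast n R C =>
    have h1 := hS _ hC (.inr C.mem_subs_self)
    exact ⟨fun D h => h ▸ pos h1, fun D h => h ▸ pos h1⟩

theorem Role.finite_transitive {K : KnowledgeBase NC NR NI} (h : K.rbox.Finite) :
    {R | K.Transitive R}.Finite := by
  have h1 : {R : Role NR | RoleAxiom.trans R ∈ K.rbox}.Finite :=
    h.preimage fun a _ b _ h => by simpa using h
  have h2 : {R : Role NR | RoleAxiom.trans R.Inv ∈ K.rbox}.Finite :=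
    h.preimage fun a _ b _ h => by
      simp only [RoleAxiom.trans.injEq] at h
      rw [← a.Inv_Inv, h, b.Inv_Inv]
  exact h1.union h2

/-- Beyond the normal forms of subexpressions and their negations, the closure contains only
concepts `∀S.C` with `S` transitive and `C` among those normal forms. Such a concept contributes no
new filler, so the process stops. -/
theorem KnowledgeBase.finite_cl {K : KnowledgeBase NC NR NI} (ht : K.tbox.Finite)
    (hr : K.rbox.Finite) : {C | K.Cl C}.Finite := by
  let S : Set (Concept NC NR) := ⋃ g ∈ K.tbox, g.toConcept.subs
  have hSfin : S.Finite := ht.biUnion fun g _ => g.toConcept.finite_subs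
  have hS : ∀ C ∈ S, C.subs ⊆ S := by
    intro C hC D hD
    simp only [S, Set.mem_iUnion] at hC ⊢
    obtain ⟨g, hg, hC⟩ := hC
    exact ⟨g, hg, Concept.subs_trans hC hD⟩
  have hfin : (nnfClosure S).Finite := (hSfin.image _).union (hSfin.image _)
  refine (hfin.union (((Role.finite_transitive hr).prod hfin).image fun q =>
    Concept.all (.atom q.1) q.2)).subset ?_
  have sub : ∀ C ∈ nnfClosure S, ∀ D, D.ImmediateSub C → D ∈ nnfClosure S := by
    rintro _ (⟨C, hC, rfl⟩ | ⟨C, hC, rfl⟩)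
    exacts [(mem_nnfClosure_of_immediateSub hS hC).1, (mem_nnfClosure_of_immediateSub hS hC).2]
  have neg : ∀ C ∈ nnfClosure S, C.nnfNeg ∈ nnfClosure S := by
    rintro _ (⟨C, hC, rfl⟩ | ⟨C, hC, rfl⟩)
    · rw [(nnf_nnf_and C).2.1]; exact .inr ⟨C, hC, rfl⟩
    · rw [(nnf_nnf_and C).2.2]; exact .inl ⟨C, hC, rfl⟩
  intro C hC
  induction hC with
  | @gci g hg => exact .inl (.inl ⟨_, Set.mem_biUnion hg g.toConcept.mem_subs_self, rfl⟩)
  | sub _ hD ih =>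
    rcases ih with h | ⟨⟨R, C⟩, ⟨-, h⟩, rfl⟩
    · exact .inl (sub _ h _ hD)
    · exact .inl (by rw [show _ = C from hD]; exact h)
  | atMost _ ih =>
    rcases ih with h | ⟨⟨R, C⟩, ⟨-, h⟩, he⟩
    · exact .inl (neg _ (sub _ h _ rfl))
    · cases he
  | trans hS _ _ ih =>
    refine .inr ⟨⟨_, _⟩, ⟨hS, ?_⟩, rfl⟩
    rcases ih with h | ⟨⟨R, C⟩, ⟨-, h⟩, he⟩
    · exact sub _ h _ rfl
    · cases he; exact h

theorem KnowledgeBase.thetaS_fin {K : KnowledgeBase NC NR NI} (hK : K.IsSHIQbs)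
    (self : Role NR → NC) : (K.thetaS self).IsFinite := by
  have hR := Role.finite_transitive hK.rbox_finite
  refine ⟨((hK.tbox_finite.union ?_).union ?_).image _, hK.rbox_finite.subset (Set.sep_subset _ _),
    (hK.rules_finite.union ?_).union ?_⟩
  · refine ((KnowledgeBase.finite_cl hK.tbox_finite hK.rbox_finite).image fun C =>
      (⟨C, match C with
        | .all U C => .all U (.all U C)
        | C => C⟩ : GCI NC NR)).subset ?_
    rintro _ ⟨R, C, -, hC, rfl⟩
    exact ⟨_, hC, rfl⟩
  · refine (hR.image fun R =>
      (⟨.ex (.inter (.atom R) (.atom R.Inv)) .top, .name (self R)⟩ : GCI NC NR)).subset ?_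
    rintro _ ⟨R, hR, rfl⟩
    exact ⟨R, hR, rfl⟩
  · refine (hR.image fun R => (⟨[.con (self R) (.var 0)], [roleAtom R (.var 0) (.var 0)]⟩ :
      Rule NC NR NI)).subset ?_
    rintro _ ⟨R, hR, rfl⟩
    exact ⟨R, hR, rfl⟩
  · refine (hR.image fun R => (⟨[roleAtom R (.var 0) (.var 1), roleAtom R (.var 1) (.var 2)],
        [roleAtom R (.var 0) (.var 2)]⟩ : Rule NC NR NI)).subset ?_
    rintro _ ⟨R, hR, rfl⟩
    exact ⟨R, hR, rfl⟩

theorem Concept.Admissible.nnf_and {rbox : Set (RoleAxiom NR)} {C : Concept NC NR}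
    (h : C.Admissible rbox) : C.nnf.Admissible rbox ∧ C.nnfNeg.Admissible rbox := by
  induction C <;> simp_all [Concept.nnf, Concept.nnfNeg, Concept.Admissible]

theorem Concept.Admissible.allParts {rbox : Set (RoleAxiom NR)} {C : Concept NC NR}
    (h : C.Admissible rbox) : C.AllParts Concept.RestrQ := by
  induction C with
  | name A => exact Concept.allParts_name.2 trivial
  | top => exact Concept.allParts_top.2 trivial
  | bot => exact Concept.allParts_bot.2 trivial
  | neg C ih => exact ih h
  | inter C D ihC ihD => exact Concept.allParts_inter.2 ⟨ihC h.1, ihD h.2⟩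
  | union C D ihC ihD => exact Concept.allParts_union.2 ⟨ihC h.1, ihD h.2⟩
  | all U C ih => exact Concept.allParts_all.2 ⟨h.1.1, ih h.2⟩
  | ex U C ih => exact Concept.allParts_ex.2 ⟨h.1.1, ih h.2⟩
  | atMost n R C ih => exact Concept.allParts_atMost.2 ⟨trivial, ih h.2⟩
  | atLeast n R C ih => exact Concept.allParts_atLeast.2 ⟨trivial, ih h.2⟩

theorem Concept.ImmediateSub.admissible {rbox : Set (RoleAxiom NR)} {C D : Concept NC NR}
    (h : D.ImmediateSub C) (hC : C.Admissible rbox) : D.Admissible rbox := by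
  cases C with
  | name A | top | bot => exact h.elim
  | neg C => exact h ▸ hC
  | inter C C' | union C C' =>
    rcases h with rfl | rfl
    exacts [hC.1, hC.2]
  | all U C | ex U C | atMost n R C | atLeast n R C => exact h ▸ hC.2

theorem KnowledgeBase.Cl.admissible {K : KnowledgeBase NC NR NI} (hK : K.IsSHIQbs)
    {C : Concept NC NR} (h : K.Cl C) : C.Admissible K.rbox := by
  induction h with
  | gci hg => exact (Concept.Admissible.nnf_and (C := GCI.toConcept _) (hK.concepts _ hg)).1
  | sub _ hD ih => exact hD.admissible ih
  | atMost _ ih => exact (Concept.Admissible.nnf_and ih.2).2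
  | @trans R S C _ _ _ ih => exact ⟨⟨id, .inl ⟨S, rfl⟩⟩, ih.2⟩

theorem KnowledgeBase.thetaS_allParts {K : KnowledgeBase NC NR NI} (hK : K.IsSHIQbs)
    (self : Role NR → NC) : ∀ E ∈ (K.thetaS self).tbox, E.AllParts Concept.RestrQ := by
  rintro _ ⟨g, (hg | ⟨R, C, -, hC, rfl⟩) | ⟨R, -, rfl⟩, rfl⟩
  · exact Concept.allParts_union.2
      ⟨(hK.concepts g hg).1.allParts, (hK.concepts g hg).2.allParts⟩
  · have h1 := (hC.admissible hK).allParts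
    exact Concept.allParts_union.2 ⟨h1, Concept.allParts_all.2 ⟨id, h1⟩⟩
  · exact Concept.allParts_union.2 ⟨Concept.allParts_ex.2 ⟨fun h => h.1,
      Concept.allParts_top.2 trivial⟩, Concept.allParts_name.2 trivial⟩

theorem KnowledgeBase.thetaS_inclOnly {K : KnowledgeBase NC NR NI} (hK : K.IsSHIQbs)
    (self : Role NR → NC) : InclOnly (K.thetaS self).rbox := by
  rintro α ⟨hα, U, V, rfl⟩
  exact ⟨U, V, rfl, (hK.inclusions U V hα).1.1⟩

/-! #### The enlarged vocabulary -/

theorem Role.map_Inv {NR' : Type u} (g : NR → NR') (R : Role NR) : R.Inv.map g = (R.map g).Inv := by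
  cases R <;> rfl

theorem Role.map_injective {NR' : Type u} {g : NR → NR'} (hg : Function.Injective g) :
    Function.Injective (Role.map g) := by
  intro R S h
  cases R <;> cases S <;> simp_all [Role.map, hg.eq_iff]

theorem Name.orig_injective {N : Type u} : Function.Injective (Name.orig : N → Name N) :=
  fun _ _ h => by simpa using h

theorem RoleExpr.map_injective {NR' : Type u} {g : NR → NR'} (hg : Function.Injective g) :
    Function.Injective (RoleExpr.map g) := by
  intro U
  induction U with
  | atom R =>
    intro V h
    cases V <;> simp_all [RoleExpr.map, (Role.map_injective hg).eq_iff]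
  | neg U ih =>
    intro V h
    cases V with
    | neg V =>
      simp only [RoleExpr.map, RoleExpr.neg.injEq] at h
      rw [ih h]
    | _ => simp [RoleExpr.map] at h
  | inter U U' ih ih' =>
    intro V h
    cases V with
    | inter V V' =>
      simp only [RoleExpr.map, RoleExpr.inter.injEq] at h
      rw [ih h.1, ih' h.2]
    | _ => simp [RoleExpr.map] at h
  | union U U' ih ih' =>
    intro V h
    cases V with
    | union V V' =>
      simp only [RoleExpr.map, RoleExpr.union.injEq] at h
      rw [ih h.1, ih' h.2]
    | _ => simp [RoleExpr.map] at h

theorem RoleExpr.derivable_map_empty {NR' : Type u} (g : NR → NR') (U : RoleExpr NR) :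
    (U.map g).Derivable ∅ ↔ U.Derivable ∅ := by
  induction U <;> simp_all [RoleExpr.map, RoleExpr.Derivable]

theorem RoleExpr.roles_map {NR' : Type u} (g : NR → NR') (U : RoleExpr NR) :
    (U.map g).roles = Role.map g '' U.roles := by
  induction U <;> simp_all [RoleExpr.map, RoleExpr.roles, Set.image_union]

/-- The lifted RBox is an injective renaming, so a derivation of non-simplicity can be pulled back.
-/
theorem nonSimple_lift {rbox : Set (RoleAxiom NR)} {R' : Role (Name NR)}
    (h : NonSimple (RoleAxiom.map Name.orig '' rbox) R') :
    ∃ R, R' = R.map Name.orig ∧ NonSimple rbox R := by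
  induction h with
  | trans h =>
    obtain ⟨α, hα, he⟩ := h
    cases α with
    | trans R =>
      simp only [RoleAxiom.map, RoleAxiom.trans.injEq] at he
      exact ⟨R, he.symm, .trans hα⟩
    | incl => simp [RoleAxiom.map] at he
  | incl h _ ih =>
    obtain ⟨R, rfl, hR⟩ := ih
    obtain ⟨α, hα, he⟩ := h
    cases α with
    | trans R => simp [RoleAxiom.map] at he
    | incl U V =>
      simp only [RoleAxiom.map, RoleAxiom.incl.injEq] at he
      obtain ⟨h1, h2⟩ := he
      obtain rfl : U = .atom R := RoleExpr.map_injective Name.orig_injective h1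
      cases V with
      | atom S =>
        simp only [RoleExpr.map, RoleExpr.atom.injEq] at h2
        exact ⟨S, h2.symm, .incl hα hR⟩
      | _ => simp [RoleExpr.map] at h2
  | inv _ ih =>
    obtain ⟨R, rfl, hR⟩ := ih
    exact ⟨R.Inv, (Role.map_Inv _ _).symm, .inv hR⟩

theorem not_nonSimple_lift {rbox : Set (RoleAxiom NR)} {R : Role NR} (h : ¬ NonSimple rbox R) :
    ¬ NonSimple (RoleAxiom.map Name.orig '' rbox) (R.map Name.orig) := fun h' => by
  obtain ⟨S, hS, hS'⟩ := nonSimple_lift h'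
  exact h (Role.map_injective Name.orig_injective hS ▸ hS')

theorem RoleExpr.Simple.lift {rbox : Set (RoleAxiom NR)} {U : RoleExpr NR} (h : U.Simple rbox) :
    (U.map Name.orig).Simple (RoleAxiom.map Name.orig '' rbox) := by
  intro R hR
  rw [RoleExpr.roles_map] at hR
  obtain ⟨R, hR, rfl⟩ := hR
  exact not_nonSimple_lift (h R hR)

theorem RoleExpr.Admissible.lift {rbox : Set (RoleAxiom NR)} {U : RoleExpr NR}
    (h : U.Admissible rbox) : (U.map Name.orig).Admissible (RoleAxiom.map Name.orig '' rbox) := by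
  refine ⟨fun h' => h.1 ((RoleExpr.derivable_map_empty _ _).1 h'), h.2.imp ?_ fun h => h.lift⟩
  rintro ⟨R, rfl⟩
  exact ⟨_, rfl⟩

theorem Concept.Admissible.lift {rbox : Set (RoleAxiom NR)} {C : Concept NC NR}
    (h : C.Admissible rbox) :
    (C.map (Name.orig : NC → Name NC) Name.orig).Admissible (RoleAxiom.map Name.orig '' rbox) := by
  induction C with
  | name A | top | bot => trivial
  | neg C ih => exact ih h
  | inter C D ihC ihD | union C D ihC ihD => exact ⟨ihC h.1, ihD h.2⟩
  | all U C ih | ex U C ih => exact ⟨h.1.lift, ih h.2⟩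
  | atMost n R C ih | atLeast n R C ih => exact ⟨not_nonSimple_lift h.1, ih h.2⟩

theorem KnowledgeBase.IsSHIQbs.lift {K : KnowledgeBase NC NR NI} (hK : K.IsSHIQbs) :
    K.lift.IsSHIQbs where
  tbox_finite := hK.tbox_finite.image _
  rbox_finite := hK.rbox_finite.image _
  rules_finite := hK.rules_finite.image _
  concepts := by
    rintro _ ⟨g, hg, rfl⟩
    exact ⟨(hK.concepts g hg).1.lift, (hK.concepts g hg).2.lift⟩
  inclusions := by
    rintro _ _ ⟨α, hα, he⟩
    cases α with
    | trans R => simp [RoleAxiom.map] at he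
    | incl U V =>
      simp only [RoleAxiom.map, RoleAxiom.incl.injEq] at he
      obtain ⟨rfl, rfl⟩ := he
      exact ⟨(hK.inclusions U V hα).1.lift, (hK.inclusions U V hα).2.lift⟩
  inclusions_simple := by
    rintro _ _ ⟨α, hα, he⟩
    cases α with
    | trans R => simp [RoleAxiom.map] at he
    | incl U V =>
      simp only [RoleAxiom.map, RoleAxiom.incl.injEq] at he
      obtain ⟨rfl, rfl⟩ := he
      refine (hK.inclusions_simple U V hα).imp ?_ fun h => h.lift
      rintro ⟨R, rfl⟩
      exact ⟨_, rfl⟩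

theorem Interp.reduct_role (I : Interp (Name NC) (Name NR) NI) (R : Role NR) :
    I.reduct.role R = I.role (R.map Name.orig) := by
  cases R <;> rfl

theorem Interp.reduct_roleExpr (I : Interp (Name NC) (Name NR) NI) (U : RoleExpr NR)
    (x y : I.Domain) : I.reduct.roleExpr U x y ↔ I.roleExpr (U.map Name.orig) x y := by
  induction U with
  | atom R => exact iff_of_eq (congrFun (congrFun (I.reduct_role R) x) y)
  | neg U ih => exact not_congr ih
  | inter U V ihU ihV => exact and_congr ihU ihV
  | union U V ihU ihV => exact or_congr ihU ihV

theorem Interp.reduct_concept (I : Interp (Name NC) (Name NR) NI) (C : Concept NC NR) :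
    I.reduct.concept C = I.concept (C.map Name.orig Name.orig) := by
  induction C with
  | name A | top | bot => rfl
  | neg C ih => exact congrArg compl ih
  | inter C D ihC ihD => exact congrArg₂ (· ∩ ·) ihC ihD
  | union C D ihC ihD => exact congrArg₂ (· ∪ ·) ihC ihD
  | all U C ih | ex U C ih =>
    have hU : I.reduct.roleExpr U = I.roleExpr (U.map Name.orig) :=
      funext fun x => funext fun y => propext (I.reduct_roleExpr U x y)
    simp only [Interp.concept, Concept.map, ih, hU]; rfl
  | atMost n R C ih | atLeast n R C ih =>
    simp only [Interp.concept, Concept.map, ih, Interp.reduct_role]; rfl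

theorem Interp.reduct_models {K : KnowledgeBase NC NR NI} {I : Interp (Name NC) (Name NR) NI} :
    I.reduct.Models K ↔ I.Models K.lift := by
  refine and_congr ?_ (and_congr ?_ ?_)
  · simp only [KnowledgeBase.lift, Set.forall_mem_image, Interp.reduct_concept, GCI.map]
    rfl
  · simp only [KnowledgeBase.lift, Set.forall_mem_image]
    refine forall₂_congr fun α _ => ?_
    cases α with
    | incl U V =>
      exact forall₂_congr fun x y =>
        imp_congr (I.reduct_roleExpr U x y) (I.reduct_roleExpr V x y)
    | trans R =>
      simp only [Interp.SatRoleAxiom, RoleAxiom.map, Interp.reduct_role]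
      rfl
  · simp only [KnowledgeBase.lift, Set.forall_mem_image]
    refine forall₂_congr fun ρ _ => forall₂_congr fun Z _ => ?_
    have key : ∀ α, I.reduct.SatAtom Z α ↔ I.SatAtom Z (α.map Name.orig Name.orig) := by
      have ht : ∀ t, I.reduct.term Z t = I.term Z t := fun t => by cases t <;> rfl
      intro α
      cases α <;> simp only [Interp.SatAtom, Atom.map, ht] <;> rfl
    simp only [Rule.map, List.mem_map, forall_exists_index, and_imp, forall_apply_eq_imp_iff₂,
      ne_eq, List.map_eq_nil_iff, key]

/-- Every interpretation is the reduct of one for the enlarged vocabulary. -/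
theorem Interp.exists_reduct (I : Interp NC NR NI) :
    ∃ I' : Interp (Name NC) (Name NR) NI, I'.reduct = I :=
  ⟨⟨I.Domain, I.ind, fun A => match A with
      | .orig A => I.con A
      | .fresh _ => ∅, fun r => match r with
      | .orig r => I.rol r
      | .fresh _ => fun _ _ => False⟩, rfl⟩

theorem KnowledgeBase.Transitive.role_trans {K : KnowledgeBase NC NR NI} {I : Interp NC NR NI}
    (hI : ∀ α ∈ K.rbox, I.SatRoleAxiom α) {R : Role NR} (hR : K.Transitive R) {x y z : I.Domain}
    (h : I.role R x y) (h' : I.role R y z) : I.role R x z := by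
  rcases hR with hR | hR
  · exact hI _ hR x y z h h'
  · rw [← Interp.role_Inv] at h h' ⊢
    exact hI _ hR z y x h' h

/-- `Self_R` is interpreted by the reflexive points of `R`; injectivity of `self` keeps different
roles from sharing a name. All added axioms and rules then follow from transitivity. -/
theorem KnowledgeBase.thetaS_extends (K : KnowledgeBase NC NR NI) {self : Role (Name NR) → ℕ}
    (hself : Set.InjOn self {R | K.lift.Transitive R}) {I : Interp (Name NC) (Name NR) NI}
    (hI : I.Models K.lift) :
    ∃ I', (K.lift.thetaS fun R => Name.fresh (self R)).IsModel I' ∧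
      I.reduct.NamedEq I'.reduct := by
  let con : Name NC → Set I.Domain
    | .orig A => I.con (.orig A)
    | .fresh k => {x | ∃ R, K.lift.Transitive R ∧ self R = k ∧ I.role R x x}
  have hrole : ∀ R, (I.withNames con I.rol).role R = I.role R := fun R =>
    Interp.withNames_role rfl
  have hse : ∀ R, K.lift.Transitive R → ∀ x : I.Domain,
      x ∈ con (.fresh (self R)) ↔ I.role R x x := by
    intro R hR x
    constructor
    · rintro ⟨S, hS, he, h⟩
      rwa [← hself hS hR he]
    · exact fun h => ⟨R, hR, rfl, h⟩
  have hI' : (I.withNames con I.rol).reduct = I.reduct := rfl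
  have hM : (I.withNames con I.rol).Models K.lift := by
    rw [← Interp.reduct_models, hI', Interp.reduct_models]
    exact hI
  refine ⟨I.withNames con I.rol, ⟨?_, ?_, ?_⟩, hI' ▸ .refl _⟩
  · rintro _ ⟨g, (hg | ⟨R, C, hR, -, rfl⟩) | ⟨R, hR, rfl⟩, rfl⟩ x
    · by_cases hx : x ∈ (I.withNames con I.rol).concept g.lhs
      · exact .inr (hM.1 g hg hx)
      · exact .inl hx
    · by_cases hx : x ∈ (I.withNames con I.rol).concept (.all (.atom R) C)
      · exact .inr fun y hy z hz => hx z (hR.role_trans hM.2.1 hy hz)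
      · exact .inl hx
    · refine or_iff_not_imp_left.2 fun hx => ?_
      obtain ⟨y, ⟨hy, hy'⟩, -⟩ := not_not.1 hx
      refine (hse R hR x).2 ?_
      replace hy' := ((I.withNames con I.rol).role_Inv R x y).1 hy'
      have := hR.role_trans hM.2.1 hy hy'
      rwa [hrole] at this
  · exact fun α hα => hM.2.1 α hα.1
  · rintro ρ ((hρ | ⟨R, hR, rfl⟩) | ⟨R, hR, rfl⟩)
    · exact hM.2.2 ρ hρ
    · rw [Interp.satRule_iff]
      intro z hz
      refine ⟨by simp, ?_⟩
      simp only [List.mem_cons, List.not_mem_nil, or_false, forall_eq,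
        Interp.ground_roleAtom] at hz ⊢
      rw [hrole]
      exact (hse R hR _).1 hz
    · rw [Interp.satRule_iff]
      intro z hz
      refine ⟨by simp, ?_⟩
      simp only [List.mem_cons, List.not_mem_nil, or_false, forall_eq_or_imp, forall_eq,
        Interp.ground_roleAtom] at hz ⊢
      exact hR.role_trans hM.2.1 hz.1 hz.2

end ThetaS

/-! ### Unravelling into a forest -/

section Unravelling

/-- The boolean value of a concept when the set `t` of parts is considered to be true. -/
def Concept.Holds (t : Set (Concept NC NR)) : Concept NC NR → Prop
  | .top => True
  | .bot => False
  | .neg C => ¬ C.Holds t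
  | .inter C D => C.Holds t ∧ D.Holds t
  | .union C D => C.Holds t ∨ D.Holds t
  | C => C ∈ t

/-- The set of inverses. -/
def invSet (ρ : Set (Role NR)) : Set (Role NR) := {R | R.Inv ∈ ρ}

@[simp] theorem mem_invSet {ρ : Set (Role NR)} {R : Role NR} : R ∈ invSet ρ ↔ R.Inv ∈ ρ := Iff.rfl

/-- The atomic roles over the signature `sig` that relate `x` to `y`. -/
def Interp.edge (I : Interp NC NR NI) (sig : Set NR) (x y : I.Domain) : Set (Role NR) :=
  {R | R.base ∈ sig ∧ I.role R x y}

theorem Interp.invSet_edge (I : Interp NC NR NI) (sig : Set NR) (x y : I.Domain) :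
    invSet (I.edge sig x y) = I.edge sig y x := by
  ext R; simp [Interp.edge]

theorem Interp.roleExpr_iff_derivable (I : Interp NC NR NI) {U : RoleExpr NR} {x y : I.Domain}
    {ρ : Set (Role NR)} (h : ∀ R ∈ U.roles, I.role R x y ↔ R ∈ ρ) :
    I.roleExpr U x y ↔ U.Derivable ρ := by
  induction U with
  | atom R => exact h R rfl
  | neg U ih => exact not_congr (ih h)
  | inter U V ihU ihV =>
    exact and_congr (ihU fun R hR => h R (.inl hR)) (ihV fun R hR => h R (.inr hR))
  | union U V ihU ihV =>
    exact or_congr (ihU fun R hR => h R (.inl hR)) (ihV fun R hR => h R (.inr hR))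

theorem Interp.roleExpr_iff_edge (I : Interp NC NR NI) {U : RoleExpr NR} {sig : Set NR}
    (hU : U.roleNames ⊆ sig) (x y : I.Domain) :
    I.roleExpr U x y ↔ U.Derivable (I.edge sig x y) :=
  I.roleExpr_iff_derivable fun R hR => (and_iff_right (hU ⟨R, hR, rfl⟩)).symm

/-- The data for an unravelling: an interpretation whose elements are all named, and a labelled
transition system of states with types. -/
structure Frame (NC NR NI : Type u) where
  base : Interp NC NR NI
  State : Type u
  st : base.Domain → State
  typ : State → Set (Concept NC NR)
  succ : State → Set (Role NR) → State → Prop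
  sig : Set NR
  surj : ∀ x, ∃ a, base.ind a = x
  succ_symm : ∀ s ρ s', succ s ρ s' → succ s' (invSet ρ) s
  succ_base : ∀ x y, succ (st x) (base.edge sig x y) (st y)

/-- Finite paths from a root. -/
inductive Tree (X L : Type u) : Type u
  | root (x : X)
  | child (p : Tree X L) (l : L)

/-- The length of a path. -/
def Tree.depth {X L : Type u} : Tree X L → ℕ
  | .root _ => 0
  | .child p _ => p.depth + 1

/-- Rules out that two paths are children of each other, so an edge of the forest has a unique
direction. -/
theorem Tree.child_child_ne {X L : Type u} (t : Tree X L) (l l' : L) :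
    Tree.child (Tree.child t l) l' ≠ t := fun h => by
  have := congrArg Tree.depth h
  simp only [Tree.depth] at this
  omega

/-- The root of a path. -/
def Tree.rt {X L : Type u} : Tree X L → Tree X L
  | .root x => .root x
  | .child p _ => p.rt

/-- The initial segment of length one of a path. -/
def Tree.top {X L : Type u} : Tree X L → Tree X L
  | .root x => .root x
  | .child (.root x) l => .child (.root x) l
  | .child (.child q l') _ => (Tree.child q l').top

namespace Frame

variable (F : Frame NC NR NI)

/-- The labels of path steps: the roles that hold between the elements and the type of the second
one. -/
abbrev Label (NC NR : Type u) : Type u := Set (Role NR) × Set (Concept NC NR)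

/-- The label is realized by a successor. -/
def Realized (s : F.State) (l : Label NC NR) : Prop := ∃ s', F.succ s l.1 s' ∧ F.typ s' = l.2

open Classical in
/-- A chosen successor. -/
noncomputable def rep (s : F.State) (l : Label NC NR) : F.State :=
  if h : F.Realized s l then h.choose else s

theorem rep_spec {s : F.State} {l : Label NC NR} (h : F.Realized s l) :
    F.succ s l.1 (F.rep s l) ∧ F.typ (F.rep s l) = l.2 := by
  unfold rep
  rw [dif_pos h]
  exact h.choose_spec

/-- Paths in the frame. -/
abbrev Path : Type u := Tree F.base.Domain (Label NC NR)

/-- The state at the end of a path. -/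
noncomputable def lab : F.Path → F.State
  | .root x => F.st x
  | .child p l => F.rep (lab p) l

/-- The label is already realized by a named element or by the predecessor. -/
def Back : F.Path → Label NC NR → Prop
  | .root x, l => ∃ y, l = (F.base.edge F.sig x y, F.typ (F.st y))
  | .child q l', l => l = (invSet l'.1, F.typ (F.lab q))

/-- The paths that are elements of the unravelling. -/
def Valid : F.Path → Prop
  | .root _ => True
  | .child p l => Valid p ∧ F.Realized (F.lab p) l ∧ ¬ F.Back p l

/-- The roles relating two paths. -/
def edge (t s : F.Path) : Set (Role NR) :=
  {R | (∃ x y, t = .root x ∧ s = .root y ∧ R ∈ F.base.edge F.sig x y) ∨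
    (∃ l, s = .child t l ∧ R ∈ l.1) ∨ ∃ l, t = .child s l ∧ R.Inv ∈ l.1}

theorem edge_root_root (x y : F.base.Domain) :
    F.edge (.root x) (.root y) = F.base.edge F.sig x y := by
  ext R
  constructor
  · rintro (⟨x', y', hx, hy, h⟩ | ⟨l, h, -⟩ | ⟨l, h, -⟩)
    · cases hx; cases hy; exact h
    · cases h
    · cases h
  · exact fun h => .inl ⟨x, y, rfl, rfl, h⟩

theorem edge_down (t : F.Path) (l : Label NC NR) : F.edge t (.child t l) = l.1 := by
  ext R
  constructor
  · rintro (⟨x', y', hx, hy, h⟩ | ⟨l', h, h'⟩ | ⟨l', h, -⟩)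
    · cases hy
    · cases h; exact h'
    · exact (Tree.child_child_ne _ _ _ h.symm).elim
  · exact fun h => .inr (.inl ⟨l, rfl, h⟩)

theorem edge_up (t : F.Path) (l : Label NC NR) : F.edge (.child t l) t = invSet l.1 := by
  ext R
  constructor
  · rintro (⟨x', y', hx, hy, h⟩ | ⟨l', h, h'⟩ | ⟨l', h, h'⟩)
    · cases hx
    · exact (Tree.child_child_ne _ _ _ h.symm).elim
    · cases h; exact h'
  · exact fun h => .inr (.inr ⟨l, rfl, h⟩)

theorem invSet_edge (t s : F.Path) : invSet (F.edge t s) = F.edge s t := by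
  ext R
  simp only [mem_invSet, edge, Set.mem_ofPred_eq, Role.Inv_Inv]
  rw [or_comm (a := ∃ l, s = Tree.child t l ∧ R.Inv ∈ l.1)]
  refine or_congr ⟨?_, ?_⟩ Iff.rfl
  · rintro ⟨x, y, hx, hy, h⟩
    exact ⟨y, x, hy, hx, by rw [← F.base.invSet_edge]; exact h⟩
  · rintro ⟨x, y, hx, hy, h⟩
    refine ⟨y, x, hy, hx, ?_⟩
    rw [← F.base.invSet_edge] at h
    exact h

theorem edge_cases {t s : F.Path} (h : (F.edge t s).Nonempty) :
    (∃ x y, t = .root x ∧ s = .root y) ∨ (∃ l, s = .child t l) ∨ ∃ l, t = .child s l := by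
  obtain ⟨R, ⟨x, y, hx, hy, -⟩ | ⟨l, hl, -⟩ | ⟨l, hl, -⟩⟩ := h
  · exact .inl ⟨x, y, hx, hy⟩
  · exact .inr (.inl ⟨l, hl⟩)
  · exact .inr (.inr ⟨l, hl⟩)

variable {F}

/-- Nonemptiness is essential: two paths that are not neighbours have the empty edge, and nothing
makes that a transition. -/
theorem succ_edge {t s : F.Path} (ht : F.Valid t) (hs : F.Valid s) (h : (F.edge t s).Nonempty) :
    F.succ (F.lab t) (F.edge t s) (F.lab s) := by
  obtain ⟨x, y, rfl, rfl⟩ | ⟨l, rfl⟩ | ⟨l, rfl⟩ := F.edge_cases h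
  · rw [edge_root_root]
    exact F.succ_base x y
  · rw [edge_down]
    exact (F.rep_spec hs.2.1).1
  · rw [edge_up]
    exact F.succ_symm _ _ _ (F.rep_spec ht.2.1).1

/-- If the label is blocked by `Back`, the named element or predecessor that blocks it is itself the
wanted neighbour; otherwise a child is created. Agreement is on edge and type only, not on the
state. -/
theorem exists_succ {t : F.Path} (ht : F.Valid t) {ρ : Set (Role NR)} {s' : F.State}
    (h : F.succ (F.lab t) ρ s') :
    ∃ s, F.Valid s ∧ F.edge t s = ρ ∧ F.typ (F.lab s) = F.typ s' := by
  by_cases hb : F.Back t (ρ, F.typ s')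
  · cases t with
    | root x =>
      obtain ⟨y, hy⟩ := hb
      simp only [Prod.mk.injEq] at hy
      exact ⟨.root y, trivial, by rw [edge_root_root, hy.1], hy.2.symm⟩
    | child q l =>
      have hb : _ = _ := hb
      simp only [Prod.mk.injEq] at hb
      exact ⟨q, ht.1, by rw [edge_up, hb.1], hb.2.symm⟩
  · have hr : F.Realized (F.lab t) (ρ, F.typ s') := ⟨s', h, rfl⟩
    exact ⟨.child t (ρ, F.typ s'), ⟨ht, hr, hb⟩, edge_down _ _ _, (F.rep_spec hr).2⟩

/-- The conditions producing witnesses assume that a state takes part in some transition; roots have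
their own loop and children the way back. -/
theorem live {t : F.Path} (ht : F.Valid t) : ∃ ρ s', F.succ (F.lab t) ρ s' := by
  cases t with
  | root x => exact ⟨_, _, F.succ_base x x⟩
  | child p l => exact ⟨_, _, F.succ_symm _ _ _ (F.rep_spec ht.2.1).1⟩

/-- Children of a path are distinguished by their labels, and `Back` forbids a child whose label
repeats that of a root neighbour or of the predecessor. The only remaining coincidence is between
two roots. -/
theorem eq_or_root {t s s' : F.Path} (ht : F.Valid t) (hs : F.Valid s) (hs' : F.Valid s')
    (h : (F.edge t s).Nonempty) (he : F.edge t s = F.edge t s')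
    (hl : F.typ (F.lab s) = F.typ (F.lab s')) :
    s = s' ∨ ∃ x y z, t = .root x ∧ s = .root y ∧ s' = .root z := by
  have h' : (F.edge t s').Nonempty := he ▸ h
  have typ_child : ∀ {p : F.Path} {l}, F.Valid (.child p l) → F.typ (F.lab (.child p l)) = l.2 :=
    fun h => (F.rep_spec h.2.1).2
  obtain ⟨x, y, rfl, rfl⟩ | ⟨l, rfl⟩ | ⟨l, rfl⟩ := F.edge_cases h
  · obtain ⟨x', z, hx, rfl⟩ | ⟨l, rfl⟩ | ⟨l, hl⟩ := F.edge_cases h'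
    · exact .inr ⟨x, y, z, rfl, rfl, rfl⟩
    · rw [edge_root_root, edge_down] at he
      rw [typ_child hs'] at hl
      exact (hs'.2.2 ⟨y, Prod.ext he.symm hl.symm⟩).elim
    · cases hl
  · obtain ⟨x', z, rfl, rfl⟩ | ⟨l', rfl⟩ | ⟨l', rfl⟩ := F.edge_cases h'
    · rw [edge_root_root, edge_down] at he
      rw [typ_child hs] at hl
      exact (hs.2.2 ⟨z, Prod.ext he hl⟩).elim
    · rw [edge_down, edge_down] at he
      rw [typ_child hs, typ_child hs'] at hl
      exact .inl (by rw [Prod.ext he hl])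
    · rw [edge_up, edge_down] at he
      rw [typ_child hs] at hl
      exact (hs.2.2 (Prod.ext he hl)).elim
  · obtain ⟨x', z, hx, rfl⟩ | ⟨l', rfl⟩ | ⟨l', hl'⟩ := F.edge_cases h'
    · cases hx
    · rw [edge_up, edge_down] at he
      rw [typ_child hs'] at hl
      exact (hs'.2.2 (Prod.ext he.symm hl.symm)).elim
    · cases hl'
      exact .inl rfl

variable (F)

/-- The concept name holds at the path. -/
def ConHolds (A : NC) : F.Path → Prop
  | .root x => x ∈ F.base.con A
  | .child p l => .name A ∈ F.typ (F.lab (.child p l))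

/-- The role name holds between the paths. -/
def RolHolds (r : NR) : F.Path → F.Path → Prop
  | .root x, .root y => F.base.rol r x y
  | .root x, .child q l => .name r ∈ F.edge (.root x) (.child q l)
  | .child p l, s => .name r ∈ F.edge (.child p l) s

/-- The unravelling. -/
def unravel : Interp NC NR NI where
  Domain := {t : F.Path // F.Valid t}
  ind a := ⟨.root (F.base.ind a), trivial⟩
  con A := {t | F.ConHolds A t.1}
  rol r t s := F.RolHolds r t.1 s.1

/-- On roots the unravelling copies `base` literally, also for names outside the signature and
outside the evaluated parts. -/
theorem namedEq_unravel : F.base.NamedEq F.unravel where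
  con _ _ := Iff.rfl
  rol _ _ _ := Iff.rfl
  eq a b := by
    refine ⟨fun h => Subtype.ext (congrArg Tree.root h), fun h => ?_⟩
    exact Tree.root.inj (congrArg Subtype.val h)

theorem rolHolds_iff {r : NR} (hr : r ∈ F.sig) (t s : F.Path) :
    F.RolHolds r t s ↔ .name r ∈ F.edge t s := by
  match t, s with
  | .root x, .root y =>
    rw [edge_root_root]
    exact (and_iff_right hr).symm
  | .root x, .child q l => exact Iff.rfl
  | .child p l, s => exact Iff.rfl

theorem role_iff {R : Role NR} (hR : R.base ∈ F.sig) (t s : F.unravel.Domain) :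
    F.unravel.role R t s ↔ R ∈ F.edge t.1 s.1 := by
  cases R with
  | name r => exact F.rolHolds_iff hR t.1 s.1
  | inv r =>
    rw [← F.invSet_edge]
    exact F.rolHolds_iff hR s.1 t.1

theorem roleExpr_iff {U : RoleExpr NR} (hU : U.roleNames ⊆ F.sig) (t s : F.unravel.Domain) :
    F.unravel.roleExpr U t s ↔ U.Derivable (F.edge t.1 s.1) :=
  F.unravel.roleExpr_iff_derivable fun R hR => F.role_iff (hU ⟨R, hR, rfl⟩) t s

theorem role_cases {R : Role NR} {t s : F.unravel.Domain} (h : F.unravel.role R t s) :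
    (∃ x y, t.1 = .root x ∧ s.1 = .root y) ∨ (∃ l, s.1 = .child t.1 l) ∨
      ∃ l, t.1 = .child s.1 l := by
  have key : ∀ {r : NR} {t s : F.Path}, F.RolHolds r t s →
      (∃ x y, t = .root x ∧ s = .root y) ∨ (∃ l, s = .child t l) ∨ ∃ l, t = .child s l := by
    intro r t s h
    match t, s with
    | .root x, .root y => exact .inl ⟨x, y, rfl, rfl⟩
    | .root x, .child q l => exact F.edge_cases ⟨_, h⟩
    | .child p l, s => exact F.edge_cases ⟨_, h⟩
  cases R with
  | name r => exact key h
  | inv r =>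
    obtain ⟨x, y, hx, hy⟩ | h | h := key h
    · exact .inl ⟨y, x, hy, hx⟩
    · exact .inr (.inr h)
    · exact .inr (.inl h)

/-- The conditions under which the parts in the set `P` are evaluated correctly. -/
structure Coherent (P : Set (Concept NC NR)) : Prop where
  shape : ∀ X ∈ P, X.RestrQ ∧ X.NumFree
  names : ∀ X ∈ P, X.roleNames ⊆ F.sig
  name : ∀ A, .name A ∈ P → ∀ x, x ∈ F.base.con A ↔ .name A ∈ F.typ (F.st x)
  all : ∀ U C, .all U C ∈ P → ∀ s ρ s', F.succ s ρ s' → .all U C ∈ F.typ s → U.Derivable ρ →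
    C.Holds (F.typ s')
  not_all : ∀ U C, .all U C ∈ P → ∀ s ρ₀ s₀, F.succ s ρ₀ s₀ → .all U C ∉ F.typ s →
    ∃ ρ s', F.succ s ρ s' ∧ U.Derivable ρ ∧ ¬ C.Holds (F.typ s')
  ex : ∀ U C, .ex U C ∈ P → ∀ s ρ₀ s₀, F.succ s ρ₀ s₀ → .ex U C ∈ F.typ s →
    ∃ ρ s', F.succ s ρ s' ∧ U.Derivable ρ ∧ C.Holds (F.typ s')
  not_ex : ∀ U C, .ex U C ∈ P → ∀ s ρ s', F.succ s ρ s' → U.Derivable ρ → C.Holds (F.typ s') →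
    .ex U C ∈ F.typ s

variable {F}

theorem _root_.DL.RoleExpr.Restricted.nonempty {U : RoleExpr NR} (hU : U.Restricted)
    {ρ : Set (Role NR)} (h : U.Derivable ρ) : ρ.Nonempty :=
  Set.nonempty_iff_ne_empty.2 fun h' => hU (h' ▸ h)

/-- The truth lemma: semantic truth at a path is the Boolean value of the concept in the type at its
end. Restrictedness makes every relevant pair of paths a transition, and `exists_succ` turns
witnessing transitions into neighbours. -/
theorem Coherent.mem_concept_iff {P : Set (Concept NC NR)} (hF : F.Coherent P)
    {C : Concept NC NR} (hC : C.parts ⊆ P) (t : F.unravel.Domain) :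
    t ∈ F.unravel.concept C ↔ C.Holds (F.typ (F.lab t.1)) := by
  induction C generalizing t with
  | name A =>
    obtain ⟨t, ht⟩ := t
    cases t with
    | root x => exact hF.name A (hC rfl) x
    | child p l => exact Iff.rfl
  | top => exact Iff.rfl
  | bot => exact Iff.rfl
  | neg C ih => exact not_congr (ih hC t)
  | inter C D ihC ihD =>
    exact and_congr (ihC (fun _ h => hC (.inl h)) t) (ihD (fun _ h => hC (.inr h)) t)
  | union C D ihC ihD =>
    exact or_congr (ihC (fun _ h => hC (.inl h)) t) (ihD (fun _ h => hC (.inr h)) t)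
  | all U C ih =>
    have hP := hC (Set.mem_union_left _ rfl)
    have hU : U.roleNames ⊆ F.sig := fun _ h => hF.names _ hP (.inl h)
    replace ih := ih fun _ h => hC (.inr h)
    constructor
    · intro h
      by_contra hno
      obtain ⟨ρ₀, s₀, h₀⟩ := live t.2
      obtain ⟨ρ, s', hs, hd, hn⟩ := hF.not_all U C hP _ ρ₀ s₀ h₀ hno
      obtain ⟨s, hv, rfl, ht⟩ := exists_succ t.2 hs
      rw [← ht, ← ih ⟨s, hv⟩] at hn
      exact hn (h ⟨s, hv⟩ ((F.roleExpr_iff hU _ _).2 hd))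
    · intro h s hs
      rw [F.roleExpr_iff hU] at hs
      exact (ih s).2 (hF.all U C hP _ _ _
        (succ_edge t.2 s.2 ((hF.shape _ hP).1.nonempty hs)) h hs)
  | ex U C ih =>
    have hP := hC (Set.mem_union_left _ rfl)
    have hU : U.roleNames ⊆ F.sig := fun _ h => hF.names _ hP (.inl h)
    replace ih := ih fun _ h => hC (.inr h)
    constructor
    · rintro ⟨s, hs, h⟩
      rw [F.roleExpr_iff hU] at hs
      exact hF.not_ex U C hP _ _ _
        (succ_edge t.2 s.2 ((hF.shape _ hP).1.nonempty hs)) hs ((ih s).1 h)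
    · intro h
      obtain ⟨ρ₀, s₀, h₀⟩ := live t.2
      obtain ⟨ρ, s', hs, hd, hn⟩ := hF.ex U C hP _ ρ₀ s₀ h₀ h
      obtain ⟨s, hv, rfl, ht⟩ := exists_succ t.2 hs
      rw [← ht, ← ih ⟨s, hv⟩] at hn
      exact ⟨⟨s, hv⟩, (F.roleExpr_iff hU _ _).2 hd, hn⟩
  | atMost n R C => exact (hF.shape _ (hC (Set.mem_union_left _ rfl))).2.elim
  | atLeast n R C => exact (hF.shape _ (hC (Set.mem_union_left _ rfl))).2.elim

end Frame

/-! #### Forest-like interpretations -/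

/-- The unnamed elements form trees: `rt` maps an element to the root of its tree, and `top` to
the child of the root through which it is reached. -/
def Interp.ForestLike (N : Interp NC NR NI) : Prop :=
  ∃ top rt : N.Domain → N.Domain, ∀ R t s, N.role R t s →
    (t ∈ Set.range N.ind ∧ s ∈ Set.range N.ind) ∨
    (t ∈ Set.range N.ind ∧ s ∉ Set.range N.ind ∧ top s = s ∧ rt s = t) ∨
    (t ∉ Set.range N.ind ∧ s ∈ Set.range N.ind ∧ top t = t ∧ rt t = s) ∨
    (t ∉ Set.range N.ind ∧ s ∉ Set.range N.ind ∧ top s = top t ∧ rt s = rt t)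

/-- Roots are exactly the named elements. A step inside a tree changes neither the root nor the
first segment of the path, and a tree is entered or left only through a child of its root. -/
theorem Frame.forestLike_unravel (F : Frame NC NR NI) : F.unravel.ForestLike := by
  have htop : ∀ t : F.Path, F.Valid t → F.Valid t.top := by
    intro t
    induction t with
    | root x => exact id
    | child p l ih =>
      cases p with
      | root x => exact id
      | child q l' => exact fun h => ih h.1
  have hrt : ∀ t : F.Path, F.Valid t → F.Valid t.rt := by
    intro t
    induction t with
    | root x => exact id
    | child p l ih => exact fun h => ih h.1
  have hroot : ∀ x h, (⟨.root x, h⟩ : F.unravel.Domain) ∈ Set.range F.unravel.ind := by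
    intro x h
    obtain ⟨a, rfl⟩ := F.surj x
    exact ⟨a, rfl⟩
  have hchild : ∀ p l h, (⟨.child p l, h⟩ : F.unravel.Domain) ∉ Set.range F.unravel.ind := by
    rintro p l h ⟨a, ha⟩
    cases congrArg Subtype.val ha
  refine ⟨fun t => ⟨t.1.top, htop _ t.2⟩, fun t => ⟨t.1.rt, hrt _ t.2⟩, ?_⟩
  rintro R ⟨t, ht⟩ ⟨s, hs⟩ h
  obtain ⟨x, y, hx, hy⟩ | ⟨l, hl⟩ | ⟨l, hl⟩ := F.role_cases h
  · obtain rfl : t = .root x := hx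
    obtain rfl : s = .root y := hy
    exact .inl ⟨hroot _ _, hroot _ _⟩
  · obtain rfl : s = .child t l := hl
    cases t with
    | root x => exact .inr (.inl ⟨hroot _ _, hchild _ _ _, rfl, rfl⟩)
    | child q l' => exact .inr (.inr (.inr ⟨hchild _ _ _, hchild _ _ _, rfl, rfl⟩))
  · obtain rfl : t = .child s l := hl
    cases s with
    | root x => exact .inr (.inr (.inl ⟨hchild _ _ _, hroot _ _, rfl, rfl⟩))
    | child q l' => exact .inr (.inr (.inr ⟨hchild _ _ _, hchild _ _ _, rfl, rfl⟩))

end Unravelling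

-- Named parts of interpretations

section Models

/-- The restriction of an interpretation to the named elements. -/
def Interp.named (I : Interp NC NR NI) : Interp NC NR NI where
  Domain := Set.range I.ind
  ind a := ⟨I.ind a, a, rfl⟩
  con A := {x | x.1 ∈ I.con A}
  rol r x y := I.rol r x.1 y.1

theorem Interp.namedEq_named (I : Interp NC NR NI) : I.NamedEq I.named :=
  ⟨fun _ _ => Iff.rfl, fun _ _ _ => Iff.rfl, fun _ _ => Subtype.mk_eq_mk.symm⟩

theorem Interp.named_surj (I : Interp NC NR NI) (x : I.named.Domain) : ∃ a, I.named.ind a = x := by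
  obtain ⟨_, a, rfl⟩ := x
  exact ⟨a, rfl⟩

theorem Interp.named_role (I : Interp NC NR NI) (R : Role NR) (x y : I.named.Domain) :
    I.named.role R x y ↔ I.role R x.1 y.1 := by cases R <;> rfl

theorem Concept.roleNames_of_mem_parts {C D : Concept NC NR} (h : D ∈ C.parts) :
    D.roleNames ⊆ C.roleNames := by
  induction C with
  | name A | top | bot => rw [Set.eq_of_mem_singleton h]
  | neg C ih => exact ih h
  | inter C C' ih ih' | union C C' ih ih' =>
    exact h.elim (fun h => (ih h).trans Set.subset_union_left)
      fun h => (ih' h).trans Set.subset_union_right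
  | all U C ih | ex U C ih | atMost n R C ih | atLeast n R C ih =>
    rcases h with rfl | h
    · exact subset_rfl
    · exact (ih h).trans Set.subset_union_right

/-! ### Models of flat TBoxes from dominoes -/

/-- The domino with the given types of its two sides and the given roles. -/
def domino (s : Set (Concept NC NR)) (ρ : Set (Role NR)) (s' : Set (Concept NC NR)) :
    Set (BVar NC NR) :=
  {v | match v with
    | .fst C => C ∈ s
    | .snd C => C ∈ s'
    | .role R => R ∈ ρ}

theorem eq_domino (V : Set (BVar NC NR)) :
    V = domino {C | .fst C ∈ V} {R | .role R ∈ V} {C | .snd C ∈ V} := by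
  ext v; cases v <;> rfl

theorem swapVars_domino (s : Set (Concept NC NR)) (ρ : Set (Role NR))
    (s' : Set (Concept NC NR)) : swapVars (domino s ρ s') = domino s' (invSet ρ) s := by
  ext v
  cases v with
  | role R =>
    simp only [swapVars, domino, Set.mem_union, Set.mem_ofPred_eq, reduceCtorEq, and_false,
      exists_false, BVar.role.injEq, false_or, or_false, mem_invSet]
    constructor
    · rintro ⟨S, hS, rfl⟩
      rwa [S.Inv_Inv]
    · exact fun h => ⟨R.Inv, h, R.Inv_Inv.symm⟩
  | fst C => simp [swapVars, domino]
  | snd C => simp [swapVars, domino]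

theorem RoleExpr.bfun_domino (U : RoleExpr NR) (s : Set (Concept NC NR)) (ρ : Set (Role NR))
    (s' : Set (Concept NC NR)) : U.bfun (domino s ρ s') ↔ U.Derivable ρ := by
  induction U with
  | atom R => exact Iff.rfl
  | neg U ih => exact not_congr ih
  | inter U V ihU ihV => exact and_congr ihU ihV
  | union U V ihU ihV => exact or_congr ihU ihV

theorem Concept.bfun_domino (C : Concept NC NR) (s : Set (Concept NC NR)) (ρ : Set (Role NR))
    (s' : Set (Concept NC NR)) : C.bfun (domino s ρ s') ↔ C.Holds s := by
  induction C with
  | neg C ih => exact not_congr ih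
  | inter C D ihC ihD => exact and_congr ihC ihD
  | union C D ihC ihD => exact or_congr ihC ihD
  | _ => exact Iff.rfl

/-- The role names of a TBox. -/
def tboxRoles (T : Set (Concept NC NR)) : Set NR := {r | ∃ C ∈ T, r ∈ C.roleNames}

/-- The domino is over the variables of `T`. -/
def IsDomino (T : Set (Concept NC NR)) (s : Set (Concept NC NR)) (ρ : Set (Role NR))
    (s' : Set (Concept NC NR)) : Prop :=
  s ⊆ parts T ∧ s' ⊆ parts T ∧ ∀ R ∈ ρ, R.base ∈ tboxRoles T

theorem domino_subset_vars {T : Set (Concept NC NR)} {s s' : Set (Concept NC NR)}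
    {ρ : Set (Role NR)} : domino s ρ s' ⊆ vars T ↔ IsDomino T s ρ s' := by
  constructor
  · refine fun h => ⟨fun C hC => ?_, fun C hC => ?_, fun R hR => ?_⟩
    · simpa [vars, roleVars] using h (show .fst C ∈ domino s ρ s' from hC)
    · simpa [vars, roleVars] using h (show .snd C ∈ domino s ρ s' from hC)
    · simpa [vars, roleVars, tboxRoles] using h (show .role R ∈ domino s ρ s' from hR)
  · rintro ⟨h1, h2, h3⟩ (R | C | C) hv
    · exact .inl (.inl ⟨R, h3 R hv, rfl⟩)
    · exact .inl (.inr ⟨C, h1 hv, rfl⟩)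
    · exact .inr ⟨C, h2 hv, rfl⟩

theorem fst_mem_successor_iff {T : Set (Concept NC NR)} {V V' : Set (BVar NC NR)}
    (h : V' ⊆ successorVars T) (C : Concept NC NR) :
    .fst C ∈ V' ∪ (V \ successorVars T) ↔ .fst C ∈ V := by
  have hC : BVar.fst C ∉ successorVars T := by
    rintro (⟨R, -, h⟩ | ⟨D, -, h⟩) <;> cases h
  constructor
  · rintro (h' | h')
    · exact (hC (h h')).elim
    · exact h'.1
  · exact fun h' => .inr ⟨h', hC⟩

theorem successorVars_subset (T : Set (Concept NC NR)) : successorVars T ⊆ vars T := by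
  rintro v (h | h)
  exacts [.inl (.inl h), .inr h]

theorem finite_tboxRoles {T : Set (Concept NC NR)} (hT : T.Finite) : (tboxRoles T).Finite :=
  (hT.biUnion fun C _ => C.finite_roleNames).subset fun _ ⟨_, hC, hr⟩ => Set.mem_biUnion hC hr

theorem finite_vars {T : Set (Concept NC NR)} (hT : T.Finite) : (vars T).Finite := by
  refine ((Set.Finite.subset ((finite_base_preimage (finite_tboxRoles hT)).image BVar.role)
    ?_).union ((finite_parts hT).image _)).union ((finite_parts hT).image _)
  rintro _ ⟨R, hR, rfl⟩
  exact ⟨R, hR, rfl⟩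

theorem stage_antitone (T : Set (Concept NC NR)) {i j : ℕ} (h : i ≤ j) {V : Set (BVar NC NR)}
    (hV : stage T j V) : stage T i V := by
  induction h with
  | refl => exact hV
  | step _ ih => exact ih hV.1

theorem tboxFun.swap {T : Set (Concept NC NR)} {V : Set (BVar NC NR)} (h : tboxFun T V) :
    tboxFun T (swapVars V) := fun i => (h (i + 1)).2.2.2

/-- There are only finitely many subsets `V`; beyond a common bound each one that fails some stage
has failed, so a witness for that bound works for all stages. -/
theorem exists_forall_of_antitone {α : Type*} {S : Set α} (hS : S.Finite)
    {φ : ℕ → Set α → Prop} (hφ : ∀ i j V, i ≤ j → φ j V → φ i V)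
    (h : ∀ i, ∃ V ⊆ S, φ i V) : ∃ V ⊆ S, ∀ i, φ i V := by
  by_contra! hno
  choose! n hn using hno
  obtain ⟨m, hm⟩ := (hS.finite_subsets.image n).bddAbove
  obtain ⟨V, hV, hm'⟩ := h m
  exact hn V hV (hφ _ _ _ (hm ⟨V, hV, rfl⟩) hm')

/-- The stages offer possibly different witnesses. Finiteness of the variable set makes one of them
serve all stages, which is where `tboxFun` as the limit becomes a fixpoint. -/
theorem tboxFun.exists_successor {T : Set (Concept NC NR)} (hT : T.Finite)
    {s s' : Set (Concept NC NR)} {ρ : Set (Role NR)} {Q : Set (BVar NC NR) → Prop}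
    (hd : IsDomino T s ρ s')
    (h : ∀ i, existsVars (successorVars T) (fun W => stage T i W ∧ Q W) (domino s ρ s')) :
    ∃ ρ' s'', IsDomino T s ρ' s'' ∧ tboxFun T (domino s ρ' s'') ∧ Q (domino s ρ' s'') := by
  obtain ⟨V, hV, hV'⟩ := exists_forall_of_antitone
    ((finite_vars hT).subset (successorVars_subset T))
    (φ := fun i V => stage T i (V ∪ (domino s ρ s' \ successorVars T)) ∧
      Q (V ∪ (domino s ρ s' \ successorVars T)))
    (fun i j V hij h => ⟨stage_antitone T hij h.1, h.2⟩) h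
  have he := eq_domino (V ∪ (domino s ρ s' \ successorVars T))
  have hs : {C | .fst C ∈ V ∪ (domino s ρ s' \ successorVars T)} = s :=
    Set.ext fun C => fst_mem_successor_iff hV C
  rw [hs] at he
  have hsub : V ∪ (domino s ρ s' \ successorVars T) ⊆ vars T :=
    Set.union_subset (hV.trans (successorVars_subset T))
      (Set.sdiff_subset.trans (domino_subset_vars.2 hd))
  rw [he] at hsub hV'
  exact ⟨_, _, domino_subset_vars.1 hsub, fun i => (hV' i).1, (hV' 0).2⟩

/-- A model of a flat TBox from dominoes for the pairs of named elements. -/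
theorem exists_model_of_dominoes {T : Set (Concept NC NR)} (hT : T.Finite)
    (hshape : ∀ X ∈ parts T, (X.RestrQ ∧ X.NumFree) ∧ X.BodyIn Concept.IsName)
    (B : Interp NC NR NI) (hB : ∀ x, ∃ a, B.ind a = x) (w : B.Domain → Set (Concept NC NR))
    (hw : ∀ x, w x ⊆ parts T) (hname : ∀ A, .name A ∈ parts T → ∀ x, x ∈ B.con A ↔ .name A ∈ w x)
    (hV : ∀ x y, tboxFun T (domino (w x) (B.edge (tboxRoles T) x y) (w y))) :
    ∃ M : Interp NC NR NI, (∀ C ∈ T, ∀ x, x ∈ M.concept C) ∧ B.NamedEq M := by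
  -- States are types and transitions are accepted dominoes. Inversion of transitions is the clause
  -- of `stage` about `swapVars`.
  let F : Frame NC NR NI :=
    { base := B
      State := Set (Concept NC NR)
      st := w
      typ := id
      succ := fun s ρ s' => IsDomino T s ρ s' ∧ tboxFun T (domino s ρ s')
      sig := tboxRoles T
      surj := hB
      succ_symm := by
        rintro s ρ s' ⟨⟨h1, h2, h3⟩, h⟩
        refine ⟨⟨h2, h1, fun R hR => ?_⟩, ?_⟩
        · rw [← R.base_Inv]; exact h3 _ hR
        · rw [← swapVars_domino]; exact h.swap
      succ_base := fun x y => ⟨⟨hw x, hw y, fun R hR => hR.1⟩, hV x y⟩ }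
  have body : ∀ {C : Concept NC NR} {t : Set (Concept NC NR)}, C.IsName → (C.Holds t ↔ C ∈ t) := by
    rintro _ t ⟨A, rfl⟩
    exact Iff.rfl
  have hF : F.Coherent (parts T) :=
    { shape := fun X hX => (hshape X hX).1
      names := fun X ⟨C, hC, hX⟩ r hr => ⟨C, hC, Concept.roleNames_of_mem_parts hX hr⟩
      name := hname
      all := by
        rintro U C hP s ρ s' ⟨-, h⟩ hs hU
        exact (body (hshape _ hP).2).2 ((h 0).2.1 U C hP ⟨hs, (U.bfun_domino ..).2 hU⟩)
      not_all := by
        rintro U C hP s ρ₀ s₀ ⟨hd, h⟩ hs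
        obtain ⟨ρ, s', h1, h2, h3, h4⟩ := tboxFun.exists_successor hT
          (Q := fun W => U.bfun W ∧ .snd C ∉ W) hd fun i => (h (i + 1)).2.2.1 U C hP hs
        exact ⟨ρ, s', ⟨h1, h2⟩, (U.bfun_domino ..).1 h3, fun h => h4 ((body (hshape _ hP).2).1 h)⟩
      ex := by
        rintro U C hP s ρ₀ s₀ ⟨hd, h⟩ hs
        obtain ⟨ρ, s', h1, h2, h3, h4⟩ := tboxFun.exists_successor hT
          (Q := fun W => U.bfun W ∧ .snd C ∈ W) hd fun i => (h (i + 1)).2.1 U C hP hs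
        exact ⟨ρ, s', ⟨h1, h2⟩, (U.bfun_domino ..).1 h3, (body (hshape _ hP).2).2 h4⟩
      not_ex := by
        rintro U C hP s ρ s' ⟨-, h⟩ hU hC
        exact (h 0).2.2 U C hP ⟨(body (hshape _ hP).2).1 hC, (U.bfun_domino ..).2 hU⟩ }
  refine ⟨F.unravel, fun C hC t => ?_, F.namedEq_unravel⟩
  obtain ⟨ρ, s', -, h⟩ := Frame.live t.2
  exact (hF.mem_concept_iff (fun X hX => ⟨C, hC, hX⟩) t).2
    ((C.bfun_domino ..).1 ((h 0).1 C hC))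

/-! ### Functional roles -/

/-- The parts in `P` that hold at an element. -/
def Interp.typeOf (M : Interp NC NR NI) (P : Set (Concept NC NR)) (x : M.Domain) :
    Set (Concept NC NR) := {D | D ∈ P ∧ x ∈ M.concept D}

theorem Interp.holds_typeOf (M : Interp NC NR NI) {P : Set (Concept NC NR)} {C : Concept NC NR}
    (hC : C.parts ⊆ P) (x : M.Domain) : C.Holds (M.typeOf P x) ↔ x ∈ M.concept C := by
  induction C with
  | top | bot => exact Iff.rfl
  | neg C ih => exact not_congr (ih hC)
  | inter C D ihC ihD =>
    exact and_congr (ihC fun _ h => hC (.inl h)) (ihD fun _ h => hC (.inr h))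
  | union C D ihC ihD =>
    exact or_congr (ihC fun _ h => hC (.inl h)) (ihD fun _ h => hC (.inr h))
  | name A => exact and_iff_right (hC rfl)
  | all U C | ex U C | atMost n R C | atLeast n R C => exact and_iff_right (hC (.inl rfl))

theorem parts_subset_of_all {T : Set (Concept NC NR)} {X D : Concept NC NR} (h : X ∈ parts T)
    (hD : D.parts ⊆ X.parts) : D.parts ⊆ parts T := by
  obtain ⟨C, hC, hX⟩ := h
  exact fun Y hY => ⟨C, hC, Concept.parts_trans hX (hD hY)⟩

/-- `M` is unravelled over its own elements, restarting from the named ones. Non-functionality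
axioms survive by the truth lemma; functionality holds because `Θ_F` forces all `R`-successors of an
element to carry the same label, and the unravelling has no two such neighbours apart from roots. -/
theorem UKB.exists_forest_model {K : UKB NC NR NI} (hr : K.rbox = ∅)
    (hshape : ∀ E ∈ K.nonFunctional, E.AllParts fun X => X.RestrQ ∧ X.NumFree)
    {M : Interp NC NR NI} (hM : K.thetaF.IsModel M) :
    ∃ N : Interp NC NR NI, K.IsModel N ∧ N.ForestLike ∧ M.NamedEq N := by
  let P := parts K.nonFunctional
  have hedge : ∀ x y, M.named.edge K.roleNames x y = M.edge K.roleNames x.1 y.1 := fun x y =>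
    Set.ext fun R => and_congr_right fun _ => M.named_role R x y
  let F : Frame NC NR NI :=
    { base := M.named
      State := M.Domain
      st := Subtype.val
      typ := M.typeOf P
      -- Any two elements are joined by a transition, labelled with the possibly empty set of roles
      -- that hold between them.
      succ := fun x ρ y => ρ = M.edge K.roleNames x y
      sig := K.roleNames
      surj := M.named_surj
      succ_symm := by
        rintro x _ y rfl
        exact M.invSet_edge _ _ _
      succ_base := hedge }
  have hnames : ∀ X ∈ P, X.roleNames ⊆ K.roleNames := fun X ⟨C, hC, hX⟩ r hr =>
    .inl ⟨C, hC.1, Concept.roleNames_of_mem_parts hX hr⟩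
  have hF : F.Coherent P :=
    { shape := fun X ⟨C, hC, hX⟩ => hshape C hC X hX
      names := hnames
      name := fun A hA x => (and_iff_right hA).symm
      all := by
        rintro U C hP x _ y rfl hx hU
        rw [← M.roleExpr_iff_edge fun _ h => hnames _ hP (.inl h)] at hU
        exact (M.holds_typeOf (parts_subset_of_all hP fun _ h => .inr h) y).2 (hx.2 y hU)
      not_all := by
        rintro U C hP x - - - hx
        have hx' : x ∉ M.concept (.all U C) := fun h => hx ⟨hP, h⟩
        obtain ⟨y, hy'⟩ := not_forall.1 hx'
        obtain ⟨hU, hy⟩ := Classical.not_imp.1 hy'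
        refine ⟨_, y, rfl, (M.roleExpr_iff_edge (fun _ h => hnames _ hP (.inl h)) x y).1 hU, ?_⟩
        exact fun h => hy ((M.holds_typeOf (parts_subset_of_all hP fun _ h => .inr h) y).1 h)
      ex := by
        rintro U C hP x - - - ⟨-, y, hU, hy⟩
        exact ⟨_, y, rfl, (M.roleExpr_iff_edge (fun _ h => hnames _ hP (.inl h)) x y).1 hU,
          (M.holds_typeOf (parts_subset_of_all hP fun _ h => .inr h) y).2 hy⟩
      not_ex := by
        rintro U C hP x _ y rfl hU hy
        rw [← M.roleExpr_iff_edge fun _ h => hnames _ hP (.inl h)] at hU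
        exact ⟨hP, y, hU,
          (M.holds_typeOf (parts_subset_of_all hP fun _ h => .inr h) y).1 hy⟩ }
  have heq : M.NamedEq F.unravel := M.namedEq_named.trans F.namedEq_unravel
  refine ⟨F.unravel, ⟨fun C hC t => ?_, by simp [hr], fun ρ hρ => ?_⟩, F.forestLike_unravel, heq⟩
  swap
  · exact heq.satRule (hM.2.2 ρ (.inl hρ))
  by_cases hfun : ∃ R, C = .atMost 1 R .top
  swap
  · push Not at hfun
    have hP : C.parts ⊆ P := fun X hX => ⟨C, ⟨hC, hfun⟩, hX⟩
    rw [hF.mem_concept_iff hP]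
    exact (M.holds_typeOf hP _).2 (hM.1 C (.inl (.inl ⟨hC, hfun⟩)) _)
  obtain ⟨R, rfl⟩ := hfun
  have hR : R.base ∈ K.roleNames := .inl ⟨_, hC, .inl rfl⟩
  rw [Interp.mem_atMost, Nat.cast_one, Set.encard_le_one_iff]
  rintro s s' ⟨hs, -⟩ ⟨hs', -⟩
  rw [F.role_iff hR] at hs hs'
  have e : F.edge t.1 s.1 = M.edge K.roleNames (F.lab t.1) (F.lab s.1) :=
    Frame.succ_edge t.2 s.2 ⟨R, hs⟩
  have e' : F.edge t.1 s'.1 = M.edge K.roleNames (F.lab t.1) (F.lab s'.1) :=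
    Frame.succ_edge t.2 s'.2 ⟨R, hs'⟩
  have hM1 : M.role R (F.lab t.1) (F.lab s.1) := by
    rw [e] at hs; exact hs.2
  have hM2 : M.role R (F.lab t.1) (F.lab s'.1) := by
    rw [e'] at hs'; exact hs'.2
  -- The axioms `∀(R⊓S).⊥ ⊔ ∀(R⊓¬S).⊥` make the connecting roles of both successors coincide.
  have hE : M.edge K.roleNames (F.lab t.1) (F.lab s.1) =
      M.edge K.roleNames (F.lab t.1) (F.lab s'.1) := by
    ext S
    refine and_congr_right fun hS => ?_
    have hax := hM.1 _ (.inr ⟨R, S, hC, hS, rfl⟩) (F.lab t.1)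
    rcases hax with h | h
    · exact ⟨fun h' => (h _ ⟨hM1, h'⟩).elim, fun h' => (h _ ⟨hM2, h'⟩).elim⟩
    · exact ⟨fun _ => by_contra fun h' => h _ ⟨hM2, h'⟩, fun _ => by_contra fun h' => h _ ⟨hM1, h'⟩⟩
  -- Likewise the axioms `∀R.¬D ⊔ ∀R.D` make their types coincide.
  have hT : M.typeOf P (F.lab s.1) = M.typeOf P (F.lab s'.1) := by
    ext D
    refine and_congr_right fun hD => ?_
    have hax := hM.1 _ (.inl (.inr ⟨R, D, hC, hD, rfl⟩)) (F.lab t.1)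
    rcases hax with h | h
    · exact ⟨fun h' => (h _ hM1 h').elim, fun h' => (h _ hM2 h').elim⟩
    · exact ⟨fun _ => h _ hM2, fun _ => h _ hM1⟩
  obtain he | ⟨x, y, z, hx, hy, hz⟩ :=
    Frame.eq_or_root t.2 s.2 s'.2 ⟨R, hs⟩ (e.trans (hE.trans e'.symm)) hT
  · exact Subtype.ext he
  · rw [hx, hy] at hM1
    rw [hx, hz] at hM2
    obtain ⟨a, rfl⟩ := M.named_surj x
    obtain ⟨b, rfl⟩ := M.named_surj y
    obtain ⟨c, rfl⟩ := M.named_surj z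
    -- Between named elements equal labels do not imply equality; here the functionality rule of
    -- `Θ_F` is applied to constants.
    have hrule := (M.satRule_iff _).1 (hM.2.2 _ (.inr ⟨R, hC, rfl⟩)) fun v =>
      if v = 0 then a else if v = 1 then b else c
    simp only [List.mem_cons, List.not_mem_nil, or_false, forall_eq_or_imp, forall_eq,
      Interp.ground_roleAtom] at hrule
    have hbc : M.ind b = M.ind c := (hrule ⟨hM1, hM2⟩).2
    refine Subtype.ext (hy.trans (Eq.trans ?_ hz.symm))
    exact congrArg Tree.root (Subtype.ext hbc)

/-! ### Transitive roles -/

theorem SubRole.nonSimple {rbox : Set (RoleAxiom NR)} {R S : Role NR} (h : SubRole rbox R S) :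
    NonSimple rbox R → NonSimple rbox S := by
  induction h with
  | refl => exact id
  | incl _ h => exact .incl h
  | inclInv hR h => exact fun _ => .inv (.incl h hR)
  | trans _ _ ih ih' => exact fun h => ih' (ih h)

theorem SubRole.inv {rbox : Set (RoleAxiom NR)} {R S : Role NR} (h : SubRole rbox R S) :
    SubRole rbox R.Inv S.Inv := by
  induction h with
  | refl h => exact .refl (.inv h)
  | incl hR h => exact .inclInv hR h
  | inclInv hR h => rw [Role.Inv_Inv, Role.Inv_Inv]; exact .incl hR h
  | trans _ _ ih ih' => exact .trans ih ih'

theorem SubRole.role {rbox : Set (RoleAxiom NR)} {N : Interp NC NR NI}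
    (hN : ∀ U V, RoleAxiom.incl U V ∈ rbox → N.SatRoleAxiom (.incl U V)) {R S : Role NR}
    (h : SubRole rbox R S) {x y : N.Domain} : N.role R x y → N.role S x y := by
  induction h generalizing x y with
  | refl => exact id
  | incl _ h => exact hN _ _ h x y
  | inclInv _ h =>
    rw [Interp.role_Inv, Interp.role_Inv]
    exact hN _ _ h y x
  | trans _ _ ih ih' => exact fun h => ih' (ih h)

theorem KnowledgeBase.Transitive.inv {K : KnowledgeBase NC NR NI} {R : Role NR}
    (h : K.Transitive R) : K.Transitive R.Inv := by
  unfold KnowledgeBase.Transitive at *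
  rw [Role.Inv_Inv]
  exact h.symm

theorem KnowledgeBase.Transitive.nonSimple {K : KnowledgeBase NC NR NI} {R : Role NR}
    (h : K.Transitive R) : NonSimple K.rbox R := by
  rcases h with h | h
  · exact .trans h
  · rw [← R.Inv_Inv]; exact .inv (.trans h)

/-- The roles of `N` extended by the transitive closures of the transitive subroles. -/
def KnowledgeBase.closedRole (K : KnowledgeBase NC NR NI) (N : Interp NC NR NI) (R : Role NR)
    (x y : N.Domain) : Prop :=
  N.role R x y ∨ ∃ S, K.Transitive S ∧ SubRole K.rbox S R ∧ Relation.TransGen (N.role S) x y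

/-- The interpretation with transitively closed roles. -/
def KnowledgeBase.closure (K : KnowledgeBase NC NR NI) (N : Interp NC NR NI) : Interp NC NR NI :=
  N.withNames N.con fun r => K.closedRole N (.name r)

theorem Interp.transGen_role_Inv (N : Interp NC NR NI) {R : Role NR} {x y : N.Domain}
    (h : Relation.TransGen (N.role R) x y) : Relation.TransGen (N.role R.Inv) y x := by
  induction h with
  | single h => exact .single ((N.role_Inv ..).2 h)
  | tail _ h ih => exact .head ((N.role_Inv ..).2 h) ih

theorem KnowledgeBase.closedRole_Inv {K : KnowledgeBase NC NR NI} {N : Interp NC NR NI}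
    {R : Role NR} {x y : N.Domain} (h : K.closedRole N R x y) : K.closedRole N R.Inv y x := by
  rcases h with h | ⟨S, h1, h2, h3⟩
  · exact .inl ((N.role_Inv ..).2 h)
  · exact .inr ⟨S.Inv, h1.inv, h2.inv, N.transGen_role_Inv h3⟩

theorem KnowledgeBase.closure_role (K : KnowledgeBase NC NR NI) (N : Interp NC NR NI) (R : Role NR)
    (x y : N.Domain) : (K.closure N).role R x y ↔ K.closedRole N R x y := by
  cases R with
  | name r => exact Iff.rfl
  | inv r => exact ⟨fun h => K.closedRole_Inv h, fun h => K.closedRole_Inv h⟩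

/-- A transitive subrole would make `R` non-simple, so the closure adds nothing to a simple role. -/
theorem KnowledgeBase.closedRole_iff_of_simple {K : KnowledgeBase NC NR NI} {N : Interp NC NR NI}
    {R : Role NR} (hR : ¬ NonSimple K.rbox R) {x y : N.Domain} :
    K.closedRole N R x y ↔ N.role R x y :=
  ⟨fun h => h.elim id fun ⟨_, h1, h2, _⟩ => (hR (h2.nonSimple h1.nonSimple)).elim, .inl⟩

theorem KnowledgeBase.closure_roleExpr (K : KnowledgeBase NC NR NI) (N : Interp NC NR NI)
    {U : RoleExpr NR} (hU : U.Simple K.rbox) (x y : N.Domain) :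
    (K.closure N).roleExpr U x y ↔ N.roleExpr U x y := by
  exact ((K.closure N).roleExpr_iff_derivable (ρ := {R | N.role R x y}) fun R hR =>
    (K.closure_role N R x y).trans (closedRole_iff_of_simple (hU R hR))).trans
    (N.roleExpr_iff_derivable (ρ := {R | N.role R x y}) fun R _ => Iff.rfl).symm

theorem KnowledgeBase.closure_of_roleExpr (K : KnowledgeBase NC NR NI) (N : Interp NC NR NI)
    {U : RoleExpr NR} (hU : U.Admissible K.rbox) {x y : N.Domain} (h : N.roleExpr U x y) :
    (K.closure N).roleExpr U x y := by
  rcases hU.2 with ⟨R, rfl⟩ | hU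
  · exact (K.closure_role N R x y).2 (.inl h)
  · exact (K.closure_roleExpr N hU x y).2 h

/-- Closing roles only adds pairs, so among normal forms only `∀` and `≤` could become false. Number
restrictions and complex role expressions use simple roles, which do not change; for `∀R.D` the
added pairs come from paths of a transitive subrole `S`, handled by the `Θ_S` axiom for `∀S.D`. Only
concepts in the closure are covered, so that this axiom is available. -/
theorem KnowledgeBase.closure_concept {K : KnowledgeBase NC NR NI} {self : Role NR → NC}
    {N : Interp NC NR NI} (hN : (K.thetaS self).IsModel N) {C : Concept NC NR}
    (hC : C.Admissible K.rbox) :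
    (K.Cl C.nnf → ∀ x : N.Domain, x ∈ N.concept C.nnf → x ∈ (K.closure N).concept C.nnf) ∧
    (K.Cl C.nnfNeg → ∀ x : N.Domain, x ∈ N.concept C.nnfNeg →
      x ∈ (K.closure N).concept C.nnfNeg) := by
  have hincl : ∀ U V, RoleAxiom.incl U V ∈ K.rbox → N.SatRoleAxiom (.incl U V) := fun U V h =>
    hN.2.1 _ ⟨h, U, V, rfl⟩
  have hall : ∀ {U : RoleExpr NR} {D : Concept NC NR}, U.Admissible K.rbox → K.Cl (.all U D) →
      (∀ x : N.Domain, x ∈ N.concept D → x ∈ (K.closure N).concept D) →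
      ∀ x : N.Domain, x ∈ N.concept (.all U D) → x ∈ (K.closure N).concept (.all U D) := by
    intro U D hU hcl ih x hx y hy
    rcases hU.2 with ⟨R, rfl⟩ | hU
    · rcases (K.closure_role N R x y).1 hy with hy | ⟨S, hS, hSR, hpath⟩
      · exact ih y (hx y hy)
      · have hclS : K.Cl (.all (.atom S) D) := .trans hS hSR hcl
        have hx' : x ∈ N.concept (.all (.atom S) D) := fun z hz => hx z (hSR.role hincl hz)
        have hax : ∀ z, z ∈ N.concept (.all (.atom S) D) →
            z ∈ N.concept (.all (.atom S) (.all (.atom S) D)) := fun z hz =>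
          (hN.1 _ ⟨_, .inl (.inr ⟨S, D, hS, hclS, rfl⟩), rfl⟩ z).resolve_left (not_not.2 hz)
        -- The induction along the path must carry `∀S.D` as well as `D`; each step passes both on.
        have key : y ∈ N.concept D ∧ y ∈ N.concept (.all (.atom S) D) := by
          induction hpath with
          | single h => exact ⟨hx' _ h, hax x hx' _ h⟩
          | tail hp h ih' =>
            obtain ⟨-, h2⟩ := ih' ((K.closure_role N R _ _).2 (.inr ⟨S, hS, hSR, hp⟩))
            exact ⟨h2 _ h, hax _ h2 _ h⟩
        exact ih y key.1
    · exact ih y (hx y ((K.closure_roleExpr N hU x y).1 hy))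
  have hex : ∀ {U : RoleExpr NR} {D : Concept NC NR}, U.Admissible K.rbox →
      (∀ x : N.Domain, x ∈ N.concept D → x ∈ (K.closure N).concept D) →
      ∀ x : N.Domain, x ∈ N.concept (.ex U D) → x ∈ (K.closure N).concept (.ex U D) :=
    fun hU ih x ⟨y, hy, hD⟩ => ⟨y, K.closure_of_roleExpr N hU hy, ih y hD⟩
  have hge : ∀ {n : ℕ} {R : Role NR} {D : Concept NC NR},
      (∀ x : N.Domain, x ∈ N.concept D → x ∈ (K.closure N).concept D) →
      ∀ x : N.Domain, x ∈ N.concept (.atLeast n R D) → x ∈ (K.closure N).concept (.atLeast n R D) :=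
    fun {n R D} ih x hx => le_trans hx (Set.encard_le_encard fun y (hy : _ ∧ _) =>
      And.intro ((K.closure_role N R x y).2 (.inl hy.1)) (ih y hy.2))
  have hle : ∀ {n : ℕ} {R : Role NR} {D : Concept NC NR}, ¬ NonSimple K.rbox R →
      (∀ x : N.Domain, x ∈ N.concept D.nnfNeg → x ∈ (K.closure N).concept D.nnfNeg) →
      ∀ x : N.Domain, x ∈ N.concept (.atMost n R D) → x ∈ (K.closure N).concept (.atMost n R D) :=
    fun {n R D} hR ih x hx => le_trans (Set.encard_le_encard fun y (hy : _ ∧ _) =>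
      And.intro ((closedRole_iff_of_simple hR).1 ((K.closure_role N R x y).1 hy.1)) (by
        by_contra hno
        exact ((K.closure N).mem_nnfNeg D y).1 (ih y ((N.mem_nnfNeg D y).2 hno)) hy.2)) hx
  induction C with
  | name A | top | bot => exact ⟨fun _ _ h => h, fun _ _ h => h⟩
  | neg C ih => exact (ih hC).symm
  | inter C D ihC ihD =>
    refine ⟨fun hcl x hx => ?_, fun hcl x hx => ?_⟩
    · exact ⟨(ihC hC.1).1 (hcl.sub (.inl rfl)) x hx.1, (ihD hC.2).1 (hcl.sub (.inr rfl)) x hx.2⟩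
    · exact hx.imp ((ihC hC.1).2 (hcl.sub (.inl rfl)) x) ((ihD hC.2).2 (hcl.sub (.inr rfl)) x)
  | union C D ihC ihD =>
    refine ⟨fun hcl x hx => ?_, fun hcl x hx => ?_⟩
    · exact hx.imp ((ihC hC.1).1 (hcl.sub (.inl rfl)) x) ((ihD hC.2).1 (hcl.sub (.inr rfl)) x)
    · exact ⟨(ihC hC.1).2 (hcl.sub (.inl rfl)) x hx.1, (ihD hC.2).2 (hcl.sub (.inr rfl)) x hx.2⟩
  | all U C ih =>
    exact ⟨fun hcl => hall hC.1 hcl ((ih hC.2).1 (hcl.sub rfl)),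
      fun hcl => hex hC.1 ((ih hC.2).2 (hcl.sub rfl))⟩
  | ex U C ih =>
    exact ⟨fun hcl => hex hC.1 ((ih hC.2).1 (hcl.sub rfl)),
      fun hcl => hall hC.1 hcl ((ih hC.2).2 (hcl.sub rfl))⟩
  | atMost n R C ih =>
    refine ⟨fun hcl => hle hC.1 ?_, fun hcl => hge ((ih hC.2).1 (hcl.sub rfl))⟩
    -- The filler is `C.nnf`, whose negated normal form must be recognized as `C.nnfNeg` to use the
    -- second half of the induction hypothesis.
    rw [(nnf_nnf_and C).2.1]
    exact (ih hC.2).2 ((nnf_nnf_and C).2.1 ▸ hcl.atMost)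
  | atLeast n R C ih =>
    refine ⟨fun hcl => hge ((ih hC.2).1 (hcl.sub rfl)), fun hcl => hle hC.1 ?_⟩
    rw [(nnf_nnf_and C).2.1]
    exact (ih hC.2).2 ((nnf_nnf_and C).2.1 ▸ hcl.atMost)

theorem KnowledgeBase.Transitive.named_trans {K : KnowledgeBase NC NR NI} {self : Role NR → NC}
    {N : Interp NC NR NI} (hN : (K.thetaS self).IsModel N) {R : Role NR} (hR : K.Transitive R)
    {a b c : NI} (h : N.role R (N.ind a) (N.ind b)) (h' : N.role R (N.ind b) (N.ind c)) :
    N.role R (N.ind a) (N.ind c) := by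
  have hrule := (N.satRule_iff _).1 (hN.2.2 _ (.inr ⟨R, hR, rfl⟩)) fun v =>
    if v = 0 then a else if v = 1 then b else c
  simp only [List.mem_cons, List.not_mem_nil, or_false, forall_eq_or_imp, forall_eq,
    Interp.ground_roleAtom] at hrule
  exact (hrule ⟨h, h'⟩).2

/-- The intermediate element may be unnamed, where the transitivity rule is powerless; the TBox
axiom records the detour as `Self_R` at the named element, and the rule for `Self_R` yields the
loop. -/
theorem KnowledgeBase.Transitive.named_self {K : KnowledgeBase NC NR NI} {self : Role NR → NC}
    {N : Interp NC NR NI} (hN : (K.thetaS self).IsModel N) {R : Role NR} (hR : K.Transitive R)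
    {a : NI} {y : N.Domain} (h : N.role R (N.ind a) y) (h' : N.role R y (N.ind a)) :
    N.role R (N.ind a) (N.ind a) := by
  have hs : N.ind a ∈ N.con (self R) :=
    (hN.1 _ ⟨_, .inr ⟨R, hR, rfl⟩, rfl⟩ (N.ind a)).resolve_left
      (not_not.2 ⟨y, ⟨h, (N.role_Inv ..).2 h'⟩, trivial⟩)
  have hrule := (N.satRule_iff _).1 (hN.2.2 _ (.inl (.inr ⟨R, hR, rfl⟩))) fun _ => a
  simp only [List.mem_cons, List.not_mem_nil, or_false, forall_eq,
    Interp.ground_roleAtom] at hrule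
  exact (hrule hs).2

/-- The path is cut at its visits to named elements. Steps between named elements compose by the
transitivity rule; an excursion into a tree returns to its root and can be dropped, except when it
starts and ends at `a` itself, where it is replaced by the loop from `Self_R`. -/
theorem KnowledgeBase.Transitive.named_transGen {K : KnowledgeBase NC NR NI}
    {self : Role NR → NC} {N : Interp NC NR NI} (hN : (K.thetaS self).IsModel N)
    (hforest : N.ForestLike) {R : Role NR} (hR : K.Transitive R) {a b : NI}
    (h : Relation.TransGen (N.role R) (N.ind a) (N.ind b)) :
    N.role R (N.ind a) (N.ind b) := by
  obtain ⟨top, rt, hcases⟩ := hforest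
  -- While the path is inside a tree, the invariant remembers the edge through which the tree was
  -- entered and that its root is `a` or an `R`-successor of `a`.
  have key : ∀ t, Relation.TransGen (N.role R) (N.ind a) t →
      (t ∈ Set.range N.ind → N.role R (N.ind a) t) ∧
      (t ∉ Set.range N.ind → rt t ∈ Set.range N.ind ∧ N.role R (rt t) (top t) ∧
        (rt t = N.ind a ∨ N.role R (N.ind a) (rt t))) := by
    intro t ht
    induction ht with
    | single h =>
      refine ⟨fun _ => h, fun hn => ?_⟩
      rcases hcases R _ _ h with h1 | ⟨h1, -, h3, h4⟩ | ⟨h1, -⟩ | ⟨h1, -⟩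
      · exact (hn h1.2).elim
      · rw [h3, h4]
        exact ⟨h1, h, .inl rfl⟩
      · exact (h1 ⟨a, rfl⟩).elim
      · exact (h1 ⟨a, rfl⟩).elim
    | @tail t s _ h ih =>
      rcases hcases R _ _ h with ⟨⟨b, rfl⟩, h2⟩ | ⟨h1, h2, h3, h4⟩ | ⟨h1, h2, h3, h4⟩ |
        ⟨h1, h2, h3, h4⟩
      · refine ⟨fun _ => ?_, fun hn => (hn h2).elim⟩
        obtain ⟨c, rfl⟩ := h2
        exact hR.named_trans hN (ih.1 ⟨b, rfl⟩) h
      · refine ⟨fun hs => (h2 hs).elim, fun _ => ?_⟩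
        rw [h3, h4]
        exact ⟨h1, h, .inr (ih.1 h1)⟩
      · refine ⟨fun _ => ?_, fun hn => (hn h2).elim⟩
        -- Leaving the tree uses the same child as entering it, so `h5` and `h` go forth and back
        -- between that child and the root.
        obtain ⟨-, h5, h6⟩ := ih.2 h1
        rw [h3, h4] at h5
        rw [h4] at h6
        rcases h6 with rfl | h6
        · exact hR.named_self hN h5 h
        · exact h6
      · refine ⟨fun hs => (h2 hs).elim, fun _ => ?_⟩
        rw [h3, h4]
        exact ih.2 h1
  exact (key _ h).1 ⟨b, rfl⟩

/-- Agreement on named elements comes first, as it takes care of the rules. A non-simple left-hand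
side of an inclusion forces both sides to be atomic, and then `⊑*` absorbs the inclusion; other
left-hand sides are unchanged by the closure. -/
theorem KnowledgeBase.closure_models {K : KnowledgeBase NC NR NI} (hK : K.IsSHIQbs)
    {self : Role NR → NC} {N : Interp NC NR NI} (hN : (K.thetaS self).IsModel N)
    (hforest : N.ForestLike) : (K.closure N).Models K ∧ N.NamedEq (K.closure N) := by
  have hincl : ∀ U V, RoleAxiom.incl U V ∈ K.rbox → N.SatRoleAxiom (.incl U V) := fun U V h =>
    hN.2.1 _ ⟨h, U, V, rfl⟩
  have heq : N.NamedEq (K.closure N) := by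
    refine ⟨fun _ _ => Iff.rfl, fun r a b => ⟨fun h => .inl h, ?_⟩, fun _ _ => Iff.rfl⟩
    rintro (h | ⟨S, hS, hSr, h⟩)
    · exact h
    · exact hSr.role hincl (hS.named_transGen hN hforest h)
  have hinclC : ∀ {R S : Role NR} {x y : N.Domain},
      RoleAxiom.incl (.atom R) (.atom S) ∈ K.rbox → K.closedRole N R x y → K.closedRole N S x y := by
    rintro R S x y h (h' | ⟨T, hT, hTR, h'⟩)
    · exact .inl (hincl _ _ h x y h')
    · exact .inr ⟨T, hT, hTR.trans (.incl (hTR.nonSimple hT.nonSimple) h), h'⟩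
  have htransC : ∀ {R : Role NR} {x y z : N.Domain}, K.Transitive R →
      K.closedRole N R x y → K.closedRole N R y z → K.closedRole N R x z := by
    intro R x y z hR h h'
    -- Pairs contributed by a subrole are also connected by a path of `R` itself, as the inclusions
    -- hold in `N`; for transitive `R` the joined path is again admitted, with `R` as its own
    -- subrole.
    have key : ∀ {x y}, K.closedRole N R x y → Relation.TransGen (N.role R) x y := by
      rintro x y (h | ⟨S, -, hSR, h⟩)
      · exact .single h
      · exact Relation.TransGen.mono (fun _ _ => hSR.role hincl) _ _ h
    exact .inr ⟨R, hR, .refl hR.nonSimple, (key h).trans (key h')⟩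
  refine ⟨⟨fun g hg x hx => ?_, ?_, fun ρ hρ => ?_⟩, heq⟩
  · have h1 := (KnowledgeBase.closure_concept hN (C := g.toConcept) (hK.concepts g hg)).1
      (.gci hg) x
    rw [Interp.concept_nnf, Interp.concept_nnf] at h1
    exact (h1 (hN.1 _ ⟨g, .inl (.inl hg), rfl⟩ x)).resolve_left (not_not.2 hx)
  · rintro (⟨U, V⟩ | R) hα
    · intro x y hxy
      obtain ⟨hU, hV⟩ := hK.inclusions U V hα
      have hsimple : U.Simple K.rbox → (K.closure N).roleExpr V x y := fun h =>
        K.closure_of_roleExpr N hV (hincl U V hα x y ((K.closure_roleExpr N h x y).1 hxy))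
      rcases hK.inclusions_simple U V hα with ⟨S, rfl⟩ | h
      · rcases hU.2 with ⟨R, rfl⟩ | h
        · exact (K.closure_role N S x y).2 (hinclC hα ((K.closure_role N R x y).1 hxy))
        · exact hsimple h
      · exact hsimple h
    · intro x y z hxy hyz
      exact (K.closure_role N R x z).2 (htransC (.inl hα) ((K.closure_role N R x y).1 hxy)
        ((K.closure_role N R y z).1 hyz))
  · exact heq.satRule (hN.2.2 ρ (.inl (.inl hρ)))

end Models

/-! ### Binary decision diagrams -/

section Diagrams

/-- The diagram that tests the variables `v 0, …, v (n-1)` in this order. -/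
def decisionNode {n : ℕ} (φ : Finset (Fin n) → Bool) (k : ℕ) (s : Finset (Fin n)) :
    Bool ⊕ (Fin n × Finset (Fin n)) :=
  if h : k < n then .inr (⟨k, h⟩, s) else .inl (φ s)

/-- The position of a node in the order of the tests. -/
def decisionRank {n : ℕ} : Bool ⊕ (Fin n × Finset (Fin n)) → ℕ
  | .inl _ => n
  | .inr p => p.1

theorem decisionRank_node {n : ℕ} (φ : Finset (Fin n) → Bool) {k : ℕ} (hk : k ≤ n)
    (s : Finset (Fin n)) : decisionRank (decisionNode φ k s) = k := by
  unfold decisionNode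
  split
  · rfl
  · simp only [decisionRank]; omega

/-- The complete ordered decision diagram of a Boolean function. -/
def decisionDiagram {Var : Type u} {n : ℕ} (φ : Finset (Fin n) → Bool) (v : Fin n → Var)
    (default : Var) : BDD (Bool ⊕ (Fin n × Finset (Fin n))) Var where
  root := decisionNode φ 0 ∅
  true_ := .inl true
  false_ := .inl false
  low m := match m with
    | .inl b => .inl b
    | .inr p => decisionNode φ (p.1 + 1) p.2
  high m := match m with
    | .inl b => .inl b
    | .inr p => decisionNode φ (p.1 + 1) (insert p.1 p.2)
  label m := match m with
    | .inl _ => default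
    | .inr p => v p.1
  node_finite := inferInstance
  true_ne_false := by simp
  acyclic := by
    intro m h
    have key : ∀ {m m' : Bool ⊕ (Fin n × Finset (Fin n))}, Relation.TransGen
        (fun m m' => (m ≠ .inl true ∧ m ≠ .inl false) ∧ (m' = (match m with
          | .inl b => .inl b
          | .inr p => decisionNode φ (p.1 + 1) p.2) ∨ m' = (match m with
          | .inl b => .inl b
          | .inr p => decisionNode φ (p.1 + 1) (insert p.1 p.2)))) m m' →
        decisionRank m < decisionRank m' := by
      intro m m' h
      have step : ∀ {m m' : Bool ⊕ (Fin n × Finset (Fin n))},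
          (m ≠ .inl true ∧ m ≠ .inl false) ∧ (m' = (match m with
          | .inl b => .inl b
          | .inr p => decisionNode φ (p.1 + 1) p.2) ∨ m' = (match m with
          | .inl b => .inl b
          | .inr p => decisionNode φ (p.1 + 1) (insert p.1 p.2))) →
          decisionRank m < decisionRank m' := by
        rintro (b | ⟨k, s⟩) m' ⟨h, h'⟩
        · cases b
          · exact (h.2 rfl).elim
          · exact (h.1 rfl).elim
        · rcases h' with rfl | rfl <;>
            · simp only [decisionRank_node φ (Nat.succ_le_of_lt k.2)]
              exact Nat.lt_succ_self _
      induction h with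
      | single h => exact step h
      | tail _ h ih => exact ih.trans (step h)
    exact lt_irrefl _ (key h)

theorem BDD.not_accepts_false {Node : Type} {Var : Type u} (O : BDD Node Var) (V : Set Var)
    {m : Node} (h : O.Accepts V m) : m ≠ O.false_ := by
  cases h with
  | terminal => exact O.true_ne_false
  | high h => exact h.2
  | low h => exact h.2

theorem BDD.accepts_high {Node : Type} {Var : Type u} (O : BDD Node Var) {V : Set Var}
    {m : Node} (hm : O.Inner m) (hV : O.label m ∈ V) :
    O.Accepts V m ↔ O.Accepts V (O.high m) := by
  refine ⟨fun h => ?_, .high hm hV⟩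
  cases h with
  | terminal => exact (hm.1 rfl).elim
  | high _ _ h => exact h
  | low _ h => exact (h hV).elim

theorem BDD.accepts_low {Node : Type} {Var : Type u} (O : BDD Node Var) {V : Set Var}
    {m : Node} (hm : O.Inner m) (hV : O.label m ∉ V) :
    O.Accepts V m ↔ O.Accepts V (O.low m) := by
  refine ⟨fun h => ?_, .low hm hV⟩
  cases h with
  | terminal => exact (hm.1 rfl).elim
  | high _ h => exact (hV h).elim
  | low _ _ h => exact h

open Classical in
-- The set `s` stores which of the first `k` variables were found true; the remaining tests add
-- exactly the later variables in `V`.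
theorem accepts_decisionNode {Var : Type u} {n : ℕ} (φ : Finset (Fin n) → Bool) (v : Fin n → Var)
    (default : Var) (V : Set Var) (k : ℕ) (hk : k ≤ n) (s : Finset (Fin n)) :
    (decisionDiagram φ v default).Accepts V (decisionNode φ k s) ↔
      φ (s ∪ Finset.univ.filter fun i => k ≤ i.1 ∧ v i ∈ V) = true := by
  induction hd : n - k generalizing k s with
  | zero =>
    have hn : ¬ k < n := by omega
    have hs : (s ∪ Finset.univ.filter fun i : Fin n => k ≤ i.1 ∧ v i ∈ V) = s := by
      rw [Finset.union_eq_left]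
      intro i hi
      have := (Finset.mem_filter.1 hi).2.1
      omega
    rw [hs, decisionNode, dif_neg hn]
    cases hφ : φ s with
    | true => exact iff_of_true .terminal rfl
    | false => exact iff_of_false (fun h => BDD.not_accepts_false _ _ h rfl) (by simp)
  | succ d ih =>
    have hn : k < n := by omega
    have hinner : (decisionDiagram φ v default).Inner (decisionNode φ k s) := by
      rw [decisionNode, dif_pos hn]
      exact ⟨Sum.inr_ne_inl, Sum.inr_ne_inl⟩
    have hlabel : (decisionDiagram φ v default).label (decisionNode φ k s) = v ⟨k, hn⟩ := by
      rw [decisionNode, dif_pos hn]; rfl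
    by_cases hV : v ⟨k, hn⟩ ∈ V
    · rw [BDD.accepts_high _ hinner (hlabel ▸ hV)]
      have hhigh : (decisionDiagram φ v default).high (decisionNode φ k s) =
          decisionNode φ (k + 1) (insert ⟨k, hn⟩ s) := by
        rw [decisionNode, dif_pos hn]; rfl
      rw [hhigh, ih (k + 1) hn _ (by omega)]
      refine iff_of_eq (congrArg (fun t => φ t = true) (Finset.ext fun i => ?_))
      simp only [Finset.mem_union, Finset.mem_insert, Finset.mem_filter, Finset.mem_univ, true_and]
      by_cases hik : i = ⟨k, hn⟩
      · subst hik; simp [hV]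
      · have : i.1 ≠ k := fun h => hik (Fin.ext h)
        have : k + 1 ≤ i.1 ↔ k ≤ i.1 := by omega
        rw [this]; simp [hik]
    · rw [BDD.accepts_low _ hinner (hlabel ▸ hV)]
      have hlow : (decisionDiagram φ v default).low (decisionNode φ k s) =
          decisionNode φ (k + 1) s := by
        rw [decisionNode, dif_pos hn]; rfl
      rw [hlow, ih (k + 1) hn _ (by omega)]
      refine iff_of_eq (congrArg (fun t => φ t = true) (Finset.ext fun i => ?_))
      simp only [Finset.mem_union, Finset.mem_filter, Finset.mem_univ, true_and]
      by_cases hik : i = ⟨k, hn⟩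
      · subst hik; simp [hV]
      · have : i.1 ≠ k := fun h => hik (Fin.ext h)
        have : k + 1 ≤ i.1 ↔ k ≤ i.1 := by omega
        rw [this]

open Classical in
theorem exists_represents {NC NR : Type u} {T : Set (Concept NC NR)} (hT : T.Finite) :
    ∃ (Node : Type) (O : BDD Node (BVar NC NR)), O.Represents T := by
  have hfin : Finite (vars T) := finite_vars hT
  let e := Finite.equivFin (vars T)
  let n := Nat.card (vars T)
  let v : Fin n → BVar NC NR := fun i => (e.symm i).1
  let φ : Finset (Fin n) → Bool := fun s => decide (tboxFun T (v '' s))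
  -- The last argument labels the terminal nodes, where labels are irrelevant.
  refine ⟨_, decisionDiagram φ v (.fst .top), ?_, ?_⟩
  · rintro (b | p) hm
    · cases b
      · exact (hm.2 rfl).elim
      · exact (hm.1 rfl).elim
    · exact (e.symm p.1).2
  · intro V hV
    have h := accepts_decisionNode φ v (.fst .top) V 0 (Nat.zero_le _) ∅
    refine h.trans ?_
    simp only [Finset.empty_union, Nat.zero_le, true_and, φ, decide_eq_true_eq]
    refine iff_of_eq (congrArg (tboxFun T) ?_)
    ext w
    simp only [Finset.coe_filter, Finset.mem_univ, true_and, Set.mem_image, Set.mem_ofPred_eq]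
    constructor
    · rintro ⟨i, hi, rfl⟩
      exact hi
    · intro hw
      have hv : v (e ⟨w, hV hw⟩) = w := congrArg Subtype.val (e.symm_apply_apply _)
      exact ⟨e ⟨w, hV hw⟩, by rwa [hv], hv⟩

end Diagrams

/-! ### The disjunctive Datalog program -/

section Datalog

variable {Node : Type}

/-- The ground atoms of the program over the original predicates coincide with those of `I`. -/
structure DInterp.NamedEq (J : DInterp NC NR NI Node) (I : Interp NC NR NI) : Prop where
  con : ∀ A a, J.ind a ∈ J.con (.name A) ↔ I.ind a ∈ I.con A
  rol : ∀ r a b, J.rol r (J.ind a) (J.ind b) ↔ I.rol r (I.ind a) (I.ind b)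
  eq : ∀ a b, J.ind a = J.ind b ↔ I.ind a = I.ind b

theorem DInterp.NamedEq.trans {J : DInterp NC NR NI Node} {I I' : Interp NC NR NI}
    (h : J.NamedEq I) (h' : I.NamedEq I') : J.NamedEq I' :=
  ⟨fun A a => (h.con A a).trans (h'.con A a), fun r a b => (h.rol r a b).trans (h'.rol r a b),
    fun a b => (h.eq a b).trans (h'.eq a b)⟩

theorem DInterp.term_inst (J : DInterp NC NR NI Node) (z : ℕ → NI) (t : Term NI) :
    J.term (fun v => J.ind (z v)) t = J.ind (t.inst z) := by cases t <;> rfl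

theorem DInterp.NamedEq.satAtom_iff {J : DInterp NC NR NI Node} {I : Interp NC NR NI}
    (h : J.NamedEq I) (z : ℕ → NI) (α : Atom NC NR NI) :
    J.SatAtom (fun v => J.ind (z v)) (α.toDatalog Node) ↔ I.Ground z α := by
  cases α <;> simp only [Atom.toDatalog, DInterp.SatAtom, Interp.Ground, Interp.SatAtom,
    DInterp.term_inst, Interp.term_inst, h.con, h.rol, h.eq]

/-! #### From models of the knowledge base to models of the program -/

/-- The domino of a pair of elements. -/
def Interp.domino (I : Interp NC NR NI) (T : Set (Concept NC NR)) (x y : I.Domain) :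
    Set (BVar NC NR) :=
  DL.domino (I.typeOf (parts T) x) (I.edge (tboxRoles T) x y) (I.typeOf (parts T) y)

theorem Interp.domino_subset (I : Interp NC NR NI) (T : Set (Concept NC NR)) (x y : I.Domain) :
    I.domino T x y ⊆ vars T :=
  domino_subset_vars.2 ⟨fun _ h => h.1, fun _ h => h.1, fun _ h => h.1⟩

/-- Dominoes with the same first type differ only in the quantified variables, so any of them may
serve as a witness for the other. -/
theorem existsVars_domino {T : Set (Concept NC NR)} {s s' s'' : Set (Concept NC NR)}
    {ρ ρ' : Set (Role NR)} {Q : BFun NC NR} (hd : IsDomino T s ρ s') (hd' : IsDomino T s ρ' s'')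
    (h : Q (domino s ρ' s'')) : existsVars (successorVars T) Q (domino s ρ s') := by
  refine ⟨domino s ρ' s'' ∩ successorVars T, Set.inter_subset_right, ?_⟩
  convert h using 1
  have hS : ∀ C, BVar.fst C ∉ successorVars T := by
    rintro C (⟨R, -, h⟩ | ⟨D, -, h⟩) <;> cases h
  ext v
  cases v with
  | fst C =>
    constructor
    · rintro (h | h)
      exacts [(hS C h.2).elim, h.1]
    · exact fun h => .inr ⟨h, hS C⟩
  | snd C =>
    constructor
    · rintro (h | h)
      exacts [h.1, (h.2 (.inr ⟨C, hd.2.1 h.1, rfl⟩)).elim]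
    · exact fun h => .inl ⟨h, .inr ⟨C, hd'.2.1 h, rfl⟩⟩
  | role R =>
    constructor
    · rintro (h | h)
      exacts [h.1, (h.2 (.inl ⟨R, hd.2.2 R h.1, rfl⟩)).elim]
    · exact fun h => .inl ⟨h, .inl ⟨R, hd'.2.2 R h, rfl⟩⟩

/-- Real elements are their own witnesses: a semantic successor `z` of `x` yields the domino of `x`
and `z`, which satisfies the previous stage by the induction hypothesis for all pairs, and swapping
the domino of `x,y` gives that of `y,x`. -/
theorem Interp.tboxFun_domino {I : Interp NC NR NI} {T : Set (Concept NC NR)}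
    (hI : ∀ C ∈ T, ∀ x, x ∈ I.concept C) (hT : ∀ X ∈ parts T, X.BodyIn Concept.IsName)
    (x y : I.Domain) : tboxFun T (I.domino T x y) := by
  have hd : ∀ x y, IsDomino T (I.typeOf (parts T) x) (I.edge (tboxRoles T) x y)
      (I.typeOf (parts T) y) := fun x y => domino_subset_vars.1 (I.domino_subset T x y)
  have hnames : ∀ {X : Concept NC NR}, X ∈ parts T → X.roleNames ⊆ tboxRoles T := by
    rintro X ⟨C, hC, hX⟩ r hr
    exact ⟨C, hC, Concept.roleNames_of_mem_parts hX hr⟩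
  have hname : ∀ {D : Concept NC NR}, D.IsName → D ∈ D.parts := by
    rintro _ ⟨A, rfl⟩
    exact rfl
  have hall : ∀ {U : RoleExpr NR} {C : Concept NC NR}, .all U C ∈ parts T → C ∈ parts T :=
    fun h => parts_subset_of_all h (fun _ h => .inr h) (hname (hT _ h))
  have hex : ∀ {U : RoleExpr NR} {C : Concept NC NR}, .ex U C ∈ parts T → C ∈ parts T :=
    fun h => parts_subset_of_all h (fun _ h => .inr h) (hname (hT _ h))
  intro i
  induction i generalizing x y with
  | zero =>
    refine ⟨fun C hC => ?_, fun U C hP ⟨h1, h2⟩ => ?_, fun U C hP ⟨h1, h2⟩ => ?_⟩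
    · have hparts : C.parts ⊆ parts T := fun X hX => ⟨C, hC, hX⟩
      exact (C.bfun_domino ..).2 ((I.holds_typeOf hparts x).2 (hI C hC x))
    · replace h2 := (U.bfun_domino ..).1 h2
      rw [← I.roleExpr_iff_edge fun _ h => hnames hP (.inl h)] at h2
      exact ⟨hall hP, h1.2 y h2⟩
    · replace h2 := (U.bfun_domino ..).1 h2
      rw [← I.roleExpr_iff_edge fun _ h => hnames hP (.inl h)] at h2
      exact ⟨hP, y, h2, h1.2⟩
  | succ i ih =>
    refine ⟨ih x y, fun U C hP ⟨_, z, hz, hC⟩ => ?_, fun U C hP hx => ?_, ?_⟩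
    · refine existsVars_domino (hd x y) (hd x z) ⟨ih x z, (U.bfun_domino ..).2 ?_, hex hP, hC⟩
      exact (I.roleExpr_iff_edge (fun _ h => hnames hP (.inl h)) x z).1 hz
    · have hx' : x ∉ I.concept (.all U C) := fun h => hx ⟨hP, h⟩
      obtain ⟨z, hz'⟩ := not_forall.1 hx'
      obtain ⟨hz, hC⟩ := Classical.not_imp.1 hz'
      refine existsVars_domino (hd x y) (hd x z)
        ⟨ih x z, (U.bfun_domino ..).2 ?_, fun h => hC h.2⟩
      exact (I.roleExpr_iff_edge (fun _ h => hnames hP (.inl h)) x z).1 hz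
    · have hs : swapVars (I.domino T x y) = I.domino T y x := by
        rw [Interp.domino, swapVars_domino, I.invSet_edge]
        rfl
      rw [hs]
      exact ih y x

/-- The Datalog interpretation given by the named elements of `I`. -/
def Interp.toDatalog (I : Interp NC NR NI) (T : Set (Concept NC NR))
    (O : BDD Node (BVar NC NR)) : DInterp NC NR NI Node where
  Domain := Set.range I.ind
  ind a := ⟨I.ind a, a, rfl⟩
  con C := {x | x.1 ∈ I.concept C}
  rol r x y := I.rol r x.1 y.1
  node m x y := O.Accepts (I.domino T x.1 y.1) m

theorem Interp.namedEq_toDatalog (I : Interp NC NR NI) (T : Set (Concept NC NR))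
    (O : BDD Node (BVar NC NR)) : (I.toDatalog T O).NamedEq I :=
  ⟨fun _ _ => Iff.rfl, fun _ _ _ => Iff.rfl, fun _ _ => Subtype.mk_eq_mk⟩

theorem Interp.toDatalog_test (I : Interp NC NR NI) {T : Set (Concept NC NR)}
    (O : BDD Node (BVar NC NR)) {v : BVar NC NR} (hv : v ∈ vars T)
    (Z : ℕ → (I.toDatalog T O).Domain) :
    (I.toDatalog T O).SatAtom Z (v.test Node) ↔ v ∈ I.domino T (Z 0).1 (Z 1).1 := by
  rcases hv with (⟨R, hR, rfl⟩ | ⟨C, hC, rfl⟩) | ⟨C, hC, rfl⟩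
  · cases R <;> exact (and_iff_right hR).symm
  · exact (and_iff_right hC).symm
  · exact (and_iff_right hC).symm

theorem Interp.toDatalog_models {I : Interp NC NR NI} {T : Set (Concept NC NR)}
    {O : BDD Node (BVar NC NR)} {rules : Set (Rule NC NR NI)} (hO : O.Represents T)
    (hI : ∀ C ∈ T, ∀ x, x ∈ I.concept C) (hT : ∀ X ∈ parts T, X.BodyIn Concept.IsName)
    (hrules : ∀ ρ ∈ rules, I.SatRule ρ) :
    (I.toDatalog T O).Models {ρ | DDRule O rules ρ} := by
  have hnamed := I.namedEq_toDatalog T O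
  have hbody : ∀ (z : ℕ → NI) (l : List (Atom NC NR NI)), (∀ α ∈ l.map (Atom.toDatalog Node),
      (I.toDatalog T O).SatAtom (fun v => (I.toDatalog T O).ind (z v)) α) →
      ∀ α ∈ l, I.Ground z α := fun z l h α hα =>
    (hnamed.satAtom_iff z α).1 (h _ (List.mem_map_of_mem hα))
  have hZ : ∀ Z : ℕ → (I.toDatalog T O).Domain, ∃ z : ℕ → NI,
      Z = fun v => (I.toDatalog T O).ind (z v) := by
    intro Z
    choose z hz using fun v => (Z v).2
    exact ⟨z, funext fun v => Subtype.ext (hz v).symm⟩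
  rintro _ hρ Z hb
  cases hρ with
  | @safe ρ α hρ hα =>
    obtain ⟨z, rfl⟩ := hZ Z
    have := ((I.satRule_iff ρ).1 (hrules ρ hρ) z (hbody z _ hb)).2 α hα
    exact ⟨_, List.mem_singleton_self _, (hnamed.satAtom_iff z α).2 this⟩
  | @constraint ρ hρ hh =>
    obtain ⟨z, rfl⟩ := hZ Z
    exact (((I.satRule_iff ρ).1 (hrules ρ hρ) z (hbody z _ hb)).1 hh).elim
  | root =>
    exact ⟨_, List.mem_singleton_self _,
      (hO.2 _ (I.domino_subset T _ _)).2 (Interp.tboxFun_domino hI hT _ _)⟩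
  | false_ => exact (BDD.not_accepts_false O _ (hb _ (List.mem_singleton_self _)) rfl).elim
  | @high m hm =>
    have h1 := (I.toDatalog_test O (hO.1 m hm) Z).1 (hb _ List.mem_cons_self)
    have h2 := hb _ (List.mem_cons_of_mem _ (List.mem_singleton_self _))
    exact ⟨_, List.mem_singleton_self _, (O.accepts_high hm h1).1 h2⟩
  | @low m hm =>
    have h2 := hb _ (List.mem_singleton_self _)
    -- The two disjuncts of the head correspond to the value of the tested variable; if it is false,
    -- acceptance passes to the low successor.
    by_cases h1 : O.label m ∈ I.domino T (Z 0).1 (Z 1).1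
    · exact ⟨_, List.mem_cons_of_mem _ (List.mem_singleton_self _),
        (I.toDatalog_test O (hO.1 m hm) Z).2 h1⟩
    · exact ⟨_, List.mem_cons_self, (O.accepts_low hm h1).1 h2⟩

/-! #### From models of the program to models of the knowledge base -/

/-- The named elements of a Datalog interpretation. -/
def DInterp.named (J : DInterp NC NR NI Node) : Interp NC NR NI where
  Domain := Set.range J.ind
  ind a := ⟨J.ind a, a, rfl⟩
  con A := {x | x.1 ∈ J.con (.name A)}
  rol r x y := J.rol r x.1 y.1

theorem DInterp.namedEq_named (J : DInterp NC NR NI Node) : J.NamedEq J.named :=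
  ⟨fun _ _ => Iff.rfl, fun _ _ _ => Iff.rfl, fun _ _ => Subtype.mk_eq_mk.symm⟩

/-- The parts of `T` that hold at an element according to `J`. -/
def DInterp.typeOf (J : DInterp NC NR NI Node) (T : Set (Concept NC NR)) (x : J.named.Domain) :
    Set (Concept NC NR) := {C | C ∈ parts T ∧ x.1 ∈ J.con C}

/-- The descendant relation is transitive and irreflexive on a finite set of nodes, hence
well-founded. -/
theorem BDD.induction {Var : Type u} (O : BDD Node Var) {Q : Node → Prop}
    (h : ∀ m, (O.Inner m → Q (O.low m) ∧ Q (O.high m)) → Q m) (m : Node) : Q m := by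
  have := O.node_finite
  let r : Node → Node → Prop := fun m' m => Relation.TransGen
    (fun m m' => (m ≠ O.true_ ∧ m ≠ O.false_) ∧ (m' = O.low m ∨ m' = O.high m)) m m'
  have : IsTrans Node r := ⟨fun _ _ _ h h' => h'.trans h⟩
  have : Std.Irrefl r := ⟨fun m => O.acyclic m⟩
  have hwf : WellFounded r := Finite.wellFounded_of_trans_of_irrefl r
  exact hwf.induction m fun m ih => h m fun hm =>
    ⟨ih _ (.single ⟨hm, .inl rfl⟩), ih _ (.single ⟨hm, .inr rfl⟩)⟩

/-- The facts of `J` select one path downwards from the node: the rule for `high` applies when the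
tested atom holds, and otherwise the rule for `low` leaves only its first disjunct. The path cannot
end in the false node, where a constraint would be violated. -/
theorem DInterp.accepts_of_node {J : DInterp NC NR NI Node} {T : Set (Concept NC NR)}
    {O : BDD Node (BVar NC NR)} {rules : Set (Rule NC NR NI)} (hO : O.Represents T)
    (hJ : J.Models {ρ | DDRule O rules ρ}) (x y : J.named.Domain) (m : Node) :
    J.node m x.1 y.1 → O.Accepts
      (domino (J.typeOf T x) (J.named.edge (tboxRoles T) x y) (J.typeOf T y)) m := by
  let Z : ℕ → J.Domain := fun i => if i = 0 then x.1 else y.1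
  have htest : ∀ v ∈ vars T, J.SatAtom Z (v.test Node) ↔
      v ∈ domino (J.typeOf T x) (J.named.edge (tboxRoles T) x y) (J.typeOf T y) := by
    rintro v ((⟨R, hR, rfl⟩ | ⟨C, hC, rfl⟩) | ⟨C, hC, rfl⟩)
    · cases R <;> exact (and_iff_right hR).symm
    · exact (and_iff_right hC).symm
    · exact (and_iff_right hC).symm
  refine O.induction (Q := fun m => J.node m x.1 y.1 → O.Accepts
    (domino (J.typeOf T x) (J.named.edge (tboxRoles T) x y) (J.typeOf T y)) m)
    (fun m ih hm => ?_) m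
  by_cases hinner : O.Inner m
  · by_cases hv : O.label m ∈
        domino (J.typeOf T x) (J.named.edge (tboxRoles T) x y) (J.typeOf T y)
    · refine (O.accepts_high hinner hv).2 ((ih hinner).2 ?_)
      obtain ⟨α, hα, hα'⟩ := hJ _ (DDRule.high hinner) Z (by
        intro α hα
        simp only [List.mem_cons, List.not_mem_nil, or_false] at hα
        rcases hα with rfl | rfl
        · exact (htest _ (hO.1 m hinner)).2 hv
        · exact hm)
      obtain rfl := List.mem_singleton.1 hα
      exact hα'
    · refine (O.accepts_low hinner hv).2 ((ih hinner).1 ?_)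
      obtain ⟨α, hα, hα'⟩ := hJ _ (DDRule.low hinner) Z (by
        intro α hα
        obtain rfl := List.mem_singleton.1 hα
        exact hm)
      simp only [List.mem_cons, List.not_mem_nil, or_false] at hα
      rcases hα with rfl | rfl
      · exact hα'
      · exact (hv ((htest _ (hO.1 m hinner)).1 hα')).elim
  · rw [BDD.Inner, not_and_or, not_not, not_not] at hinner
    rcases hinner with rfl | rfl
    · exact .terminal
    · obtain ⟨α, hα, -⟩ := hJ _ DDRule.false_ Z (by
        intro α hα
        obtain rfl := List.mem_singleton.1 hα
        exact hm)
      cases hα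

theorem DInterp.exists_model {J : DInterp NC NR NI Node} {T : Set (Concept NC NR)}
    {O : BDD Node (BVar NC NR)} {rules : Set (Rule NC NR NI)} (hfin : T.Finite)
    (hT : ∀ X ∈ parts T, (X.RestrQ ∧ X.NumFree) ∧ X.BodyIn Concept.IsName)
    (hO : O.Represents T) (hJ : J.Models {ρ | DDRule O rules ρ}) :
    ∃ M : Interp NC NR NI, (∀ C ∈ T, ∀ x, x ∈ M.concept C) ∧ (∀ ρ ∈ rules, M.SatRule ρ) ∧
      J.NamedEq M := by
  have hd : ∀ x y : J.named.Domain,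
      domino (J.typeOf T x) (J.named.edge (tboxRoles T) x y) (J.typeOf T y) ⊆ vars T := fun x y =>
    domino_subset_vars.2 ⟨fun _ h => h.1, fun _ h => h.1, fun _ h => h.1⟩
  obtain ⟨M, hM, heq⟩ := exists_model_of_dominoes hfin hT J.named
    (by rintro ⟨_, a, rfl⟩; exact ⟨a, rfl⟩) (J.typeOf T) (fun _ _ h => h.1)
    (fun A hA x => (and_iff_right hA).symm) fun x y => by
      refine (hO.2 _ (hd x y)).1 (DInterp.accepts_of_node hO hJ x y O.root ?_)
      obtain ⟨α, hα, hα'⟩ := hJ _ DDRule.root (fun i => if i = 0 then x.1 else y.1)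
        (fun α hα => by cases hα)
      obtain rfl := List.mem_singleton.1 hα
      exact hα'
  have hJM : J.NamedEq M := J.namedEq_named.trans heq
  refine ⟨M, hM, fun ρ hρ => ?_, hJM⟩
  rw [Interp.satRule_iff]
  intro z hz
  have hz' : ∀ α ∈ ρ.body.map (Atom.toDatalog Node),
      J.SatAtom (fun v => J.ind (z v)) α := by
    intro α hα
    obtain ⟨β, hβ, rfl⟩ := List.mem_map.1 hα
    exact (hJM.satAtom_iff z β).2 (hz β hβ)
  constructor
  · intro hh
    obtain ⟨α, hα, -⟩ := hJ _ (DDRule.constraint hρ hh) _ hz'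
    cases hα
  · intro α hα
    obtain ⟨β, hβ, hβ'⟩ := hJ _ (DDRule.safe hρ hα) _ hz'
    obtain rfl := List.mem_singleton.1 hβ
    exact (hJM.satAtom_iff z α).1 hβ'

/-! ### The transformation as a whole -/

variable {K : KnowledgeBase NC NR NI}

theorem KnowledgeBase.exists_thetaSHIQ (hK : K.IsSHIQbs) :
    ∃ K' : UKB (Name NC) (Name NR) NI, K.ThetaSHIQ K' := by
  obtain ⟨self, -, hself⟩ := (Role.finite_transitive hK.lift.rbox_finite).exists_injOn_of_encard_le
    (t := (Set.univ : Set ℕ)) (by simp)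
  have hS := KnowledgeBase.thetaS_fin hK.lift fun R => Name.fresh (self R)
  obtain ⟨L, hL⟩ := exists_flat hS
  obtain ⟨K₁, hK₁⟩ := exists_geExhausts (hL.fin hS)
  have h1 : K₁.IsFinite := Exhausts.invariant hK₁ (fun _ _ h hK => h.fin hK) (hL.fin hS)
  obtain ⟨L', hL'⟩ := exists_flat h1.thetaH
  obtain ⟨K₂, hK₂⟩ := exists_leExhausts (hL'.fin h1.thetaH)
  exact ⟨_, self, K₁, K₂, hself, ⟨L, hL, hK₁⟩, ⟨L', hL', hK₂⟩, rfl⟩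

/-- What is needed about the results of the transformation. -/
structure KnowledgeBase.ThetaSpec (K : KnowledgeBase NC NR NI)
    (K' : UKB (Name NC) (Name NR) NI) : Prop where
  fin : K'.IsFinite
  rbox : K'.rbox = ∅
  shape : ∀ E ∈ K'.tbox, E.AllParts fun X => X.RestrQ ∧ X.NumFree
  sound : ∀ I : Interp NC NR NI, I.Models K → ∃ I', K'.IsModel I' ∧ I.NamedEq I'.reduct
  complete : ∀ M, K'.IsModel M → ∃ I : Interp NC NR NI, I.Models K ∧ M.reduct.NamedEq I

/-- Soundness composes the model extensions of all steps. For completeness the one-step reflections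
need a genuine model before `Θ_F`, supplied by the forest model; its forest shape is needed again
for the transitive closure. -/
theorem KnowledgeBase.ThetaSHIQ.spec (hK : K.IsSHIQbs) {K' : UKB (Name NC) (Name NR) NI}
    (h : K.ThetaSHIQ K') : K.ThetaSpec K' := by
  obtain ⟨self, K₁, K₂, hself, ⟨L, hL, hK₁⟩, ⟨L', hL', hK₂⟩, rfl⟩ := h
  have finS := KnowledgeBase.thetaS_fin hK.lift fun R => Name.fresh (self R)
  have finL := hL.fin finS
  have fin1 : K₁.IsFinite := Exhausts.invariant hK₁ (fun _ _ h hK => h.fin hK) finL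
  have finL' := hL'.fin fin1.thetaH
  have fin2 : K₂.IsFinite := Exhausts.invariant hK₂ (fun _ _ h hK => h.fin hK) finL'
  have shL : L.Shaped Concept.GeShape := by
    refine UKB.Shaped.imp (hL.shaped dualStable_restrQ.flatStable finS
      (UKB.shaped_nnf dualStable_restrQ (KnowledgeBase.thetaS_allParts hK.lift _))) ?_
    rintro X ⟨h1, h2⟩
    refine ⟨h1, ?_, ?_⟩ <;> cases X <;> first | trivial | exact .inl h2
  have sh1 : K₁.Shaped Concept.GeShape :=
    Exhausts.invariant hK₁ (fun _ _ h hK => h.shaped hK) shL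
  have incl1 : InclOnly K₁.rbox := by
    refine Exhausts.invariant (P := fun K => InclOnly K.rbox) hK₁
      (fun _ _ h hK => h.inclOnly hK) ?_
    rw [hL.rbox]
    exact KnowledgeBase.thetaS_inclOnly hK.lift _
  have shH : K₁.thetaH.Shaped Concept.LeShape := (hK₁.noGe fin1 sh1).thetaH incl1
  -- The knowledge base is already in negation normal form, so the initial normalization of the
  -- second flattening does not bring back at-least restrictions.
  have shL' := hL'.shaped flatStable_leShape fin1.thetaH (shH.nnf_eq.symm ▸ shH)
  have inv2 : K₂.LeInvariant := by
    refine Exhausts.invariant hK₂ (fun _ _ h hK => h.leInvariant hK) fun E hE _ => ?_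
    refine ⟨(shL' E hE).1, fun X hX => ⟨((shL' E hE).2 X hX).1, ?_⟩⟩
    have h2 := ((shL' E hE).2 X hX).2
    cases X <;> first | trivial | exact .inl h2
  have hnum := hK₂.numFree fin2 inv2
  have rbox2 : K₂.rbox = ∅ := by
    refine Exhausts.invariant (P := fun K => K.rbox = ∅) hK₂ ?_ (hL'.rbox.trans incl1.thetaH_rbox)
    rintro _ _ ⟨E, E', C, n, R, f, -, -, -, -, -, rfl⟩ h
    exact h
  refine ⟨fin2.thetaF, rbox2, UKB.thetaF_allParts hnum, fun I hI => ?_, fun M hM => ?_⟩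
  · obtain ⟨I₀, rfl⟩ := I.exists_reduct
    obtain ⟨I₁, hI₁, e₁⟩ := K.thetaS_extends hself (Interp.reduct_models.1 hI)
    obtain ⟨I₂, hI₂, e₂⟩ := hL.extends I₁ hI₁
    obtain ⟨I₃, hI₃, e₃⟩ := hK₁.extends (fun _ _ => GeStep.extends) I₂ hI₂
    obtain ⟨I₄, hI₄, e₄⟩ := hL'.extends I₃ (UKB.isModel_thetaH.2 hI₃)
    obtain ⟨I₅, hI₅, e₅⟩ := hK₂.extends (fun _ _ => LeStep.extends) I₄ hI₄
    exact ⟨I₅, hI₅.thetaF, e₁.trans (e₂.trans (e₃.trans (e₄.trans e₅)))⟩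
  · obtain ⟨N, hN, hforest, e⟩ := UKB.exists_forest_model rbox2 hnum hM
    have hN₁ := UKB.isModel_thetaH.1
      (hL'.reflects N (hK₂.reflects (fun _ _ => LeStep.reflects) N hN))
    have hN₂ := hL.reflects N (hK₁.reflects (fun _ _ => GeStep.reflects) N hN₁)
    -- The reflections do not alter the interpretation, so `N` is still forest-like when the
    -- transitive closure is taken.
    obtain ⟨h1, h2⟩ := KnowledgeBase.closure_models hK.lift hN₂ hforest
    exact ⟨_, Interp.reduct_models.2 h1, (e.trans h2).reduct⟩

/-- The original ground atoms of a Datalog interpretation coincide with those of `I`. -/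
def Interp.SameFacts (I : Interp NC NR NI) (J : DInterp (Name NC) (Name NR) NI Node) : Prop :=
  (∀ A a, I.ind a ∈ I.con A ↔ J.ind a ∈ J.con (.name (.orig A))) ∧
  (∀ r a b, I.rol r (I.ind a) (I.ind b) ↔ J.rol (.orig r) (J.ind a) (J.ind b)) ∧
  ∀ a b, I.ind a = I.ind b ↔ J.ind a = J.ind b

theorem Interp.NamedEq.sameFacts {I : Interp NC NR NI} {M : Interp (Name NC) (Name NR) NI}
    {J : DInterp (Name NC) (Name NR) NI Node} (h : I.NamedEq M.reduct) (h' : J.NamedEq M) :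
    I.SameFacts J :=
  ⟨fun A a => (h.con A a).trans (h'.con _ a).symm,
    fun r a b => (h.rol r a b).trans (h'.rol _ a b).symm,
    fun a b => (h.eq a b).trans (h'.eq a b).symm⟩

theorem UKB.exists_isDD {K' : UKB (Name NC) (Name NR) NI} (h : K'.IsFinite) :
    ∃ (Node : Type) (P : Program (Name NC) (Name NR) NI Node), K'.IsDD P := by
  obtain ⟨L, hL⟩ := exists_flat h
  obtain ⟨Node, O, hO⟩ := exists_represents (hL.fin h).tbox
  exact ⟨Node, _, L, O, hL, hO, rfl⟩

theorem KnowledgeBase.ThetaSpec.program {K' : UKB (Name NC) (Name NR) NI} (h : K.ThetaSpec K')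
    {P : Program (Name NC) (Name NR) NI Node} (hP : K'.IsDD P) :
    (∀ I : Interp NC NR NI, I.Models K → ∃ J, DInterp.Models J P ∧ I.SameFacts J) ∧
    ∀ J, DInterp.Models J P → ∃ I : Interp NC NR NI, I.Models K ∧ I.SameFacts J := by
  obtain ⟨L, O, hL, hO, rfl⟩ := hP
  have hshape := hL.shaped dualStable_restrQ_numFree.flatStable h.fin
    (UKB.shaped_nnf dualStable_restrQ_numFree h.shape)
  have hT : ∀ X ∈ parts L.tbox, (X.RestrQ ∧ X.NumFree) ∧ X.BodyIn Concept.IsName :=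
    fun X ⟨C, hC, hX⟩ => (hshape C hC).2 X hX
  constructor
  · intro I hI
    obtain ⟨I', hI', e⟩ := h.sound I hI
    obtain ⟨I'', hI'', e'⟩ := hL.extends I' hI'
    exact ⟨I''.toDatalog L.tbox O, Interp.toDatalog_models hO hI''.1 (fun X hX => (hT X hX).2)
      (hL.rules ▸ hI''.2.2), (e.trans e').sameFacts (I''.namedEq_toDatalog _ _)⟩
  · intro J hJ
    obtain ⟨M, hM, hrules, e⟩ := DInterp.exists_model (hL.fin h.fin).tbox hT hO hJ
    have hML : L.IsModel M := by
      refine ⟨hM, ?_, hL.rules ▸ hrules⟩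
      rw [hL.rbox, h.rbox]
      exact fun _ h => h.elim
    obtain ⟨I, hI, e'⟩ := h.complete M (hL.reflects M hML)
    exact ⟨I, hI, e'.symm.sameFacts e⟩

end Datalog

end DL

theorem mainTheorem1 {NC NR NI : Type u} [Nonempty NI] (K : DL.KnowledgeBase NC NR NI)
    (hK : K.IsSHIQbs) :
    (∃ K' : DL.UKB (DL.Name NC) (DL.Name NR) NI, K.ThetaSHIQ K') ∧
    ∀ K' : DL.UKB (DL.Name NC) (DL.Name NR) NI, K.ThetaSHIQ K' →
      (∃ (Node : Type) (P : DL.Program (DL.Name NC) (DL.Name NR) NI Node), K'.IsDD P) ∧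
      ∀ (Node : Type) (P : DL.Program (DL.Name NC) (DL.Name NR) NI Node), K'.IsDD P →
        (K.Satisfiable ↔ P.Satisfiable) ∧
        (∀ (C : NC) (a : NI), K.EntailsConcept C a ↔ P.EntailsConcept (.name (.orig C)) a) ∧
        (∀ (R : NR) (a b : NI), K.EntailsRole R a b ↔ P.EntailsRole (.orig R) a b) ∧
        (∀ a b : NI, K.EntailsEq a b ↔ P.EntailsEq a b) := by
  refine ⟨DL.KnowledgeBase.exists_thetaSHIQ hK, fun K' hK' => ?_⟩
  have hspec := hK'.spec hK
  refine ⟨DL.UKB.exists_isDD hspec.fin, fun Node P hP => ?_⟩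
  -- All claims follow from these two transfers: satisfiability directly, entailments by moving a
  -- given model to the other side and reading off the same ground atom.
  obtain ⟨fwd, bwd⟩ := hspec.program hP
  refine ⟨⟨?_, ?_⟩, fun C a => ⟨fun h J hJ => ?_, fun h I hI => ?_⟩,
    fun R a b => ⟨fun h J hJ => ?_, fun h I hI => ?_⟩,
    fun a b => ⟨fun h J hJ => ?_, fun h I hI => ?_⟩⟩
  · rintro ⟨I, hI⟩
    obtain ⟨J, hJ, -⟩ := fwd I hI
    exact ⟨J, hJ⟩
  · rintro ⟨J, hJ⟩
    obtain ⟨I, hI, -⟩ := bwd J hJ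
    exact ⟨I, hI⟩
  · obtain ⟨I, hI, e⟩ := bwd J hJ
    exact (e.1 C a).1 (h I hI)
  · obtain ⟨J, hJ, e⟩ := fwd I hI
    exact (e.1 C a).2 (h J hJ)
  · obtain ⟨I, hI, e⟩ := bwd J hJ
    exact (e.2.1 R a b).1 (h I hI)
  · obtain ⟨J, hJ, e⟩ := fwd I hI
    exact (e.2.1 R a b).2 (h J hJ)
  · obtain ⟨I, hI, e⟩ := bwd J hJ
    exact (e.2.2 a b).1 (h I hI)
  · obtain ⟨J, hJ, e⟩ := fwd I hI
    exact (e.2.2 a b).2 (h J hJ)
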